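/- **Conventions.** Let $V$ be a set of variables. Product-free Lambek categories are built from the base category $\mathsf{s}$ and the $x\in V$ with $A\backslash B$ and $B/A$. They are translated into polarised formulae of multiplicative linear logic by $+\alpha=\alpha$, $-\alpha=\alpha^\perp$, $+(A\backslash B)=-A\,⅋\,{+B}$, $-(A\backslash B)=-B\otimes +A$, $+(B/A)=+B\,⅋\,{-A}$, $-(B/A)=+A\otimes -B$; linear negation reverses the order, $(F⅋G)^\perp=G^\perp\otimes F^\perp$ and $(F\otimes G)^\perp=G^\perp⅋F^\perp$. Output and input formulae are $O ::= \alpha\mid I⅋O\mid O⅋I$ and $I ::= \alpha^\perp\mid O\otimes I\mid I\otimes O$. *Natural deduction.* The rules are: the hypothesis $A\vdash A$; from $A,\Gamma\vdash B$ infer $\Gamma\vdash A\backslash B$, and from $\Gamma,A\vdash B$ infer $\Gamma\vdash B/A$, in both cases with $\Gamma$ non-empty; from $\Delta\vdash A$ and $\Gamma\vdash A\backslash B$ infer $\Delta,\Gamma\vdash B$; from $\Gamma\vdash B/A$ and $\Delta\vdash A$ infer $\Gamma,\Delta\vdash B$. A deduction is normal if no principal (functor) premise of an elimination is the conclusion of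 an introduction. *Proof nets.* A cut-free proof structure is a cyclic sequence of conclusions. Each conclusion comes with a tree of subformulae, which may stop at complex formulae, and axiom links pair the leaves, each link joining some $F$ to $F^\perp$. It is a (product-free Lambek) proof net if (1) every cycle of its graph contains both branches of some ⅋-link; (2) exactly one conclusion is an output formula and all others are input formulae; (3) no two axioms cross; (4) no sub proof net (a sub-structure satisfying (1)–(3)) has a single conclusion. Proof structures that differ only by the names of the axiom links are identified. **Theorem.** 1. For all categories $C$ and all finite sequences $\Gamma=H_1,\dots,H_n$ of categories, there is a bijection between the normal natural deductions of $\Gamma\vdash C$ and the cut-free proof nets with conclusions $-H_n,\dots,-H_1,+C$. * From left to right it is the following inductive translation. An introduction becomes a ⅋-link. A deduction of $X_0$ that is a hypothesis or ends with an elimination has a principal branch $X_0,\dots,X_p$, from its conclusion up to a hypothesis. One starts from the axiom $-X_0,+X_0$ and successively, for $k=1,\dots,p$, joins the conclusion $-X_{k-1}$ to the output of the translation of the deduction of the other premise $G_k$ by a $\otimes$-link with conclusion $-X_k$. In particular no cut is introduced. * From right to left it is the climbing algorithm. Enter by the output conclusion and go up through ⅋-links (abstractions $\lambda_l,\lambda_r$)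 to an axiom. Cross the axiom and go down through $\otimes$-links (applications) until a conclusion or a premise of a ⅋-link is reached; this occurrence names the head variable. Then climb in the same way from the output premises of the $\otimes$-links that were met. On every proof net the algorithm produces exactly one Lambek $\lambda$-term. In this term each variable occurs once, the free variables are the input conclusions in the order $H_1,\dots,H_n$, the type is $C$, $\lambda_l$ (respectively $\lambda_r$) binds the leftmost (respectively rightmost) free variable, and the term is the normal deduction that corresponds to the net. 2. A *name-free natural deduction frame with conclusion $\mathsf{s}$* is the tree of rules of a normal natural deduction of $\mathsf{s}$ from some hypotheses, with all formulae erased but the final $\mathsf{s}$. An *$\mathsf{s}$ proof frame* is a (product-free) proof net over the two base symbols $\mathsf{s},O$ whose output conclusion is an axiom leaf $\mathsf{s}$ and all of whose other axioms are on $O$ and $I=O^\perp$; the frame of a net with output $\mathsf{s}$ is obtained by replacing each axiom formula accordingly, except for the axiom of the output. There is a bijection between name-free natural deduction frames with conclusion $\mathsf{s}$ and $\mathsf{s}$ proof frames that maps the frame of $d$ to the frame of the translation of $d$, for every normal deduction $d$ of $\mathsf{s}$. For every product-free Lambek grammar $G$ (a finite set of categories for each word), a sentence with a natural deduction frame is generated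 by $G$ if and only if the sentence with the corresponding proof frame is. 3. Let the set of words be finite and $V=\mathbb N$. The class of rigid product-free Lambek grammars (at most one category per word) is learnable in Gold's sense from sentences structured by name-free normal natural deduction frames with conclusion $\mathsf{s}$: there is a partial recursive function $\varphi$ from finite sequences of structured sentences to rigid grammars such that, for every rigid grammar $G$ and every enumeration $(e_i)_{i\in\mathbb N}$ of the language of structured sentences of $G$, the values $\varphi(e_0,\dots,e_{P-1})$ are, for all large enough $P$, defined and equal to one grammar which generates the same language as $G$. -/

import Mathlib

namespace Lambek

universe u v

/-! ### Categories and linear formulae -/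

/-- Base categories: the distinguished `s`, and the category variables. -/
inductive Base (V : Type u) : Type u
  | s : Base V
  | var (x : V) : Base V

/-- Product-free Lambek categories. `under A B` is `A \ B`, and `over B A` is `B / A`. -/
inductive Cat (V : Type u) : Type u
  | base (b : Base V) : Cat V
  | under (A B : Cat V) : Cat V
  | over (B A : Cat V) : Cat V

/-- The category `s`. -/
def Cat.s {V : Type u} : Cat V := .base .s

/-- Formulae of multiplicative linear logic; `coatom b` is `b^⊥`. -/
inductive LF (V : Type u) : Type u
  | atom (b : Base V) : LF V
  | coatom (b : Base V) : LF V
  | tens (F G : LF V) : LF V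
  | par (F G : LF V) : LF V

/-- Linear negation, with the order-reversing De Morgan laws. -/
def LF.dual {V : Type u} : LF V → LF V
  | .atom b => .coatom b
  | .coatom b => .atom b
  | .tens F G => .par G.dual F.dual
  | .par F G => .tens G.dual F.dual

mutual

/-- Output (positive) heterogeneous polarised formulae. -/
inductive LF.IsOutput {V : Type u} : LF V → Prop
  | atom (b : Base V) : LF.IsOutput (.atom b)
  | par_left {F G : LF V} : F.IsInput → G.IsOutput → LF.IsOutput (.par F G)
  | par_right {F G : LF V} : F.IsOutput → G.IsInput → LF.IsOutput (.par F G)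

/-- Input (negative) heterogeneous polarised formulae. -/
inductive LF.IsInput {V : Type u} : LF V → Prop
  | coatom (b : Base V) : LF.IsInput (.coatom b)
  | tens_left {F G : LF V} : F.IsOutput → G.IsInput → LF.IsInput (.tens F G)
  | tens_right {F G : LF V} : F.IsInput → G.IsOutput → LF.IsInput (.tens F G)

end

mutual

/-- The output formula `+A` of a category. -/
def Cat.pos {V : Type u} : Cat V → LF V
  | .base b => .atom b
  | .under A B => .par A.neg B.pos
  | .over B A => .par B.pos A.neg

/-- The input formula `-A` of a category. -/
def Cat.neg {V : Type u} : Cat V → LF V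
  | .base b => .coatom b
  | .under A B => .tens B.neg A.pos
  | .over B A => .tens A.pos B.neg

end

/-! ### Natural deduction -/

/-- Natural deductions of the product-free Lambek calculus as plain trees, with labels on the
leaves (the hypotheses, free or cancelled). An introduction rule need not say which hypothesis it
cancels: `introL` cancels the leftmost free one and `introR` the rightmost free one.
The principal premise of `elimL arg fn` and of `elimR fn arg` is `fn`. -/
inductive NDTree (α : Type u) : Type u
  | hyp (a : α) : NDTree α
  | introL (d : NDTree α) : NDTree α
  | introR (d : NDTree α) : NDTree α
  | elimL (arg fn : NDTree α) : NDTree α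
  | elimR (fn arg : NDTree α) : NDTree α

/-- `Derives d Γ C`: the tree `d` is a natural deduction of `C` with sequence `Γ` of free
hypotheses. The antecedent left by an introduction rule must not be empty. -/
inductive Derives {V : Type u} : NDTree (Cat V) → List (Cat V) → Cat V → Prop
  | hyp (A : Cat V) : Derives (.hyp A) [A] A
  | introL {d : NDTree (Cat V)} {A B : Cat V} {Γ : List (Cat V)} :
      Γ ≠ [] → Derives d (A :: Γ) B → Derives (.introL d) Γ (.under A B)
  | introR {d : NDTree (Cat V)} {A B : Cat V} {Γ : List (Cat V)} :
      Γ ≠ [] → Derives d (Γ ++ [A]) B → Derives (.introR d) Γ (.over B A)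
  | elimL {arg fn : NDTree (Cat V)} {A B : Cat V} {Δ Γ : List (Cat V)} :
      Derives arg Δ A → Derives fn Γ (.under A B) → Derives (.elimL arg fn) (Δ ++ Γ) B
  | elimR {fn arg : NDTree (Cat V)} {A B : Cat V} {Γ Δ : List (Cat V)} :
      Derives fn Γ (.over B A) → Derives arg Δ A → Derives (.elimR fn arg) (Γ ++ Δ) B

/-- The last rule is an introduction. -/
def NDTree.IsIntro {α : Type u} : NDTree α → Prop
  | .introL _ => True
  | .introR _ => True
  | _ => False

/-- A deduction is normal when no principal premise of an elimination is the conclusion of an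
introduction. -/
def NDTree.Normal {α : Type u} : NDTree α → Prop
  | .hyp _ => True
  | .introL d => d.Normal
  | .introR d => d.Normal
  | .elimL arg fn => arg.Normal ∧ fn.Normal ∧ ¬ fn.IsIntro
  | .elimR fn arg => fn.Normal ∧ arg.Normal ∧ ¬ fn.IsIntro

/-- Erasure of the names. -/
def NDTree.erase {α : Type u} : NDTree α → NDTree Unit
  | .hyp _ => .hyp ()
  | .introL d => .introL d.erase
  | .introR d => .introR d.erase
  | .elimL arg fn => .elimL arg.erase fn.erase
  | .elimR fn arg => .elimR fn.erase arg.erase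

/-- Normal natural deductions of `C` from `Γ`. -/
def NormalDeduction {V : Type u} (Γ : List (Cat V)) (C : Cat V) : Type u :=
  {d : NDTree (Cat V) // Derives d Γ C ∧ d.Normal}

/-! ### Cut-free proof nets -/

/-- Subformula trees, which may stop at a complex formula. A leaf carries its formula and the
index of its axiom link. -/
inductive PTree (V : Type u) : Type u
  | leaf (F : LF V) (i : ℕ) : PTree V
  | tens (a b : PTree V) : PTree V
  | par (a b : PTree V) : PTree V

namespace PTree

variable {V : Type u}

/-- The formula at the root. -/
def formula : PTree V → LF V
  | leaf F _ => F
  | tens a b => .tens a.formula b.formula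
  | par a b => .par a.formula b.formula

/-- The leaves, from left to right. -/
def leaves : PTree V → List (LF V × ℕ)
  | leaf F i => [(F, i)]
  | tens a b => a.leaves ++ b.leaves
  | par a b => a.leaves ++ b.leaves

/-- All subtrees. -/
def subtrees : PTree V → List (PTree V)
  | leaf F i => [leaf F i]
  | tens a b => tens a b :: (a.subtrees ++ b.subtrees)
  | par a b => par a b :: (a.subtrees ++ b.subtrees)

/-- Renaming of the axiom indices. -/
def reindex (f : ℕ → ℕ) : PTree V → PTree V
  | leaf F i => leaf F (f i)
  | tens a b => tens (a.reindex f) (b.reindex f)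
  | par a b => par (a.reindex f) (b.reindex f)

/-- `a` is one of the two premises of the last link of `b`. -/
inductive IsPremise : PTree V → PTree V → Prop
  | tens_left (a b : PTree V) : IsPremise a (tens a b)
  | tens_right (a b : PTree V) : IsPremise b (tens a b)
  | par_left (a b : PTree V) : IsPremise a (par a b)
  | par_right (a b : PTree V) : IsPremise b (par a b)

/-- Two leaves with the same axiom index. -/
inductive Linked : PTree V → PTree V → Prop
  | mk (F G : LF V) (i : ℕ) : Linked (leaf F i) (leaf G i)

end PTree

/-- A cut-free proof structure: the cyclically ordered sequence of its conclusions, cut open at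
some place. -/
abbrev Struct (V : Type u) : Type u := List (PTree V)

namespace Struct

variable {V : Type u}

/-- The leaves, in their order. -/
def leaves (π : Struct V) : List (LF V × ℕ) := π.flatMap PTree.leaves

/-- The axiom indices of the leaves, in their order. -/
def indices (π : Struct V) : List ℕ := π.leaves.map Prod.snd

/-- The formula occurrences. When `IsLinked π` holds, a leaf is determined by its formula and its
index, so different occurrences are different trees. -/
def occ (π : Struct V) : List (PTree V) := π.flatMap PTree.subtrees

/-- Each axiom index appears exactly twice, once on some `F` and once on `F^⊥`. -/
def IsLinked (π : Struct V) : Prop :=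
  ∀ i ∈ π.indices, ∃ F : LF V, π.leaves.filter (fun x => x.2 = i) = [(F, i), (F.dual, i)]

/-- The graph of a proof structure: the vertices are the formula occurrences, the edges are the
branches of the links and the axioms. -/
def graph (π : Struct V) : SimpleGraph (PTree V) :=
  SimpleGraph.fromRel fun a b => a ∈ π.occ ∧ b ∈ π.occ ∧ (a.IsPremise b ∨ a.Linked b)

/-- Any cycle contains the two branches of some par link. -/
def Acyclic (π : Struct V) : Prop :=
  ∀ (t : PTree V) (p : π.graph.Walk t t), p.IsCycle →
    ∃ a b : PTree V, s(a, PTree.par a b) ∈ p.edges ∧ s(b, PTree.par a b) ∈ p.edges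

/-- Exactly one conclusion is an output and all others are inputs; the cyclic order is cut open
just after the output. -/
def Intuitionistic (π : Struct V) : Prop :=
  ∃ (L : Struct V) (o : PTree V), π = L ++ [o] ∧ o.formula.IsOutput ∧ ∀ t ∈ L, t.formula.IsInput

/-- No two axioms cross each other. -/
def Planar (π : Struct V) : Prop :=
  ∀ i j : ℕ, i ≠ j → ¬ [i, j, i, j].Sublist π.indices

/-- The correctness criterion, but for the condition on empty antecedents. -/
structure IsPreNet (π : Struct V) : Prop where
  linked : π.IsLinked
  acyclic : π.Acyclic
  intuitionistic : π.Intuitionistic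
  planar : π.Planar

/-- Cut-free proof nets of the product-free Lambek calculus: the criterion holds, and there is no
sub proof net with a single conclusion. (A sub proof net with the single conclusion `c`
consists of the occurrences above `c`.) -/
structure IsProofNet (π : Struct V) : Prop extends π.IsPreNet where
  nonempty_antecedents : ∀ c ∈ π.occ, ¬ IsPreNet [c]

/-- `π` is a proof net with conclusions `Hₙ-, …, H₁-, C+`. -/
def IsNetOf (π : Struct V) (Γ : List (Cat V)) (C : Cat V) : Prop :=
  π.IsProofNet ∧ π.map PTree.formula = (Γ.map Cat.neg).reverse ++ [C.pos]

/-- `π` and `π'` differ by a renaming of the axiom indices. -/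
def Same (π π' : Struct V) : Prop :=
  ∃ f : Equiv.Perm ℕ, π' = π.map (PTree.reindex f)

theorem reindex_reindex (f g : ℕ → ℕ) (t : PTree V) :
    (t.reindex f).reindex g = t.reindex (g ∘ f) := by
  induction t with
  | leaf F i => rfl
  | tens a b iha ihb => simp [PTree.reindex, iha, ihb]
  | par a b iha ihb => simp [PTree.reindex, iha, ihb]

theorem reindex_id (t : PTree V) : t.reindex id = t := by
  induction t with
  | leaf F i => rfl
  | tens a b iha ihb => simp [PTree.reindex, iha, ihb]
  | par a b iha ihb => simp [PTree.reindex, iha, ihb]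

theorem same_equivalence : Equivalence (Same (V := V)) where
  refl π := ⟨1, by
    have h : PTree.reindex (V := V) ((1 : Equiv.Perm ℕ) : ℕ → ℕ) = id :=
      funext fun t => reindex_id t
    rw [h, List.map_id]⟩
  symm := by
    rintro π _ ⟨f, rfl⟩
    refine ⟨f.symm, ?_⟩
    rw [List.map_map]
    have h : PTree.reindex (V := V) f.symm ∘ PTree.reindex f = id := by
      funext t
      simp [reindex_reindex, reindex_id]
    rw [h, List.map_id]
  trans := by
    rintro π _ _ ⟨f, rfl⟩ ⟨g, rfl⟩
    refine ⟨f.trans g, ?_⟩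
    rw [List.map_map]
    congr 1
    funext t
    simp [reindex_reindex]

end Struct

/-- Identification of proof nets up to the choice of the axiom indices. -/
instance netSetoid {V : Type u} (Γ : List (Cat V)) (C : Cat V) :
    Setoid {π : Struct V // π.IsNetOf Γ C} where
  r x y := x.1.Same y.1
  iseqv :=
    ⟨fun x => Struct.same_equivalence.refl x.1, fun h => Struct.same_equivalence.symm h,
      fun h h' => Struct.same_equivalence.trans h h'⟩

/-- Cut-free proof nets with conclusions `Hₙ-, …, H₁-, C+`. -/
def ProofNet {V : Type u} (Γ : List (Cat V)) (C : Cat V) : Type u :=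
  Quotient (netSetoid Γ C)

/-- The proof net represented by a structure. -/
def ProofNet.mk {V : Type u} {Γ : List (Cat V)} {C : Cat V} (π : Struct V) (h : π.IsNetOf Γ C) :
    ProofNet Γ C :=
  Quotient.mk (netSetoid Γ C) ⟨π, h⟩

/-! ### From normal deductions to proof nets -/

mutual

/-- The inductive translation of normal deductions into proof structures. An introduction becomes
a par link. A deduction that ends with an elimination, or that is a hypothesis, is translated
along its principal branch, starting from the axiom on its conclusion `C`. -/
inductive Translates {V : Type u} : NDTree (Cat V) → Struct V → Prop
  | introL {d : NDTree (Cat V)} {L : Struct V} {a b : PTree V} :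
      Translates d (L ++ [a, b]) → Translates (.introL d) (L ++ [.par a b])
  | introR {d : NDTree (Cat V)} {L : Struct V} {a b : PTree V} :
      Translates d (a :: (L ++ [b])) → Translates (.introR d) (L ++ [.par b a])
  | branch {d : NDTree (Cat V)} {π : Struct V} (C : Cat V) (i : ℕ) :
      AlongBranch d [] (.leaf C.neg i) [.leaf C.pos i] π → Translates d π

/-- `AlongBranch d L x R π`: starting from the structure with conclusions `L, x, R`, whose
conclusion `x` is the one that grows, adding a tensor link with the translation of the
non-principal premise for each elimination met along the principal branch of `d`, up to the
hypothesis that ends the branch, yields `π`. The axiom indices of the parts that are put together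
are kept apart. -/
inductive AlongBranch {V : Type u} :
    NDTree (Cat V) → Struct V → PTree V → Struct V → Struct V → Prop
  | hyp {A : Cat V} {L R : Struct V} {x : PTree V} :
      x.formula = A.neg → AlongBranch (.hyp A) L x R (L ++ x :: R)
  | elimL {arg fn : NDTree (Cat V)} {L R D π : Struct V} {x g : PTree V} :
      Translates arg (D ++ [g]) →
      (Struct.indices (D ++ [g])).Disjoint (Struct.indices (L ++ x :: R)) →
      AlongBranch fn L (.tens x g) (D ++ R) π →
      AlongBranch (.elimL arg fn) L x R π
  | elimR {fn arg : NDTree (Cat V)} {L R D π : Struct V} {x g : PTree V} :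
      Translates arg (D ++ [g]) →
      (Struct.indices (D ++ [g])).Disjoint (Struct.indices (L ++ x :: R)) →
      AlongBranch fn (L ++ D) (.tens g x) R π →
      AlongBranch (.elimR fn arg) L x R π

end

/-! ### From proof nets to normal deductions -/

/-- Lambek λ-terms, with variable names in `N`. `appL u t` applies `t : A \ B` to `u : A`, and
`appR t u` applies `t : B / A` to `u : A`. -/
inductive LTerm (N : Type v) (V : Type u) : Type (max u v)
  | var (x : N) (A : Cat V) : LTerm N V
  | lamL (x : N) (A : Cat V) (t : LTerm N V) : LTerm N V
  | lamR (x : N) (A : Cat V) (t : LTerm N V) : LTerm N V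
  | appL (u t : LTerm N V) : LTerm N V
  | appR (t u : LTerm N V) : LTerm N V

namespace LTerm

variable {N : Type v} {V : Type u}

/-- `HasType t Γ C`: the term `t` has type `C`, and `Γ` is the sequence of its typed free
variables. `λ_l` binds the leftmost free variable, `λ_r` the rightmost one. -/
inductive HasType : LTerm N V → List (N × Cat V) → Cat V → Prop
  | var (x : N) (A : Cat V) : HasType (var x A) [(x, A)] A
  | lamL {x : N} {A B : Cat V} {t : LTerm N V} {Γ : List (N × Cat V)} :
      Γ ≠ [] → HasType t ((x, A) :: Γ) B → HasType (lamL x A t) Γ (.under A B)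
  | lamR {x : N} {A B : Cat V} {t : LTerm N V} {Γ : List (N × Cat V)} :
      Γ ≠ [] → HasType t (Γ ++ [(x, A)]) B → HasType (lamR x A t) Γ (.over B A)
  | appL {A B : Cat V} {u t : LTerm N V} {Δ Γ : List (N × Cat V)} :
      HasType u Δ A → HasType t Γ (.under A B) → HasType (appL u t) (Δ ++ Γ) B
  | appR {A B : Cat V} {t u : LTerm N V} {Γ Δ : List (N × Cat V)} :
      HasType t Γ (.over B A) → HasType u Δ A → HasType (appR t u) (Γ ++ Δ) B

/-- The occurrences of variables, free or bound, from left to right. -/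
def vars : LTerm N V → List N
  | var x _ => [x]
  | lamL _ _ t => t.vars
  | lamR _ _ t => t.vars
  | appL u t => u.vars ++ t.vars
  | appR t u => t.vars ++ u.vars

/-- The natural deduction written as a term. -/
def toND : LTerm N V → NDTree (Cat V)
  | var _ A => .hyp A
  | lamL _ _ t => .introL t.toND
  | lamR _ _ t => .introR t.toND
  | appL u t => .elimL u.toND t.toND
  | appR t u => .elimR t.toND u.toND

end LTerm

mutual

/-- `Climbs π o t`: the climbing algorithm labels the output occurrence `o` of `π` with the term
`t`. Going up, it meets par links, which give abstractions, until it reaches an axiom. The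
variable bound at a par link is named by the input premise of that link. -/
inductive Climbs {V : Type u} (π : Struct V) : PTree V → LTerm (PTree V) V → Prop
  | par_left {a b : PTree V} {A : Cat V} {t : LTerm (PTree V) V} :
      a.formula = A.neg → Climbs π b t → Climbs π (.par a b) (.lamL a A t)
  | par_right {a b : PTree V} {A : Cat V} {t : LTerm (PTree V) V} :
      a.formula = A.neg → Climbs π b t → Climbs π (.par b a) (.lamR a A t)
  | ax {C : Cat V} {i : ℕ} {t : LTerm (PTree V) V} :
      PTree.leaf C.neg i ∈ π.occ → Descends π (.leaf C.neg i) t → Climbs π (.leaf C.pos i) t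

/-- `Descends π x t`: going down from the input occurrence `x`, the algorithm meets tensor links,
which give applications to the labels of their output premises, until it reaches a conclusion
or a premise of a par link, which names the head variable of `t`. -/
inductive Descends {V : Type u} (π : Struct V) : PTree V → LTerm (PTree V) V → Prop
  | head {x : PTree V} {A : Cat V} :
      x ∈ π ∨ (∃ b : PTree V, .par x b ∈ π.occ ∨ .par b x ∈ π.occ) →
      x.formula = A.neg → Descends π x (.var x A)
  | tens_left {x g : PTree V} {u t : LTerm (PTree V) V} :
      .tens x g ∈ π.occ → Climbs π g u → Descends π (.tens x g) t → Descends π x (.appL u t)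
  | tens_right {x g : PTree V} {u t : LTerm (PTree V) V} :
      .tens g x ∈ π.occ → Climbs π g u → Descends π (.tens g x) t → Descends π x (.appR t u)

end

/-- `Reads π t`: entering `π` by its output conclusion, the climbing algorithm produces `t`. -/
def Reads {V : Type u} (π : Struct V) (t : LTerm (PTree V) V) : Prop :=
  ∃ (L : Struct V) (o : PTree V), π = L ++ [o] ∧ Climbs π o t

/-! ### Frames -/

/-- Name-free normal natural deductions with conclusion `s`. -/
def NDFrame (V : Type u) : Type :=
  {f : NDTree Unit //
    ∃ (d : NDTree (Cat V)) (Γ : List (Cat V)), (Derives d Γ Cat.s ∧ d.Normal) ∧ d.erase = f}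

/-- The frame of a normal deduction of `s`. -/
def NormalDeduction.frame {V : Type u} {Γ : List (Cat V)} (d : NormalDeduction Γ (Cat.s (V := V))) :
    NDFrame V :=
  ⟨d.1.erase, d.1, Γ, d.2, rfl⟩

/-- The positive symbol `O` of frames, whose dual is `I`: in frames it is the only base category
besides `s`. -/
def baseO : Base Unit := .var ()

/-- An s proof frame is a cut-free proof net whose output conclusion is an axiom leaf `s`, and all
of whose other axioms are on `O` and its dual `I`. -/
def IsProofFrame (ρ : Struct Unit) : Prop :=
  ρ.IsProofNet ∧ ∃ (L : Struct Unit) (m : ℕ), ρ = L ++ [.leaf (.atom .s) m] ∧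
    ∀ x ∈ ρ.leaves, x.2 ≠ m → x.1 = .atom baseO ∨ x.1 = .coatom baseO

instance frameSetoid : Setoid {ρ : Struct Unit // IsProofFrame ρ} where
  r x y := x.1.Same y.1
  iseqv :=
    ⟨fun x => Struct.same_equivalence.refl x.1, fun h => Struct.same_equivalence.symm h,
      fun h h' => Struct.same_equivalence.trans h h'⟩

/-- s proof frames (product-free), up to the choice of the axiom indices. -/
def ProofFrame : Type := Quotient frameSetoid

/-- The s proof frame represented by a structure. -/
def ProofFrame.mk (ρ : Struct Unit) (h : IsProofFrame ρ) : ProofFrame :=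
  Quotient.mk frameSetoid ⟨ρ, h⟩

open Classical in
/-- Replaces the two ends of each axiom by `O` and `I`, except that the ends of the axiom with
index `m` become `s` and its dual. -/
noncomputable def PTree.eraseExcept {V : Type u} (m : ℕ) : PTree V → PTree Unit
  | .leaf F i =>
      let b : Base Unit := if i = m then .s else baseO
      .leaf (if F.IsOutput then .atom b else .coatom b) i
  | .tens x y => .tens (x.eraseExcept m) (y.eraseExcept m)
  | .par x y => .par (x.eraseExcept m) (y.eraseExcept m)

/-- The axiom index of the output conclusion, when that conclusion is a leaf (as it is when it is
`s`). -/
def Struct.mainIndex {V : Type u} (π : Struct V) : ℕ :=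
  match π.getLast? with
  | some (.leaf _ i) => i
  | _ => 0

/-- The proof frame associated with a proof net whose output conclusion is `s`. -/
noncomputable def Struct.frame {V : Type u} (π : Struct V) : Struct Unit :=
  π.map (PTree.eraseExcept π.mainIndex)

/-! ### Grammars -/

/-- Product-free Lambek grammars with words in `W`: a finite set of categories for each word. -/
abbrev Grammar (W : Type v) (V : Type u) : Type (max u v) := W → Finset (Cat V)

/-- Rigid grammars: at most one category for each word. -/
def Grammar.Rigid {W : Type v} {V : Type u} (G : Grammar W V) : Prop := ∀ w, (G w).card ≤ 1

/-- `G` assigns the categories `cs` to the words `ws`. -/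
def Grammar.Assigns {W : Type v} {V : Type u} (G : Grammar W V) (ws : List W)
    (cs : List (Cat V)) : Prop :=
  List.Forall₂ (fun w c => c ∈ G w) ws cs

/-- The language of `G` as a set of structured sentences: sentences with the name-free normal
natural deductions that analyse them. -/
def Grammar.ndLanguage {W : Type v} {V : Type u} (G : Grammar W V) :
    Set (List W × NDTree Unit) :=
  {e | ∃ cs : List (Cat V), G.Assigns e.1 cs ∧
    ∃ d : NormalDeduction cs (Cat.s (V := V)), d.1.erase = e.2}

/-- The language of `G` as a set of structured sentences: sentences with the s proof frames that
analyse them. -/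
def Grammar.spfLanguage {W : Type v} {V : Type u} (G : Grammar W V) :
    Set (List W × ProofFrame) :=
  {e | ∃ (cs : List (Cat V)) (π : Struct V), G.Assigns e.1 cs ∧ π.IsNetOf cs Cat.s ∧
    ∃ h : IsProofFrame π.frame, e.2 = ProofFrame.mk π.frame h}

/-! ### Learning -/

/-- `φ` learns, in Gold's sense, the class `K` of grammars generating languages of `U`-objects:
its values lie in `K`, and on the initial segments of any enumeration of the language of a
grammar of `K`, it is eventually defined and constant, with a value that generates the
language. -/
def IsLearningFunction {Gr : Type u} {U : Type v} (K : Set Gr) (lang : Gr → Set U)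
    (φ : List U →. Gr) : Prop :=
  (∀ D, ∀ H ∈ φ D, H ∈ K) ∧
  ∀ G ∈ K, ∀ e : ℕ → U, Set.range e = lang G →
    ∃ (N : ℕ) (H : Gr), lang H = lang G ∧ ∀ P ≥ N, φ ((List.range P).map e) = Part.some H

/-- Gödel numbers of natural deduction frames. -/
def frameCode : NDTree Unit → ℕ
  | .hyp _ => 0
  | .introL d => Nat.pair 1 (frameCode d)
  | .introR d => Nat.pair 2 (frameCode d)
  | .elimL d e => Nat.pair 3 (Nat.pair (frameCode d) (frameCode e))
  | .elimR d e => Nat.pair 4 (Nat.pair (frameCode d) (frameCode e))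

/-- Gödel numbers of categories. -/
def catCode : Cat ℕ → ℕ
  | .base .s => 0
  | .base (.var n) => Nat.pair 1 n
  | .under A B => Nat.pair 2 (Nat.pair (catCode A) (catCode B))
  | .over B A => Nat.pair 3 (Nat.pair (catCode B) (catCode A))

/-- Code of a grammar with words `0, …, m - 1`: the sorted lists of the Gödel numbers of the
categories of the successive words. -/
def grammarCode {m : ℕ} (G : Grammar (Fin m) ℕ) : List (List ℕ) :=
  List.ofFn fun w => ((G w).image catCode).sort (· ≤ ·)

/-- A partial function from sequences of structured sentences to grammars is effective when it is
partial recursive through the codes. -/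
def Effective {m : ℕ} (φ : List (List (Fin m) × NDTree Unit) →. Grammar (Fin m) ℕ) : Prop :=
  ∃ g : List (List (Fin m) × ℕ) →. List (List ℕ), Partrec g ∧
    ∀ D, g (D.map fun e => (e.1, frameCode e.2)) = (φ D).map grammarCode

end Lambek

namespace Lambek

universe u v

variable {V : Type u}

/-! ### Linear formulae and polarities -/

-- Nets and deductions. In a net each occurrence other than the output conclusion has exactly one
-- next occurrence in the climbing order `Struct.Nxt`: a complex input goes up to its input premise,
-- an input leaf crosses its axiom, an output goes down to the link it is a premise of. These steps
-- use only the output branch of a par link, so the acyclicity criterion makes them a forest, and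
-- every occurrence is led to the output conclusion (`Regular.reaches_output`). Hence a nonempty
-- family of input conclusions is never closed under the axioms. Switching one par link to its input
-- branch shows moreover that its input premise is led to its conclusion (`Regular.reaches_par`).
-- When the output is an axiom leaf, the descent from the other end of the axiom therefore ends at a
-- conclusion. If this is a tensor of `x` and `g`, the occurrences led to `g` are tied to the rest
-- by that link only, and planarity puts their conclusions next to `g` (`split_right`,
-- `split_left`). Induction on the size gives sequentialisation (`exists_deduction`); conversely
-- each rule preserves the criterion (`sound`). The translation is unique up to names since the
-- rules alone guide it (`similar_of_erase_eq`), and it is injective since the climb is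
-- deterministic and retraces the construction (`climbs_unique`, `reads_of_translates`). Frames. By
-- `similar_of_erase_eq` the frame of the net depends only on the frame of the deduction. An erased
-- translation is itself the translation of a deduction with the same frame
-- (`translates_eraseExcept`), so the injectivity above recovers that frame. A proof frame is a net,
-- hence comes from a deduction, and substituting `s` for all base categories moves this deduction
-- to any set of variables. Learning. Two deductions with the same frame have a common
-- generalisation (`Derives.lgg`), so the least general generalisation of two lexicons generates all
-- their common structured sentences. Consequently a lexicon that has the fewest symbols, and then
-- the most variables, among those generating all of a rigid language generates exactly that
-- language (`language_subset_of_key_le`). The learner takes the first such candidate compatible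
-- with the data. Compatibility is primitive recursive: by the subformula property the codes of the
-- lexicon bound all labels of a deduction. Only finitely many lexicons of small key have to be
-- refuted, hence the convergence.

theorem LF.dual_dual (F : LF V) : F.dual.dual = F := by
  induction F <;> simp_all [LF.dual]

theorem LF.dual_ne (F : LF V) : F.dual ≠ F := by
  cases F <;> simp [LF.dual]

@[simp] theorem LF.isOutput_atom (b : Base V) : (LF.atom b).IsOutput := .atom b

@[simp] theorem LF.isInput_coatom (b : Base V) : (LF.coatom b).IsInput := .coatom b

@[simp] theorem LF.not_isOutput_coatom (b : Base V) : ¬ (LF.coatom b).IsOutput := by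
  intro h; cases h

@[simp] theorem LF.not_isInput_atom (b : Base V) : ¬ (LF.atom b).IsInput := by
  intro h; cases h

@[simp] theorem LF.not_isOutput_tens (F G : LF V) : ¬ (LF.tens F G).IsOutput := by
  intro h; cases h

@[simp] theorem LF.not_isInput_par (F G : LF V) : ¬ (LF.par F G).IsInput := by
  intro h; cases h

theorem LF.isOutput_par {F G : LF V} :
    (LF.par F G).IsOutput ↔ F.IsInput ∧ G.IsOutput ∨ F.IsOutput ∧ G.IsInput := by
  constructor
  · intro h
    cases h with
    | par_left h h' => exact .inl ⟨h, h'⟩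
    | par_right h h' => exact .inr ⟨h, h'⟩
  · rintro (⟨h, h'⟩ | ⟨h, h'⟩)
    exacts [.par_left h h', .par_right h h']

theorem LF.isInput_tens {F G : LF V} :
    (LF.tens F G).IsInput ↔ F.IsOutput ∧ G.IsInput ∨ F.IsInput ∧ G.IsOutput := by
  constructor
  · intro h
    cases h with
    | tens_left h h' => exact .inl ⟨h, h'⟩
    | tens_right h h' => exact .inr ⟨h, h'⟩
  · rintro (⟨h, h'⟩ | ⟨h, h'⟩)
    exacts [.tens_left h h', .tens_right h h']

theorem LF.IsOutput.not_isInput {F : LF V} (h : F.IsOutput) : ¬ F.IsInput := by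
  cases F <;> simp_all

theorem LF.IsInput.not_isOutput {F : LF V} (h : F.IsInput) : ¬ F.IsOutput :=
  fun h' => h'.not_isInput h

/-- Negation exchanges the two polarities, so neither equivalence can be proved by induction without
the other. -/
theorem LF.isOutput_dual_and (F : LF V) :
    (F.dual.IsOutput ↔ F.IsInput) ∧ (F.dual.IsInput ↔ F.IsOutput) := by
  induction F with
  | atom b => simp [LF.dual]
  | coatom b => simp [LF.dual]
  | tens F G hF hG =>
    simp [LF.dual, LF.isOutput_par, LF.isInput_tens, hF, hG]; tauto
  | par F G hF hG =>
    simp [LF.dual, LF.isOutput_par, LF.isInput_tens, hF, hG]; tauto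

theorem LF.isInput_dual {F : LF V} : F.dual.IsInput ↔ F.IsOutput := F.isOutput_dual_and.2

theorem Cat.polarity (A : Cat V) : A.pos.IsOutput ∧ A.neg.IsInput := by
  induction A with
  | base b => simp [Cat.pos, Cat.neg]
  | under A B hA hB => simp [Cat.pos, Cat.neg, LF.isOutput_par, LF.isInput_tens, hA, hB]
  | _ A B hA hB => simp [Cat.pos, Cat.neg, LF.isOutput_par, LF.isInput_tens, hA, hB]

@[simp] theorem Cat.isOutput_pos (A : Cat V) : A.pos.IsOutput := A.polarity.1

@[simp] theorem Cat.isInput_neg (A : Cat V) : A.neg.IsInput := A.polarity.2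

@[simp] theorem Cat.not_isInput_pos (A : Cat V) : ¬ A.pos.IsInput := A.polarity.1.not_isInput

@[simp] theorem Cat.not_isOutput_neg (A : Cat V) : ¬ A.neg.IsOutput := A.polarity.2.not_isOutput

theorem Cat.dual_pos_neg (A : Cat V) : A.pos.dual = A.neg ∧ A.neg.dual = A.pos := by
  induction A with
  | base b => simp [Cat.pos, Cat.neg, LF.dual]
  | under A B hA hB => simp [Cat.pos, Cat.neg, LF.dual, hA, hB]
  | _ A B hA hB => simp [Cat.pos, Cat.neg, LF.dual, hA, hB]

@[simp] theorem Cat.dual_neg (A : Cat V) : A.neg.dual = A.pos := A.dual_pos_neg.2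

@[simp] theorem Cat.dual_pos (A : Cat V) : A.pos.dual = A.neg := A.dual_pos_neg.1

theorem Cat.neg_ne_pos (A B : Cat V) : A.neg ≠ B.pos := fun h =>
  B.not_isInput_pos (h ▸ A.isInput_neg)

/-- The side of the input factor tells `under` from `over`. The output factor is dualised, which
turns it back into an input formula to which the induction hypothesis applies. -/
theorem Cat.neg_injective : Function.Injective (Cat.neg (V := V)) := by
  intro A
  induction A with
  | base b => intro B h; cases B <;> simp_all [Cat.neg]
  | under A A' hA hA' =>
    intro B h
    cases B with
    | base b => simp [Cat.neg] at h
    | under B B' =>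
      simp only [Cat.neg, LF.tens.injEq] at h
      have h2 : A.neg = B.neg := by rw [← Cat.dual_pos, h.2, Cat.dual_pos]
      rw [hA' h.1, hA h2]
    | _ B B' =>
      simp only [Cat.neg, LF.tens.injEq] at h
      exact absurd h.1 (Cat.neg_ne_pos _ _)
  | _ A A' hA hA' =>
    intro B h
    cases B with
    | base b => simp [Cat.neg] at h
    | under B B' =>
      simp only [Cat.neg, LF.tens.injEq] at h
      exact absurd h.1.symm (Cat.neg_ne_pos _ _)
    | _ B B' =>
      simp only [Cat.neg, LF.tens.injEq] at h
      have h1 : A'.neg = B'.neg := by rw [← Cat.dual_pos, h.1, Cat.dual_pos]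
      rw [hA h.2, hA' h1]

theorem Cat.pos_injective : Function.Injective (Cat.pos (V := V)) := fun A B h =>
  Cat.neg_injective (by rw [← Cat.dual_pos, h, Cat.dual_pos])

/-- The productions of polarised formulae match those of categories one by one; every formula met in
a net thus has a category. -/
theorem LF.exists_cat (F : LF V) :
    (F.IsOutput → ∃ C : Cat V, F = C.pos) ∧ (F.IsInput → ∃ C : Cat V, F = C.neg) := by
  induction F with
  | atom b => exact ⟨fun _ => ⟨.base b, rfl⟩, by simp⟩
  | coatom b => exact ⟨by simp, fun _ => ⟨.base b, rfl⟩⟩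
  | tens F G hF hG =>
    refine ⟨by simp, fun h => ?_⟩
    rcases LF.isInput_tens.1 h with ⟨h, h'⟩ | ⟨h, h'⟩
    · obtain ⟨A, rfl⟩ := hF.1 h
      obtain ⟨B, rfl⟩ := hG.2 h'
      exact ⟨.over B A, rfl⟩
    · obtain ⟨B, rfl⟩ := hF.2 h
      obtain ⟨A, rfl⟩ := hG.1 h'
      exact ⟨.under A B, rfl⟩
  | par F G hF hG =>
    refine ⟨fun h => ?_, by simp⟩
    rcases LF.isOutput_par.1 h with ⟨h, h'⟩ | ⟨h, h'⟩
    · obtain ⟨A, rfl⟩ := hF.2 h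
      obtain ⟨B, rfl⟩ := hG.1 h'
      exact ⟨.under A B, rfl⟩
    · obtain ⟨B, rfl⟩ := hF.1 h
      obtain ⟨A, rfl⟩ := hG.2 h'
      exact ⟨.over B A, rfl⟩

theorem LF.IsInput.exists_neg {F : LF V} (h : F.IsInput) : ∃ C : Cat V, F = C.neg :=
  F.exists_cat.2 h

theorem Cat.neg_eq_tens_left {C : Cat V} {F G : LF V} (h : LF.tens F G = C.neg)
    (hF : F.IsInput) : ∃ A B : Cat V, C = .under A B ∧ F = B.neg ∧ G = A.pos := by
  cases C with
  | base b => simp [Cat.neg] at h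
  | under A B => simp only [Cat.neg, LF.tens.injEq] at h; exact ⟨A, B, rfl, h.1, h.2⟩
  | _ B A =>
    simp only [Cat.neg, LF.tens.injEq] at h
    rw [h.1] at hF; simp at hF

theorem Cat.neg_eq_tens_right {C : Cat V} {F G : LF V} (h : LF.tens F G = C.neg)
    (hG : G.IsInput) : ∃ A B : Cat V, C = .over B A ∧ F = A.pos ∧ G = B.neg := by
  cases C with
  | base b => simp [Cat.neg] at h
  | under A B =>
    simp only [Cat.neg, LF.tens.injEq] at h
    rw [h.2] at hG; simp at hG
  | _ B A =>
    simp only [Cat.neg, LF.tens.injEq] at h; exact ⟨A, B, rfl, h.1, h.2⟩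

/-! ### Subformula trees -/

namespace PTree

/-- The axiom indices of the leaves. -/
def idx (t : PTree V) : List ℕ := t.leaves.map Prod.snd

/-- The number of nodes. -/
def size : PTree V → ℕ
  | leaf _ _ => 1
  | tens a b => a.size + b.size + 1
  | par a b => a.size + b.size + 1

@[simp] theorem idx_leaf (F : LF V) (i : ℕ) : (leaf F i).idx = [i] := rfl

@[simp] theorem idx_tens (a b : PTree V) : (tens a b).idx = a.idx ++ b.idx := by
  simp [idx, leaves]

@[simp] theorem idx_par (a b : PTree V) : (par a b).idx = a.idx ++ b.idx := by
  simp [idx, leaves]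

theorem leaves_ne_nil (t : PTree V) : t.leaves ≠ [] := by
  induction t <;> simp_all [leaves]

theorem idx_ne_nil (t : PTree V) : t.idx ≠ [] := by
  simp [idx, leaves_ne_nil]

theorem exists_mem_idx (t : PTree V) : ∃ i, i ∈ t.idx :=
  List.exists_mem_of_ne_nil _ t.idx_ne_nil

@[simp] theorem self_mem_subtrees (t : PTree V) : t ∈ t.subtrees := by
  cases t <;> simp [subtrees]

theorem IsPremise.size_lt {a b : PTree V} (h : a.IsPremise b) : a.size < b.size := by
  cases h <;> simp only [size] <;> omega

theorem mem_subtrees_iff {a t : PTree V} :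
    a ∈ t.subtrees ↔ a = t ∨ ∃ b : PTree V, b.IsPremise t ∧ a ∈ b.subtrees := by
  constructor
  · intro h
    cases t with
    | leaf F i => simpa [subtrees] using Or.inl h
    | tens x y =>
      simp only [subtrees, List.mem_cons, List.mem_append] at h
      rcases h with h | h | h
      exacts [.inl h, .inr ⟨x, .tens_left _ _, h⟩, .inr ⟨y, .tens_right _ _, h⟩]
    | par x y =>
      simp only [subtrees, List.mem_cons, List.mem_append] at h
      rcases h with h | h | h
      exacts [.inl h, .inr ⟨x, .par_left _ _, h⟩, .inr ⟨y, .par_right _ _, h⟩]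
  · rintro (rfl | ⟨b, hb, h⟩)
    · simp
    · cases hb <;> simp [subtrees, h]

theorem subtrees_trans {a b c : PTree V} (hab : a ∈ b.subtrees) (hbc : b ∈ c.subtrees) :
    a ∈ c.subtrees := by
  induction c with
  | leaf F i => simp [subtrees] at hbc; subst hbc; exact hab
  | tens x y hx hy =>
    rcases mem_subtrees_iff.1 hbc with rfl | ⟨d, hd, h⟩
    · exact hab
    · refine mem_subtrees_iff.2 (.inr ⟨d, hd, ?_⟩)
      cases hd
      exacts [hx h, hy h]
  | par x y hx hy =>
    rcases mem_subtrees_iff.1 hbc with rfl | ⟨d, hd, h⟩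
    · exact hab
    · refine mem_subtrees_iff.2 (.inr ⟨d, hd, ?_⟩)
      cases hd
      exacts [hx h, hy h]

theorem IsPremise.mem_subtrees {a b : PTree V} (h : a.IsPremise b) : a ∈ b.subtrees :=
  mem_subtrees_iff.2 (.inr ⟨a, h, by simp⟩)

theorem size_le_of_mem_subtrees {a b : PTree V} (h : a ∈ b.subtrees) : a.size ≤ b.size := by
  induction b with
  | leaf F i => simp [subtrees] at h; subst h; rfl
  | tens x y hx hy =>
    simp only [subtrees, List.mem_cons, List.mem_append] at h
    rcases h with rfl | h | h
    · rfl
    · have := hx h; simp only [size]; omega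
    · have := hy h; simp only [size]; omega
  | par x y hx hy =>
    simp only [subtrees, List.mem_cons, List.mem_append] at h
    rcases h with rfl | h | h
    · rfl
    · have := hx h; simp only [size]; omega
    · have := hy h; simp only [size]; omega

theorem leaf_mem_subtrees {F : LF V} {i : ℕ} {t : PTree V} :
    leaf F i ∈ t.subtrees ↔ (F, i) ∈ t.leaves := by
  induction t with
  | leaf G j => simp [subtrees, leaves]
  | tens a b ha hb => simp [subtrees, leaves, ha, hb]
  | par a b ha hb => simp [subtrees, leaves, ha, hb]

theorem leaves_subset_of_mem_subtrees {a t : PTree V} (h : a ∈ t.subtrees) :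
    a.leaves ⊆ t.leaves := by
  rintro ⟨F, i⟩ hx
  rw [← leaf_mem_subtrees] at hx ⊢
  exact subtrees_trans hx h

theorem idx_subset_of_mem_subtrees {a t : PTree V} (h : a ∈ t.subtrees) : a.idx ⊆ t.idx :=
  List.map_subset _ (leaves_subset_of_mem_subtrees h)

theorem exists_leaf_of_mem_idx {i : ℕ} {t : PTree V} (h : i ∈ t.idx) :
    ∃ F, leaf F i ∈ t.subtrees := by
  obtain ⟨⟨F, j⟩, hj, rfl⟩ := List.mem_map.1 h
  exact ⟨F, leaf_mem_subtrees.2 hj⟩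

/-- The polarity of the formula is well defined. -/
def Polar (t : PTree V) : Prop := t.formula.IsOutput ∨ t.formula.IsInput

theorem Polar.premise {a b : PTree V} (h : a.IsPremise b) (hb : b.Polar) : a.Polar := by
  cases h <;> simp [Polar, formula, LF.isOutput_par, LF.isInput_tens] at hb ⊢ <;> tauto

theorem Polar.subtree {a t : PTree V} (h : a ∈ t.subtrees) (ht : t.Polar) : a.Polar := by
  induction t with
  | leaf F i => simp [subtrees] at h; subst h; exact ht
  | tens x y hx hy =>
    rcases mem_subtrees_iff.1 h with rfl | ⟨d, hd, h⟩
    · exact ht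
    · have := ht.premise hd
      cases hd
      exacts [hx h this, hy h this]
  | par x y hx hy =>
    rcases mem_subtrees_iff.1 h with rfl | ⟨d, hd, h⟩
    · exact ht
    · have := ht.premise hd
      cases hd
      exacts [hx h this, hy h this]

end PTree

-- Leaves, indices and occurrences of a structure

namespace Struct

theorem indices_eq (π : Struct V) : π.indices = π.flatMap PTree.idx := by
  simp [indices, leaves, List.map_flatMap]; rfl

@[simp] theorem leaves_append (π ρ : Struct V) : leaves (π ++ ρ) = leaves π ++ leaves ρ := by
  simp [leaves]

@[simp] theorem leaves_cons (t : PTree V) (π : Struct V) :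
    leaves (t :: π) = t.leaves ++ leaves π := by
  simp [leaves]

@[simp] theorem leaves_nil : leaves ([] : Struct V) = [] := rfl

@[simp] theorem indices_append (π ρ : Struct V) :
    indices (π ++ ρ) = indices π ++ indices ρ := by
  simp [indices]

@[simp] theorem indices_cons (t : PTree V) (π : Struct V) :
    indices (t :: π) = t.idx ++ indices π := by
  simp [indices, PTree.idx]

@[simp] theorem indices_nil : indices ([] : Struct V) = [] := rfl

@[simp] theorem occ_append (π ρ : Struct V) : occ (π ++ ρ) = occ π ++ occ ρ := by
  simp [occ]

@[simp] theorem occ_cons (t : PTree V) (π : Struct V) : occ (t :: π) = t.subtrees ++ occ π := by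
  simp [occ]

@[simp] theorem occ_nil : occ ([] : Struct V) = [] := rfl

theorem mem_occ {a : PTree V} {π : Struct V} : a ∈ π.occ ↔ ∃ t ∈ π, a ∈ t.subtrees := by
  simp [occ]

theorem mem_occ_of_mem {t : PTree V} {π : Struct V} (h : t ∈ π) : t ∈ π.occ :=
  mem_occ.2 ⟨t, h, by simp⟩

theorem mem_occ_of_subtree {a b : PTree V} {π : Struct V} (h : a ∈ b.subtrees) (hb : b ∈ π.occ) :
    a ∈ π.occ := by
  obtain ⟨t, ht, hb⟩ := mem_occ.1 hb
  exact mem_occ.2 ⟨t, ht, PTree.subtrees_trans h hb⟩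

theorem mem_occ_of_premise {a b : PTree V} {π : Struct V} (h : a.IsPremise b) (hb : b ∈ π.occ) :
    a ∈ π.occ :=
  mem_occ_of_subtree h.mem_subtrees hb

theorem root_or_premise {a : PTree V} {π : Struct V} (h : a ∈ π.occ) :
    a ∈ π ∨ ∃ b ∈ π.occ, a.IsPremise b := by
  obtain ⟨t, ht, h⟩ := mem_occ.1 h
  have key : ∀ t : PTree V, a ∈ t.subtrees → a = t ∨ ∃ b ∈ t.subtrees, a.IsPremise b := by
    intro t
    induction t with
    | leaf F i => intro h; simp [PTree.subtrees] at h; exact .inl h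
    | tens x y hx hy =>
      intro h
      rcases PTree.mem_subtrees_iff.1 h with rfl | ⟨d, hd, h⟩
      · exact .inl rfl
      · have : a = d ∨ ∃ b ∈ d.subtrees, a.IsPremise b := by
          cases hd
          exacts [hx h, hy h]
        rcases this with rfl | ⟨b, hb, hab⟩
        · exact .inr ⟨_, by simp, hd⟩
        · exact .inr ⟨b, PTree.subtrees_trans hb hd.mem_subtrees, hab⟩
    | par x y hx hy =>
      intro h
      rcases PTree.mem_subtrees_iff.1 h with rfl | ⟨d, hd, h⟩
      · exact .inl rfl
      · have : a = d ∨ ∃ b ∈ d.subtrees, a.IsPremise b := by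
          cases hd
          exacts [hx h, hy h]
        rcases this with rfl | ⟨b, hb, hab⟩
        · exact .inr ⟨_, by simp, hd⟩
        · exact .inr ⟨b, PTree.subtrees_trans hb hd.mem_subtrees, hab⟩
  rcases key t h with rfl | ⟨b, hb, hab⟩
  · exact .inl ht
  · exact .inr ⟨b, mem_occ.2 ⟨t, ht, hb⟩, hab⟩

theorem leaf_mem_occ {F : LF V} {i : ℕ} {π : Struct V} :
    PTree.leaf F i ∈ π.occ ↔ (F, i) ∈ π.leaves := by
  simp [occ, leaves, PTree.leaf_mem_subtrees]

theorem mem_indices {i : ℕ} {π : Struct V} : i ∈ π.indices ↔ ∃ t ∈ π, i ∈ t.idx := by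
  simp [indices_eq]

theorem idx_subset_of_mem_occ {a : PTree V} {π : Struct V} (h : a ∈ π.occ) :
    a.idx ⊆ π.indices := by
  obtain ⟨t, ht, h⟩ := mem_occ.1 h
  exact fun i hi => mem_indices.2 ⟨t, ht, PTree.idx_subset_of_mem_subtrees h hi⟩

/-- All conclusions have a well-defined polarity. -/
def Polar (π : Struct V) : Prop := ∀ t ∈ π, t.Polar

theorem Polar.occ {π : Struct V} (h : π.Polar) {a : PTree V} (ha : a ∈ π.occ) : a.Polar := by
  obtain ⟨t, ht, ha⟩ := mem_occ.1 ha
  exact (h t ht).subtree ha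

theorem Intuitionistic.polar {π : Struct V} (h : π.Intuitionistic) : π.Polar := by
  obtain ⟨L, o, rfl, ho, hL⟩ := h
  intro t ht
  rcases List.mem_append.1 ht with ht | ht
  · exact .inr (hL t ht)
  · simp at ht; subst ht; exact .inl ho

/-- The number of nodes. -/
def size (π : Struct V) : ℕ := (π.map PTree.size).sum

@[simp] theorem size_append (π ρ : Struct V) : size (π ++ ρ) = size π + size ρ := by
  simp [size]

@[simp] theorem size_cons (t : PTree V) (π : Struct V) : size (t :: π) = t.size + size π := by
  simp [size]

@[simp] theorem size_nil : size ([] : Struct V) = 0 := rfl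

end Struct

/-! ### Renamings -/

/-- Permutations of an infinite set act multiply transitively: an enumeration of `l` and its image
by `f` are two embeddings of the same finite type. Nets are identified through permutations, whereas
gluing yields renamings that are injective only on the indices in use. -/
theorem exists_perm_eqOn (f : ℕ → ℕ) (l : List ℕ) (hf : Set.InjOn f {i | i ∈ l}) :
    ∃ σ : Equiv.Perm ℕ, ∀ i ∈ l, σ i = f i := by
  classical
  set n := l.toFinset.card
  have e := l.toFinset.equivFin
  have h1 : Function.Injective (fun k : Fin n => ((e.symm k : l.toFinset) : ℕ)) :=
    Subtype.val_injective.comp e.symm.injective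
  have h2 : Function.Injective (fun k : Fin n => f ((e.symm k : l.toFinset) : ℕ)) := by
    intro j k hjk
    exact h1 (hf (List.mem_toFinset.1 (e.symm j).2) (List.mem_toFinset.1 (e.symm k).2) hjk)
  obtain ⟨σ, hσ⟩ := (Equiv.Perm.isMultiplyPretransitive ℕ n).exists_smul_eq ⟨_, h1⟩ ⟨_, h2⟩
  refine ⟨σ, fun i hi => ?_⟩
  have := DFunLike.congr_fun hσ (e ⟨i, List.mem_toFinset.2 hi⟩)
  simpa using this

theorem exists_perm_disjoint (l m : List ℕ) :
    ∃ σ : Equiv.Perm ℕ, (l.map σ).Disjoint m := by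
  -- Every member of `m` is at most `m.sum`, so the shift goes past all of them.
  obtain ⟨σ, hσ⟩ := exists_perm_eqOn (fun i => i + (m.sum + 1)) l (fun i _ j _ h => by simpa using h)
  refine ⟨σ, fun i hi hm => ?_⟩
  obtain ⟨j, hj, rfl⟩ := List.mem_map.1 hi
  rw [hσ j hj] at hm
  have := List.le_sum_of_mem hm
  omega

end Lambek


namespace Lambek

universe u v

variable {V : Type u}

/-! ### Occurrences in linked structures -/

theorem PTree.leaves_sublist_of_mem_subtrees {a t : PTree V} (h : a ∈ t.subtrees) :
    a.leaves.Sublist t.leaves := by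
  induction t with
  | leaf F i => simp [subtrees] at h; subst h; exact List.Sublist.refl _
  | tens x y hx hy =>
    simp only [subtrees, List.mem_cons, List.mem_append] at h
    rcases h with rfl | h | h
    · exact List.Sublist.refl _
    · exact (hx h).trans (List.sublist_append_left _ _)
    · exact (hy h).trans (List.sublist_append_right _ _)
  | par x y hx hy =>
    simp only [subtrees, List.mem_cons, List.mem_append] at h
    rcases h with rfl | h | h
    · exact List.Sublist.refl _
    · exact (hx h).trans (List.sublist_append_left _ _)
    · exact (hy h).trans (List.sublist_append_right _ _)

/-- Without repeated leaves the two premises of a link have disjoint leaves, so subtrees with a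
common leaf lie on one branch. -/
theorem PTree.comparable {t a b : PTree V} (ht : t.leaves.Nodup) (ha : a ∈ t.subtrees)
    (hb : b ∈ t.subtrees) {x : LF V × ℕ} (hxa : x ∈ a.leaves) (hxb : x ∈ b.leaves) :
    a ∈ b.subtrees ∨ b ∈ a.subtrees := by
  have main : ∀ y z : PTree V, (y.leaves ++ z.leaves).Nodup →
      (y.leaves.Nodup → a ∈ y.subtrees → b ∈ y.subtrees → a ∈ b.subtrees ∨ b ∈ a.subtrees) →
      (z.leaves.Nodup → a ∈ z.subtrees → b ∈ z.subtrees → a ∈ b.subtrees ∨ b ∈ a.subtrees) →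
      (a ∈ y.subtrees ∨ a ∈ z.subtrees) → (b ∈ y.subtrees ∨ b ∈ z.subtrees) →
      a ∈ b.subtrees ∨ b ∈ a.subtrees := by
    intro y z hn hy hz ha hb
    obtain ⟨hny, hnz, hd⟩ := List.nodup_append'.1 hn
    rcases ha with ha | ha <;> rcases hb with hb | hb
    · exact hy hny ha hb
    · exact absurd (leaves_subset_of_mem_subtrees hb hxb)
        (hd (leaves_subset_of_mem_subtrees ha hxa))
    · exact absurd (leaves_subset_of_mem_subtrees ha hxa)
        (hd (leaves_subset_of_mem_subtrees hb hxb))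
    · exact hz hnz ha hb
  induction t with
  | leaf F i => simp [subtrees] at ha hb; subst ha; subst hb; simp
  | tens y z hy hz =>
    simp only [subtrees, List.mem_cons, List.mem_append] at ha hb
    rcases ha with rfl | ha
    · right; simpa [subtrees] using hb
    rcases hb with rfl | hb
    · left; simp [subtrees, ha]
    exact main y z ht hy hz ha hb
  | par y z hy hz =>
    simp only [subtrees, List.mem_cons, List.mem_append] at ha hb
    rcases ha with rfl | ha
    · right; simpa [subtrees] using hb
    rcases hb with rfl | hb
    · left; simp [subtrees, ha]
    exact main y z ht hy hz ha hb

namespace Struct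

theorem root_unique {π : Struct V} (hn : π.leaves.Nodup) {t t' : PTree V} (ht : t ∈ π)
    (ht' : t' ∈ π) {x : LF V × ℕ} (hx : x ∈ t.leaves) (hx' : x ∈ t'.leaves) : t = t' := by
  induction π with
  | nil => simp at ht
  | cons a π ih =>
    rw [leaves_cons] at hn
    obtain ⟨-, hn', hd⟩ := List.nodup_append'.1 hn
    have mem : ∀ s ∈ π, x ∈ s.leaves → x ∈ leaves π := fun s hs hxs =>
      List.mem_flatMap.2 ⟨s, hs, hxs⟩
    rcases List.mem_cons.1 ht with h | h <;> rcases List.mem_cons.1 ht' with h' | h'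
    · rw [h, h']
    · exact absurd (mem _ h' hx') (hd (h ▸ hx))
    · exact absurd (mem _ h hx) (hd (h' ▸ hx'))
    · exact ih hn' h h'

theorem leaves_sublist_of_mem_occ {π : Struct V} {a : PTree V} (ha : a ∈ π.occ) :
    a.leaves.Sublist π.leaves := by
  induction π with
  | nil => simp at ha
  | cons t π ih =>
    rw [occ_cons, List.mem_append] at ha
    rw [leaves_cons]
    rcases ha with ha | ha
    · exact (PTree.leaves_sublist_of_mem_subtrees ha).trans (List.sublist_append_left _ _)
    · exact (ih ha).trans (List.sublist_append_right _ _)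

theorem comparable {π : Struct V} (hn : π.leaves.Nodup) {a b : PTree V} (ha : a ∈ π.occ)
    (hb : b ∈ π.occ) {x : LF V × ℕ} (hxa : x ∈ a.leaves) (hxb : x ∈ b.leaves) :
    a ∈ b.subtrees ∨ b ∈ a.subtrees := by
  obtain ⟨t, ht, ha'⟩ := mem_occ.1 ha
  obtain ⟨t', ht', hb'⟩ := mem_occ.1 hb
  obtain rfl := root_unique hn ht ht' (PTree.leaves_subset_of_mem_subtrees ha' hxa)
    (PTree.leaves_subset_of_mem_subtrees hb' hxb)
  exact PTree.comparable (hn.sublist (leaves_sublist_of_mem_occ (mem_occ_of_mem ht)))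
    ha' hb' hxa hxb

/-- Two trees over `a` share its leaves, hence are nested. If the nesting were strict, `a` would be
one premise of the larger tree and lie inside the other premise, and its leaves would be repeated.
-/
theorem premise_unique {π : Struct V} (hn : π.leaves.Nodup) {a b b' : PTree V}
    (hb : b ∈ π.occ) (hb' : b' ∈ π.occ) (hab : a.IsPremise b) (hab' : a.IsPremise b') :
    b = b' := by
  have main : ∀ {b b' : PTree V}, b' ∈ π.occ → a.IsPremise b → a.IsPremise b' →
      b ∈ b'.subtrees → b = b' := by
    intro b b' hb' hab hab' h
    rcases PTree.mem_subtrees_iff.1 h with rfl | ⟨c, hc, h⟩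
    · rfl
    exfalso
    have hac : a ≠ c := by
      rintro rfl
      have := PTree.size_le_of_mem_subtrees h
      have := hab.size_lt
      omega
    have hsub : a.leaves ⊆ c.leaves :=
      PTree.leaves_subset_of_mem_subtrees (PTree.subtrees_trans hab.mem_subtrees h)
    have hn' := hn.sublist (leaves_sublist_of_mem_occ hb')
    obtain ⟨x, hx⟩ := List.exists_mem_of_ne_nil _ a.leaves_ne_nil
    cases hab' <;> cases hc <;> simp only [PTree.leaves] at hn' <;>
      first
      | exact hac rfl
      | exact (List.nodup_append'.1 hn').2.2 hx (hsub hx)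
      | exact (List.nodup_append'.1 hn').2.2 (hsub hx) hx
  obtain ⟨x, hx⟩ := List.exists_mem_of_ne_nil _ a.leaves_ne_nil
  rcases comparable hn hb hb' (PTree.leaves_subset_of_mem_subtrees hab.mem_subtrees hx)
    (PTree.leaves_subset_of_mem_subtrees hab'.mem_subtrees hx) with h | h
  · exact main hb' hab hab' h
  · exact (main hb hab' hab h).symm

theorem not_root_of_premise {π : Struct V} (hn : π.leaves.Nodup) {a b : PTree V}
    (hb : b ∈ π.occ) (hab : a.IsPremise b) : a ∉ π := by
  intro ha
  obtain ⟨t, ht, hbt⟩ := mem_occ.1 hb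
  obtain ⟨x, hx⟩ := List.exists_mem_of_ne_nil _ a.leaves_ne_nil
  obtain rfl := root_unique hn ha ht hx (PTree.leaves_subset_of_mem_subtrees
    (PTree.subtrees_trans hab.mem_subtrees hbt) hx)
  have := PTree.size_le_of_mem_subtrees hbt
  have := hab.size_lt
  omega

/-- A repeated leaf would be both ends of its axiom, but no formula is its own dual. This is what
allows trees to stand for occurrences. -/
theorem IsLinked.nodup {π : Struct V} (h : π.IsLinked) : π.leaves.Nodup := by
  rw [List.nodup_iff_sublist]
  rintro ⟨F, i⟩ hs
  have hi : i ∈ π.indices := List.mem_map.2 ⟨(F, i), hs.subset (by simp), rfl⟩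
  obtain ⟨G, hG⟩ := h i hi
  have h2 := hs.filter (fun x => decide (x.2 = i))
  rw [hG] at h2
  simp only [decide_true, List.filter_cons_of_pos, List.filter_nil] at h2
  have := h2.eq_of_length rfl
  simp only [List.cons.injEq, Prod.mk.injEq, and_true] at this
  exact G.dual_ne (this.2.symm.trans this.1)

theorem IsLinked.dual_mem {π : Struct V} (h : π.IsLinked) {F : LF V} {i : ℕ}
    (hF : PTree.leaf F i ∈ π.occ) : PTree.leaf F.dual i ∈ π.occ := by
  rw [leaf_mem_occ] at hF ⊢
  obtain ⟨G, hG⟩ := h i (List.mem_map.2 ⟨(F, i), hF, rfl⟩)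
  have h1 : (F, i) ∈ π.leaves.filter (fun x => decide (x.2 = i)) := by simp [hF]
  have h2 : ∀ H, (H, i) ∈ π.leaves.filter (fun x => decide (x.2 = i)) → (H, i) ∈ π.leaves :=
    fun H hH => (List.mem_filter.1 hH).1
  rw [hG] at h1 h2
  simp only [List.mem_cons, Prod.mk.injEq, and_true, List.not_mem_nil, or_false] at h1
  rcases h1 with rfl | rfl
  · exact h2 _ (by simp)
  · exact h2 _ (by simp [LF.dual_dual])

theorem IsLinked.eq_or_eq_dual {π : Struct V} (h : π.IsLinked) {F G : LF V} {i : ℕ}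
    (hF : PTree.leaf F i ∈ π.occ) (hG : PTree.leaf G i ∈ π.occ) : G = F ∨ G = F.dual := by
  rw [leaf_mem_occ] at hF hG
  obtain ⟨H, hH⟩ := h i (List.mem_map.2 ⟨(F, i), hF, rfl⟩)
  have h1 : (F, i) ∈ π.leaves.filter (fun x => decide (x.2 = i)) := by simp [hF]
  have h2 : (G, i) ∈ π.leaves.filter (fun x => decide (x.2 = i)) := by simp [hG]
  rw [hH] at h1 h2
  simp only [List.mem_cons, Prod.mk.injEq, and_true, List.not_mem_nil, or_false] at h1 h2
  rcases h1 with rfl | rfl <;> rcases h2 with rfl | rfl <;> simp [LF.dual_dual]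

/-! ### Rearranging linked and planar structures -/

theorem isLinked_congr {π ρ : Struct V} (h : π.leaves = ρ.leaves) :
    π.IsLinked ↔ ρ.IsLinked := by
  simp [IsLinked, indices, h]

theorem planar_congr {π ρ : Struct V} (h : π.indices = ρ.indices) : π.Planar ↔ ρ.Planar := by
  simp [Planar, h]

theorem IsLinked.rotate {π ρ : Struct V} (h : IsLinked (π ++ ρ)) : IsLinked (ρ ++ π) := by
  intro i hi
  obtain ⟨F, hF⟩ := h i (by simpa [or_comm] using hi)
  simp only [leaves_append, List.filter_append] at hF ⊢
  generalize List.filter (fun x => decide (x.2 = i)) π.leaves = a at *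
  generalize List.filter (fun x => decide (x.2 = i)) ρ.leaves = b at *
  -- The cut distributes the two ends of the axiom as 0 + 2, 1 + 1 or 2 + 0; only 1 + 1 exchanges
  -- them, and then the witness is the dual formula.
  rcases a with - | ⟨x, - | ⟨y, - | ⟨z, a⟩⟩⟩
  · exact ⟨F, by simpa using hF⟩
  · simp only [List.cons_append, List.nil_append, List.cons.injEq] at hF
    exact ⟨F.dual, by simp [hF, LF.dual_dual]⟩
  · simp only [List.cons_append, List.nil_append, List.cons.injEq] at hF
    exact ⟨F, by simp [hF]⟩
  · simp at hF

theorem Planar.rotate {π ρ : Struct V} (h : Planar (π ++ ρ)) : Planar (ρ ++ π) := by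
  have key : ∀ a b : List ℕ, (∀ i j, i ≠ j → ¬ [i, j, i, j].Sublist (a ++ b)) →
      ∀ i j, i ≠ j → ¬ [i, j, i, j].Sublist (b ++ a) := by
    intro a b H i j hij hs
    obtain ⟨l, r, hlr, hl, hr⟩ := List.sublist_append_iff.1 hs
    have key : ∀ k l, [k, l, k, l] = r ++ l :: [] → True := fun _ _ _ => trivial
    -- Zero to four letters of the pattern fall into `b`. Moving them to the end gives the same
    -- cyclic word, where an odd number exchanges `i` and `j`.
    rcases l with - | ⟨x, - | ⟨y, - | ⟨z, - | ⟨w, - | ⟨w', l⟩⟩⟩⟩⟩ <;>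
      simp only [List.nil_append, List.cons_append, List.cons.injEq] at hlr
    · subst hlr
      exact H i j hij (by simpa using hr.append hl)
    · obtain ⟨rfl, rfl⟩ := hlr
      exact H j i hij.symm (by simpa using hr.append hl)
    · obtain ⟨rfl, rfl, rfl⟩ := hlr
      exact H i j hij (by simpa using hr.append hl)
    · obtain ⟨rfl, rfl, rfl, rfl⟩ := hlr
      exact H j i hij.symm (by simpa using hr.append hl)
    · obtain ⟨rfl, rfl, rfl, rfl, rfl⟩ := hlr
      exact H i j hij (by simpa using hr.append hl)
    · simp at hlr
  intro i j hij
  rw [indices_append]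
  exact key π.indices ρ.indices (fun i j hij => by simpa using h i j hij) i j hij

/-- A block with indices of its own is invisible when the leaves of another index are filtered out,
and conversely. -/
theorem isLinked_insert {π ρ σ : Struct V}
    (hd : ρ.indices.Disjoint (indices (π ++ σ))) :
    IsLinked (π ++ ρ ++ σ) ↔ IsLinked ρ ∧ IsLinked (π ++ σ) := by
  have filter_nil : ∀ (τ : Struct V) (i : ℕ), i ∉ τ.indices →
      τ.leaves.filter (fun x => decide (x.2 = i)) = [] := by
    intro τ i hi
    rw [List.filter_eq_nil_iff]
    intro x hx h
    exact hi (List.mem_map.2 ⟨x, hx, by simpa using h⟩)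
  have h1 : ∀ i ∈ ρ.indices, (leaves (π ++ ρ ++ σ)).filter (fun x => decide (x.2 = i)) =
      ρ.leaves.filter (fun x => decide (x.2 = i)) := by
    intro i hi
    have h : i ∉ π.indices ∧ i ∉ σ.indices := by simpa using fun h => hd hi h
    simp [filter_nil _ _ h.1, filter_nil _ _ h.2]
  have h2 : ∀ i ∈ indices (π ++ σ),
      (leaves (π ++ ρ ++ σ)).filter (fun x => decide (x.2 = i)) =
      (leaves (π ++ σ)).filter (fun x => decide (x.2 = i)) := by
    intro i hi
    simp [filter_nil ρ i (fun h => hd h hi)]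
  constructor
  · intro h
    refine ⟨fun i hi => ?_, fun i hi => ?_⟩
    · rw [← h1 i hi]; exact h i (by simp [hi])
    · rw [← h2 i hi]
      refine h i ?_
      simp only [indices_append, List.mem_append] at hi ⊢
      tauto
  · rintro ⟨hρ, hπ⟩ i hi
    by_cases hi' : i ∈ ρ.indices
    · rw [h1 i hi']; exact hρ i hi'
    · have hi2 : i ∈ indices (π ++ σ) := by
        simp only [indices_append, List.mem_append] at hi ⊢
        tauto
      rw [h2 i hi2]; exact hπ i hi2

theorem planar_insert {π ρ σ : Struct V}
    (hd : ρ.indices.Disjoint (indices (π ++ σ))) :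
    Planar (π ++ ρ ++ σ) ↔ Planar ρ ∧ Planar (π ++ σ) := by
  constructor
  · intro h
    refine ⟨fun i j hij hs => h i j hij ?_, fun i j hij hs => h i j hij ?_⟩
    · simp only [indices_append]
      exact (hs.trans (List.sublist_append_right _ _)).trans (List.sublist_append_left _ _)
    · refine hs.trans ?_
      simp only [indices_append, List.append_assoc]
      exact List.Sublist.append_left (List.sublist_append_right _ _) _
  · rintro ⟨hρ, hπ⟩ i j hij hs
    simp only [indices_append] at hs hd
    obtain ⟨l', r, hlr, hlm, hr⟩ := List.sublist_append_iff.1 hs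
    obtain ⟨l, m, rfl, hl, hm⟩ := List.sublist_append_iff.1 hlm
    have hd1 : ∀ k ∈ ρ.indices, k ∉ π.indices ∧ k ∉ σ.indices := fun k hk => by
      simpa using fun h => hd hk h
    have hl' : ∀ k ∈ l, k ∉ ρ.indices := fun k hk hk' => (hd1 k hk').1 (hl.subset hk)
    have hm' : ∀ k ∈ m, k ∈ ρ.indices := fun k hk => hm.subset hk
    have hr' : ∀ k ∈ r, k ∉ ρ.indices := fun k hk hk' => (hd1 k hk').2 (hr.subset hk)
    have hout : m ≠ [] := by
      rintro rfl
      refine hπ i j hij ?_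
      rw [hlr]
      simpa using hl.append hr
    have hin : ¬ (l = [] ∧ r = []) := by
      rintro ⟨rfl, rfl⟩
      refine hρ i j hij ?_
      rw [hlr]
      simpa using hm
    clear hl hm hr hs hρ hπ hd hd1 hlm
    generalize ρ.indices = s at *
    -- The part of `i j i j` inside `ρ` is a segment, neither empty nor everything. Such a segment
    -- shares a letter with its complement, against the disjointness of the indices.
    rcases l with - | ⟨x, - | ⟨y, - | ⟨z, - | ⟨w, l⟩⟩⟩⟩ <;>
    rcases m with - | ⟨x', - | ⟨y', - | ⟨z', - | ⟨w', m⟩⟩⟩⟩ <;>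
    simp only [List.nil_append, List.cons_append, List.append_nil, List.cons.injEq,
      List.append_eq_nil_iff, reduceCtorEq, false_and, and_false, List.nil_eq] at hlr <;>
    (try (obtain ⟨rfl, hlr⟩ := hlr)) <;> (try (obtain ⟨rfl, hlr⟩ := hlr)) <;>
    (try (obtain ⟨rfl, hlr⟩ := hlr)) <;> (try (obtain ⟨rfl, hlr⟩ := hlr)) <;>
    (try subst hlr) <;> simp_all <;>
    first | exact (hm' i).1 rfl | exact (hl' i).1 rfl

/-- A family of conclusions that shares no index with the others contains both ends of each of its
axioms. -/
theorem IsLinked.filter {π : Struct V} (h : π.IsLinked) (P : PTree V → Bool)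
    (hP : ∀ t ∈ π, ∀ t' ∈ π, P t → ¬ P t' → t.idx.Disjoint t'.idx) :
    IsLinked (List.filter P π) := by
  intro i hi
  obtain ⟨t, ht', hit⟩ := mem_indices.1 hi
  obtain ⟨ht, hPt⟩ := List.mem_filter.1 ht'
  obtain ⟨F, hF⟩ := h i (mem_indices.2 ⟨t, ht, hit⟩)
  refine ⟨F, ?_⟩
  rw [← hF]
  have key : ∀ t' ∈ π, ¬ P t' → i ∉ t'.idx := fun t' ht' hPt' hi' =>
    hP t ht t' ht' hPt hPt' hit hi'
  clear hi ht ht' hF h hP hit hPt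
  induction π with
  | nil => rfl
  | cons a π ih =>
    have ih := ih (fun t' ht' => key t' (List.mem_cons_of_mem _ ht'))
    by_cases hPa : P a
    · rw [List.filter_cons_of_pos hPa]
      simp [ih]
    · rw [List.filter_cons_of_neg hPa, ih]
      have : a.leaves.filter (fun x => decide (x.2 = i)) = [] := by
        rw [List.filter_eq_nil_iff]
        intro x hx hxi
        exact key a (by simp) hPa (List.mem_map.2 ⟨x, hx, by simpa using hxi⟩)
      simp [this]

-- The graph of a structure and of its parts

theorem graph_adj {π : Struct V} {a b : PTree V} :
    π.graph.Adj a b ↔ a ∈ π.occ ∧ b ∈ π.occ ∧ a ≠ b ∧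
      (a.IsPremise b ∨ b.IsPremise a ∨ a.Linked b) := by
  have : a.Linked b ↔ b.Linked a := ⟨fun h => by cases h; constructor, fun h => by cases h; constructor⟩
  simp only [graph, SimpleGraph.fromRel_adj]
  tauto

theorem graph_mono {π ρ : Struct V} (h : ∀ a ∈ π.occ, a ∈ ρ.occ) : π.graph ≤ ρ.graph := by
  intro a b hab
  rw [graph_adj] at hab ⊢
  exact ⟨h _ hab.1, h _ hab.2.1, hab.2.2⟩

/-- The vertices are the trees themselves, so a cycle of the part is a cycle of the whole with the
same edges, and the par link it must contain is the same. -/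
theorem Acyclic.mono {π ρ : Struct V} (h : ∀ a ∈ π.occ, a ∈ ρ.occ) (hρ : ρ.Acyclic) :
    π.Acyclic := by
  intro t p hp
  obtain ⟨a, b, ha, hb⟩ := hρ t _ (hp.mapLe (graph_mono h))
  rw [SimpleGraph.Walk.edges_mapLe_eq_edges] at ha hb
  exact ⟨a, b, ha, hb⟩

end Struct

end Lambek


namespace Lambek

universe u v

variable {V : Type u}

/-! ### Directed chains in forests -/

section Forest

open Relation

variable {α : Type u} {H : SimpleGraph α} {R : α → α → Prop}

/-- In a forest a chain that never goes straight back is a path: a vertex adjacent to the start of a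
path can only lie on it as its second vertex. The clause on `p.snd` remembers the first step of the
chain, to which the no-return hypothesis is applied. -/
theorem exists_path_of_reflTransGen (hH : H.IsAcyclic) (hR : ∀ a b, R a b → H.Adj a b)
    (h2 : ∀ a b c, R a b → R b c → c ≠ a) {a b : α} (h : ReflTransGen R a b) :
    ∃ p : H.Walk a b, p.IsPath ∧ (p.Nil ∨ R a p.snd) := by
  induction h using ReflTransGen.head_induction_on with
  | refl => exact ⟨.nil, by simp, by simp⟩
  | head hac _ ih =>
    obtain ⟨p, hp, hp'⟩ := ih
    refine ⟨.cons (hR _ _ hac) p, ?_, .inr (by simpa using hac)⟩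
    rw [SimpleGraph.Walk.cons_isPath_iff]
    refine ⟨hp, fun hmem => ?_⟩
    have hsnd := hH.eq_snd_of_adj_start hp (hR _ _ hac).symm hmem
    rcases hp' with hnil | hp'
    · cases hnil
      simp only [SimpleGraph.Walk.support_nil, List.mem_singleton] at hmem
      exact (hR _ _ hac).ne hmem
    · exact h2 _ _ _ hac hp' hsnd.symm

theorem not_transGen_self (hH : H.IsAcyclic) (hR : ∀ a b, R a b → H.Adj a b)
    (h2 : ∀ a b c, R a b → R b c → c ≠ a) (a : α) : ¬ TransGen R a a := by
  intro h
  obtain ⟨c, hac, hca⟩ := TransGen.head'_iff.1 h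
  obtain ⟨p, hp, hp'⟩ := exists_path_of_reflTransGen hH hR h2 hca
  have hsnd := hH.eq_snd_of_adj_start hp (hR _ _ hac).symm (by simp)
  rcases hp' with hnil | hp'
  · cases hnil
    exact (hR _ _ hac).ne rfl
  · exact h2 _ _ _ hac hp' hsnd.symm

end Forest

namespace Struct

open Relation

/-! ### The climbing order -/

/-- One step towards the output conclusion along the climbing order. -/
inductive Nxt (π : Struct V) : PTree V → PTree V → Prop
  | spine {a b : PTree V} :
      a ∈ π.occ → b.IsPremise a → a.formula.IsInput → b.formula.IsInput → Nxt π a b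
  | ax {F : LF V} {i : ℕ} :
      .leaf F i ∈ π.occ → F.IsInput → Nxt π (.leaf F i) (.leaf F.dual i)
  | out {a b : PTree V} :
      b ∈ π.occ → a.IsPremise b → a.formula.IsOutput → Nxt π a b

/-- The hypotheses under which the climbing order is studied. -/
structure Regular (π : Struct V) : Prop where
  linked : π.IsLinked
  acyclic : π.Acyclic
  polar : π.Polar

theorem IsPreNet.regular {π : Struct V} (h : π.IsPreNet) : π.Regular :=
  ⟨h.linked, h.acyclic, h.intuitionistic.polar⟩

variable {π : Struct V}

theorem Nxt.mem_left {a b : PTree V} (h : Nxt π a b) : a ∈ π.occ := by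
  cases h with
  | spine h _ _ _ => exact h
  | ax h _ => exact h
  | out h h' _ => exact mem_occ_of_premise h' h

theorem Nxt.mem_right (hL : π.IsLinked) {a b : PTree V} (h : Nxt π a b) : b ∈ π.occ := by
  cases h with
  | spine h h' _ _ => exact mem_occ_of_premise h' h
  | ax h _ => exact hL.dual_mem h
  | out h h' _ => exact h

theorem Nxt.adj (hL : π.IsLinked) {a b : PTree V} (h : Nxt π a b) : π.graph.Adj a b := by
  rw [graph_adj]
  refine ⟨h.mem_left, h.mem_right hL, ?_, ?_⟩
  · intro hab
    cases h with
    | spine _ h _ _ => have := h.size_lt; rw [hab] at this; omega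
    | ax h _ => exact LF.dual_ne _ (PTree.leaf.inj hab).1.symm
    | out _ h _ => have := h.size_lt; rw [hab] at this; omega
  · cases h with
    | spine _ h _ _ => exact .inr (.inl h)
    | ax h _ => exact .inr (.inr (.mk _ _ _))
    | out h h' _ => exact .inl h'

theorem not_isPremise_leaf {a : PTree V} {F : LF V} {i : ℕ} : ¬ a.IsPremise (.leaf F i) := by
  intro h; cases h

/-- Each edge has one direction: a branch with an input premise is only climbed, a branch with an
output premise is only descended, and an axiom is only crossed from its input end. -/
theorem Nxt.no_return {a b c : PTree V} (h : Nxt π a b) (h' : Nxt π b c) : c ≠ a := by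
  intro hca
  cases h with
  | spine _ h1 _ h2 =>
    cases h' with
    | spine _ h3 _ _ => have := h1.size_lt; have := h3.size_lt; rw [hca] at this; omega
    | ax _ _ => rw [← hca] at h1; exact not_isPremise_leaf h1
    | out _ _ h3 => exact h2.not_isOutput h3
  | ax _ h1 =>
    generalize hb : PTree.leaf _ _ = b at h'
    cases h' with
    | spine _ h3 _ _ => rw [← hb] at h3; exact not_isPremise_leaf h3
    | out _ h3 _ => rw [hca] at h3; exact not_isPremise_leaf h3
    | ax _ h3 => rw [← (PTree.leaf.inj hb).1] at h3; exact (LF.isInput_dual.1 h3).not_isInput h1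
  | out _ h1 h2 =>
    cases h' with
    | spine _ _ _ h4 => rw [hca] at h4; exact h2.not_isInput h4
    | ax _ h3 => exact not_isPremise_leaf h1
    | out _ h3 _ => have := h1.size_lt; have := h3.size_lt; rw [hca] at this; omega

/-- An input tensor has a single input premise, and an occurrence is a premise of at most one link.
-/
theorem Nxt.functional (hR : π.Regular) {a b c : PTree V} (h : Nxt π a b) (h' : Nxt π a c) :
    b = c := by
  cases h with
  | spine ha h1 h2 h3 =>
    cases h' with
    | spine _ h4 _ h6 =>
      cases h1 <;> cases h4 <;> simp [PTree.formula, LF.isInput_tens] at h2 <;>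
        first
        | rfl
        | rcases h2 with h2 | h2
          · exact absurd ‹PTree.formula _ |>.IsInput› h2.1.not_isInput
          · exact absurd ‹PTree.formula _ |>.IsInput› h2.2.not_isInput
    | ax _ _ => exact absurd h1 not_isPremise_leaf
    | out _ _ h4 => exact absurd h2 h4.not_isInput
  | ax ha h1 =>
    cases h' with
    | spine _ h3 _ _ => exact absurd h3 not_isPremise_leaf
    | ax _ h3 => rfl
    | out _ _ h3 => exact absurd h1 h3.not_isInput
  | out hb h1 h2 =>
    cases h' with
    | spine _ _ h4 _ => exact absurd h4 h2.not_isInput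
    | ax _ h3 => exact absurd h3 h2.not_isInput
    | out hc h3 _ => exact premise_unique hR.linked.nodup hb hc h1 h3

theorem Regular.exists_nxt (hR : π.Regular) {a : PTree V} (ha : a ∈ π.occ) :
    (a ∈ π ∧ a.formula.IsOutput) ∨ ∃ b, Nxt π a b := by
  rcases hR.polar.occ ha with h | h
  · rcases root_or_premise ha with h' | ⟨b, hb, hab⟩
    · exact .inl ⟨h', h⟩
    · exact .inr ⟨b, .out hb hab h⟩
  · right
    cases a with
    | leaf F i => exact ⟨_, .ax ha h⟩
    | tens x y =>
      rcases LF.isInput_tens.1 h with h' | h'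
      · exact ⟨y, .spine ha (.tens_right _ _) h h'.2⟩
      · exact ⟨x, .spine ha (.tens_left _ _) h h'.1⟩
    | par x y => exact absurd h (LF.not_isInput_par _ _)

/-- The form in which the criterion is applied: a subgraph that never has both branches of a par
link, as a switching, is a forest. -/
theorem Acyclic.isAcyclic (hA : π.Acyclic) {H : SimpleGraph (PTree V)} (hH : H ≤ π.graph)
    (hpar : ∀ a b : PTree V, H.Adj a (.par a b) → H.Adj b (.par a b) → False) :
    H.IsAcyclic := by
  intro t p hp
  obtain ⟨a, b, ha, hb⟩ := hA t _ (hp.mapLe hH)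
  rw [SimpleGraph.Walk.edges_mapLe_eq_edges] at ha hb
  exact hpar a b (p.adj_of_mem_edges ha) (p.adj_of_mem_edges hb)

/-- The forest of the climbing order. -/
def climbGraph (π : Struct V) : SimpleGraph (PTree V) := SimpleGraph.fromRel (Nxt π)

theorem Nxt.climbGraph_adj (hL : π.IsLinked) {a b : PTree V} (h : Nxt π a b) :
    π.climbGraph.Adj a b := by
  rw [climbGraph, SimpleGraph.fromRel_adj]
  exact ⟨(h.adj hL).ne, .inl h⟩

/-- The climbing order never uses the branch from an input premise of a par link. As only one
premise is an output, it never has both branches. -/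
theorem nxt_par {a p : PTree V} (hp : p.formula.IsOutput) (hap : a.IsPremise p)
    (h : Nxt π a p ∨ Nxt π p a) : a.formula.IsOutput := by
  rcases h with h | h
  · cases h with
    | spine _ h _ _ => have := h.size_lt; have := hap.size_lt; omega
    | ax _ _ => exact absurd hap not_isPremise_leaf
    | out _ _ h => exact h
  · cases h with
    | spine _ _ h _ => exact absurd h hp.not_isInput
    | ax _ _ => exact absurd hap not_isPremise_leaf
    | out _ h _ => have := h.size_lt; have := hap.size_lt; omega

theorem Regular.isOutput_par (hR : π.Regular) {a b : PTree V} (h : .par a b ∈ π.occ) :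
    (PTree.par a b).formula.IsOutput := by
  rcases hR.polar.occ h with h | h
  · exact h
  · exact absurd h (LF.not_isInput_par _ _)

theorem Regular.not_isOutput_both (hR : π.Regular) {a b : PTree V} (h : .par a b ∈ π.occ)
    (ha : a.formula.IsOutput) (hb : b.formula.IsOutput) : False := by
  rcases LF.isOutput_par.1 (hR.isOutput_par h) with h | h
  · exact ha.not_isInput h.1
  · exact hb.not_isInput h.2

theorem Regular.isAcyclic_climbGraph (hR : π.Regular) : π.climbGraph.IsAcyclic := by
  refine hR.acyclic.isAcyclic ?_ ?_
  · intro a b hab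
    rw [climbGraph, SimpleGraph.fromRel_adj] at hab
    rcases hab.2 with h | h
    · exact h.adj hR.linked
    · exact (h.adj hR.linked).symm
  · intro a b ha hb
    rw [climbGraph, SimpleGraph.fromRel_adj] at ha hb
    have hmem : .par a b ∈ π.occ := by
      rcases ha.2 with h | h
      · exact h.mem_right hR.linked
      · exact h.mem_left
    have ho := hR.isOutput_par hmem
    exact hR.not_isOutput_both hmem (nxt_par ho (.par_left _ _) ha.2)
      (nxt_par ho (.par_right _ _) hb.2)

theorem Regular.not_transGen_self (hR : π.Regular) (a : PTree V) :
    ¬ TransGen (Nxt π) a a :=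
  Lambek.not_transGen_self hR.isAcyclic_climbGraph (fun _ _ h => h.climbGraph_adj hR.linked)
    (fun _ _ _ h h' => h.no_return h') a

/-- Each occurrence is led to an output conclusion. -/
theorem Regular.reaches_output (hR : π.Regular) {a : PTree V} (ha : a ∈ π.occ) :
    ∃ r ∈ π, r.formula.IsOutput ∧ ReflTransGen (Nxt π) a r := by
  have hfin : Finite {x // x ∈ π.occ} := List.finite_toSet π.occ
  let r : {x // x ∈ π.occ} → {x // x ∈ π.occ} → Prop := fun x y => TransGen (Nxt π) y.1 x.1
  have : IsTrans _ r := ⟨fun x y z h h' => TransGen.trans h' h⟩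
  have : Std.Irrefl r := ⟨fun x h => hR.not_transGen_self x.1 h⟩
  have hwf : WellFounded r := Finite.wellFounded_of_trans_of_irrefl r
  suffices ∀ x : {x // x ∈ π.occ}, ∃ r ∈ π, r.formula.IsOutput ∧ ReflTransGen (Nxt π) x.1 r from
    this ⟨a, ha⟩
  intro x
  induction x using hwf.induction with
  | _ x ih =>
    rcases hR.exists_nxt x.2 with h | ⟨b, hb⟩
    · exact ⟨x.1, h.1, h.2, .refl⟩
    · obtain ⟨s, hs, hs', h⟩ := ih ⟨b, hb.mem_right hR.linked⟩ (.single hb)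
      exact ⟨s, hs, hs', .head hb h⟩

/-- The climbing order would have no place to end. This is the only form of connectedness used for
nets: a part without output is empty. -/
theorem Regular.eq_nil (hR : π.Regular) (h : ∀ t ∈ π, t.formula.IsInput) : π = [] := by
  rw [List.eq_nil_iff_forall_not_mem]
  intro t ht
  obtain ⟨r, hr, hr', -⟩ := hR.reaches_output (mem_occ_of_mem ht)
  exact (h r hr).not_isOutput hr'

/-- The climbing order leads from the input premise of a par link to its conclusion. -/
theorem Regular.reaches_par (hR : π.Regular)
    (huniq : ∀ r ∈ π, ∀ r' ∈ π, r.formula.IsOutput → r'.formula.IsOutput → r = r')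
    {y p : PTree V} (hp : p ∈ π.occ) (hyp : y.IsPremise p) (hpo : p.formula.IsOutput)
    (hy : y.formula.IsInput) : ReflTransGen (Nxt π) y p := by
  by_contra hn
  have hyp_ne : y ≠ p := fun h => by have := hyp.size_lt; rw [h] at this; omega
  -- The link of `p` is switched to its input branch: the climbing steps entering `p` are dropped,
  -- the edge from `y` to `p` is added. The graph `H` still never has both branches of a par link.
  let R : PTree V → PTree V → Prop := fun a b => Nxt π a b ∧ b ≠ p
  let H : SimpleGraph (PTree V) := SimpleGraph.fromRel fun a b => R a b ∨ (a = y ∧ b = p)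
  have hHle : H ≤ π.graph := by
    have key : ∀ a b, R a b ∨ (a = y ∧ b = p) → π.graph.Adj a b := by
      rintro a b (h | ⟨rfl, rfl⟩)
      · exact h.1.adj hR.linked
      · exact graph_adj.2 ⟨mem_occ_of_premise hyp hp, hp, hyp_ne, .inl hyp⟩
    intro a b hab
    rw [SimpleGraph.fromRel_adj] at hab
    rcases hab.2 with h | h
    · exact key _ _ h
    · exact (key _ _ h).symm
  have hHac : H.IsAcyclic := by
    refine hR.acyclic.isAcyclic hHle ?_
    intro a b ha hb
    have hmem : .par a b ∈ π.occ := (graph_adj.1 (hHle ha)).2.1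
    have ho := hR.isOutput_par hmem
    have key : ∀ c : PTree V, c.IsPremise (.par a b) → H.Adj c (.par a b) →
        c.formula.IsOutput ∨ (c = y ∧ .par a b = p) := by
      intro c hc h
      rw [SimpleGraph.fromRel_adj] at h
      rcases h.2 with (h | h) | (h | h)
      · exact .inl (nxt_par ho hc (.inl h.1))
      · exact .inr h
      · exact .inl (nxt_par ho hc (.inr h.1))
      · have := hc.size_lt
        rw [h.1, h.2] at this
        have := hyp.size_lt
        omega
    have key2 : ∀ c : PTree V, c.IsPremise (.par a b) → H.Adj c (.par a b) →
        .par a b = p → c.formula.IsInput := by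
      intro c hc h hpar
      rw [SimpleGraph.fromRel_adj] at h
      rcases h.2 with (h | h) | (h | h)
      · exact absurd hpar h.2
      · rw [h.1]; exact hy
      · cases h.1 with
        | spine _ _ h _ => exact absurd h ho.not_isInput
        | out _ h _ => have := hc.size_lt; have := h.size_lt; omega
      · have := hc.size_lt
        rw [h.1, h.2] at this
        have := hyp.size_lt
        omega
    by_cases hpar : .par a b = p
    · have h1 := key2 a (.par_left _ _) ha hpar
      have h2 := key2 b (.par_right _ _) hb hpar
      rcases LF.isOutput_par.1 ho with h | h
      · exact h.2.not_isInput h2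
      · exact h.1.not_isInput h1
    · have h1 := (key a (.par_left _ _) ha).resolve_right (fun h => hpar h.2)
      have h2 := (key b (.par_right _ _) hb).resolve_right (fun h => hpar h.2)
      exact hR.not_isOutput_both hmem h1 h2
  have hRadj : ∀ a b, R a b → H.Adj a b := fun a b h => by
    rw [SimpleGraph.fromRel_adj]
    exact ⟨(h.1.adj hR.linked).ne, .inl (.inl h)⟩
  have hR2 : ∀ a b c, R a b → R b c → c ≠ a := fun a b c h h' => h.1.no_return h'.1
  have lift : ∀ a r, ReflTransGen (Nxt π) a r → (∀ b, TransGen (Nxt π) a b → b ≠ p) →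
      ReflTransGen R a r := by
    intro a r h hb
    induction h with
    | refl => exact .refl
    | tail h1 h2 ih => exact .tail ih ⟨h2, hb _ (TransGen.tail' h1 h2)⟩
  -- Both `y` and `p` are led to the same output conclusion `r`, by chains that do not enter `p`:
  -- the first by the assumption to be refuted, the second because the climbing order has no cycle.
  -- Both are thus paths of `H`.
  obtain ⟨r, hr, hro, hyr⟩ := hR.reaches_output (mem_occ_of_premise hyp hp)
  obtain ⟨r', hr', hro', hpr⟩ := hR.reaches_output hp
  obtain rfl := huniq r hr r' hr' hro hro'
  obtain ⟨P, hP, hP'⟩ := exists_path_of_reflTransGen hHac hRadj hR2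
    (lift y r hyr (by rintro b hb rfl; exact hn hb.to_reflTransGen))
  obtain ⟨Q, hQ, hQ'⟩ := exists_path_of_reflTransGen hHac hRadj hR2
    (lift p r hpr (by rintro b hb rfl; exact hR.not_transGen_self _ hb))
  have hadj : H.Adj p y := by
    rw [SimpleGraph.fromRel_adj]
    exact ⟨hyp_ne.symm, .inr (.inr ⟨rfl, rfl⟩)⟩
  have hcons : (SimpleGraph.Walk.cons hadj P).IsPath := by
    rw [SimpleGraph.Walk.cons_isPath_iff]
    refine ⟨hP, fun hmem => ?_⟩
    have hsnd := hHac.eq_snd_of_adj_start hP hadj.symm hmem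
    rcases hP' with hnil | hP'
    · cases hnil
      simp only [SimpleGraph.Walk.support_nil, List.mem_singleton] at hmem
      exact hyp_ne hmem.symm
    · exact hP'.2 hsnd.symm
  -- By uniqueness of paths in a forest, the way from `p` through `y` to `r` is the chain that
  -- starts at `p`, so `y` would be the occurrence next to `p`. But `p` is an output and `y` lies
  -- above it.
  have heq : SimpleGraph.Walk.cons hadj P = Q :=
    congrArg Subtype.val ((hHac.subsingleton_path p r).elim ⟨_, hcons⟩ ⟨Q, hQ⟩)
  subst heq
  rcases hQ' with hnil | hQ'
  · simp at hnil
  · have h := hQ'.1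
    simp only [SimpleGraph.Walk.snd_cons] at h
    cases h with
    | spine _ _ h _ => exact hpo.not_isInput h
    | ax _ h => exact hpo.not_isInput h
    | out _ h _ => have := hyp.size_lt; have := h.size_lt; omega

end Struct

end Lambek


namespace Lambek

universe u v

variable {V : Type u}

/-! ### Contiguity in noncrossing sequences of blocks -/

section Blocks

variable {α : Type u}

theorem four_blocks_sublist {idx : α → List ℕ} {i j : ℕ} {A B C D : List α}
    (hA : ∃ t ∈ A, i ∈ idx t) (hB : ∃ t ∈ B, j ∈ idx t) (hC : ∃ t ∈ C, i ∈ idx t)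
    (hD : ∃ t ∈ D, j ∈ idx t) : [i, j, i, j].Sublist ((A ++ (B ++ (C ++ D))).flatMap idx) := by
  simp only [List.flatMap_append]
  have key : ∀ {k : ℕ} {E : List α}, (∃ t ∈ E, k ∈ idx t) → [k].Sublist (E.flatMap idx) := by
    intro k E h
    exact List.singleton_sublist.2 (List.mem_flatMap.2 h)
  exact (key hA).append ((key hB).append ((key hC).append (key hD)))

/-- In a noncrossing sequence of blocks without closed families in `B`, the blocks of `B` that
are tied to `g` come first. -/
theorem exists_contiguous {idx : α → List ℕ} {S : α → Prop} {Pre B Post : List α} {g : α}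
    (hnc : ∀ i j, i ≠ j → ¬ [i, j, i, j].Sublist ((Pre ++ g :: (B ++ Post)).flatMap idx))
    (hg : S g) (hPre : ∀ t ∈ Pre, ¬ S t) (hPost : ∀ t ∈ Post, ¬ S t)
    (hsep : ∀ t ∈ Pre ++ g :: (B ++ Post), ∀ t' ∈ Pre ++ g :: (B ++ Post), ∀ i, i ∈ idx t →
      i ∈ idx t' → S t → S t')
    (hcl : ∀ Q : α → Prop, (∀ t ∈ B, Q t → ∀ t' ∈ Pre ++ g :: (B ++ Post), ∀ i, i ∈ idx t →
      i ∈ idx t' → t' ∈ B ∧ Q t') → ∀ t ∈ B, ¬ Q t) :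
    ∃ D B', B = D ++ B' ∧ (∀ t ∈ D, S t) ∧ ∀ t ∈ B', ¬ S t := by
  classical
  have hcl' : ∀ Q : α → Prop, (∃ t ∈ B, Q t) → ∃ t ∈ B, Q t ∧ ∃ t' ∈ Pre ++ g :: (B ++ Post),
      ∃ i, i ∈ idx t ∧ i ∈ idx t' ∧ (t' ∈ B → ¬ Q t') := by
    intro Q ⟨t, ht, hQt⟩
    by_contra hcon
    push Not at hcon
    exact hcl Q (fun t ht hQ t' ht' i hi hi' => hcon t ht hQ t' ht' i hi hi') t ht hQt
  clear hcl
  have hsplit : ∀ l : List α, (∀ t ∈ l, S t) ∨ ∃ D c E, l = D ++ c :: E ∧ (∀ t ∈ D, S t) ∧ ¬ S c := by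
    intro l
    induction l with
    | nil => simp
    | cons a l ih =>
      by_cases ha : S a
      · rcases ih with ih | ⟨D, c, E, rfl, hD, hc⟩
        · left; simpa [ha] using ih
        · exact .inr ⟨a :: D, c, E, rfl, by simpa [ha] using hD, hc⟩
      · exact .inr ⟨[], a, l, rfl, by simp, ha⟩
  -- `D` is the longest initial segment in `S` and `c` the first block outside; a block of `S` after
  -- `c` has to be excluded.
  rcases hsplit B with h | ⟨D, c, E, rfl, hD, hc⟩
  · exact ⟨B, [], by simp, h, by simp⟩
  refine ⟨D, c :: E, rfl, hD, ?_⟩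
  by_contra hcon
  push Not at hcon
  obtain ⟨s, hs, hSs⟩ := hcon
  have hs : s ∈ E := by
    rcases List.mem_cons.1 hs with rfl | hs
    · exact absurd hSs hc
    · exact hs
  -- The blocks of `S` after `c` are not a closed family, so one of them, `t`, is tied by `e` to a
  -- block `t'` outside this family. That block is in `S` too, hence among `g` and `D`.
  obtain ⟨t, ht, ⟨hSt, htE⟩, t', ht', e, het, het', hbad⟩ :=
    hcl' (fun t => S t ∧ t ∈ E) ⟨s, by simp [hs], hSs, hs⟩
  have hSt' : S t' := hsep t (by
    simp only [List.mem_append, List.mem_cons] at ht ⊢; tauto) t' ht' e het het' hSt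
  have ht'D : t' ∈ g :: D := by
    simp only [List.mem_append, List.mem_cons] at ht' ⊢
    rcases ht' with h | h | ((h | h | h) | h)
    · exact absurd hSt' (hPre _ h)
    · exact .inl h
    · exact .inr h
    · rw [h] at hSt'; exact absurd hSt' hc
    · exact absurd ⟨hSt', h⟩ (hbad (by simp [h]))
    · exact absurd hSt' (hPost _ h)
  obtain ⟨E₁, E₂, rfl⟩ := List.append_of_mem htE
  -- Likewise the blocks outside `S` from `c` up to `t` are not closed: one of them, `w`, is tied by
  -- `j` to a block `w'` that lies in `Pre` or after `t`.
  obtain ⟨w, hw, ⟨hSw, hwE⟩, w', hw', j, hjw, hjw', hbad'⟩ :=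
    hcl' (fun u => ¬ S u ∧ u ∈ c :: E₁) ⟨c, by simp, hc, by simp⟩
  have hwM : w ∈ Pre ++ g :: ((D ++ c :: (E₁ ++ t :: E₂)) ++ Post) := by
    simp only [List.mem_append, List.mem_cons] at hw ⊢; tauto
  have htM : t ∈ Pre ++ g :: ((D ++ c :: (E₁ ++ t :: E₂)) ++ Post) := by
    simp
  have hSw' : ¬ S w' := fun h => hSw (hsep w' hw' w hwM j hjw' hjw h)
  have hej : e ≠ j := by
    rintro rfl
    exact hSw (hsep t htM w hwM e het hjw hSt)
  have cases_w' : w' ∈ Pre ∨ w' ∈ E₂ ++ Post := by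
    simp only [List.mem_append, List.mem_cons] at hw' ⊢
    rcases hw' with h | h | ((h | h | h | h | h) | h)
    · exact .inl h
    · rw [h] at hSw'; exact absurd hg hSw'
    · exact absurd (hD _ h) hSw'
    · exact absurd ⟨hSw', by simp [h]⟩ (hbad' (by simp [h]))
    · exact absurd ⟨hSw', by simp [h]⟩ (hbad' (by simp [h]))
    · rw [h] at hSw'; exact absurd hSt hSw'
    · exact .inr (.inl h)
    · exact .inr (.inr h)
  -- The order of the blocks is `w'`, `t'`, `w`, `t` or `t'`, `w`, `t`, `w'`; either way `e` and `j`
  -- cross.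
  rcases cases_w' with h | h
  · refine hnc j e hej.symm ?_
    have := four_blocks_sublist (idx := idx) (A := Pre) (B := g :: D) (C := c :: E₁)
      (D := t :: (E₂ ++ Post)) ⟨w', h, hjw'⟩ ⟨t', ht'D, het'⟩ ⟨w, hwE, hjw⟩ ⟨t, by simp, het⟩
    simpa using this
  · refine hnc e j hej ?_
    have := four_blocks_sublist (idx := idx) (A := Pre ++ g :: D) (B := c :: E₁) (C := [t])
      (D := E₂ ++ Post) ⟨t', by simp only [List.mem_append]; exact .inr ht'D, het'⟩
      ⟨w, hwE, hjw⟩ ⟨t, by simp, het⟩ ⟨w', h, hjw'⟩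
    simpa using this

end Blocks

namespace Struct

open Relation

variable {π : Struct V}

/-! ### Splitting a proof net at the last tensor link of its head -/

/-- `Spine z c`: one goes down from `z` to `c` through input premises of tensor links. -/
inductive Spine (z : PTree V) : PTree V → Prop
  | refl : z.formula.IsInput → Spine z z
  | step {a b : PTree V} :
      a.IsPremise b → a.formula.IsInput → b.formula.IsInput → Spine z a → Spine z b

theorem Spine.isInput {z c : PTree V} (h : Spine z c) : c.formula.IsInput := by
  cases h with
  | refl h => exact h
  | step _ _ h _ => exact h

theorem Spine.mem_subtrees {z c : PTree V} (h : Spine z c) : z ∈ c.subtrees := by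
  induction h with
  | refl _ => simp
  | step h _ _ _ ih => exact PTree.subtrees_trans ih h.mem_subtrees

/-- From the spine the climbing order goes back up the spine, crosses the axiom, and stops at the
output conclusion, which is the only output on the way. -/
theorem Spine.eq_output (hR : π.Regular) {C : Cat V} {i : ℕ} (ho : .leaf C.pos i ∈ π)
    {c p : PTree V} (hc : Spine (.leaf C.neg i) c) (hcp : ReflTransGen (Nxt π) c p)
    (hp : p.formula.IsOutput) : p = .leaf C.pos i := by
  have key : Spine (.leaf C.neg i) p ∨ p = .leaf C.pos i := by
    clear hp
    induction hcp with
    | refl => exact .inl hc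
    | tail _ h ih =>
      rcases ih with ih | rfl
      · cases ih with
        | refl _ =>
          right
          have := h.functional hR (.ax h.mem_left C.isInput_neg)
          rw [this, Cat.dual_neg]
        | step h1 h2 h3 h4 =>
          left
          rw [h.functional hR (.spine h.mem_left h1 h3 h2)]
          exact h4
      · exfalso
        cases h with
        | spine _ h _ _ => exact not_isPremise_leaf h
        | ax _ h => simp at h
        | out hb h _ => exact not_root_of_premise hR.linked.nodup hb h ho
  rcases key with h | h
  · exact absurd hp h.isInput.not_isOutput
  · exact h

theorem Regular.not_nxt_output_root (hR : π.Regular) {o b : PTree V} (ho : o ∈ π)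
    (hoo : o.formula.IsOutput) : ¬ Nxt π o b := by
  intro h
  cases h with
  | spine _ _ h _ => exact hoo.not_isInput h
  | ax _ h => exact hoo.not_isInput h
  | out hb h _ => exact not_root_of_premise hR.linked.nodup hb h ho

/-- The data of a proof net whose output conclusion is a leaf `o`, with the last link
of its head. -/
structure HeadSplit (π : Struct V) (C : Cat V) (i : ℕ) (c x g : PTree V) : Prop where
  regular : π.Regular
  uniq : ∀ r ∈ π, ∀ r' ∈ π, r.formula.IsOutput → r'.formula.IsOutput → r = r'
  out_mem : .leaf C.pos i ∈ π
  root_mem : c ∈ π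
  root_input : c.formula.IsInput
  spine : Spine (.leaf C.neg i) x
  x_premise : x.IsPremise c
  g_premise : g.IsPremise c
  g_output : g.formula.IsOutput

namespace HeadSplit

variable {C : Cat V} {i : ℕ} {c x g : PTree V}

theorem nxt_g (h : HeadSplit π C i c x g) : Nxt π g c :=
  .out (mem_occ_of_mem h.root_mem) h.g_premise h.g_output

theorem nxt_c (h : HeadSplit π C i c x g) : Nxt π c x :=
  .spine (mem_occ_of_mem h.root_mem) h.x_premise h.root_input h.spine.isInput

theorem spine_c (h : HeadSplit π C i c x g) : Spine (.leaf C.neg i) c :=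
  .step h.x_premise h.spine.isInput h.root_input h.spine

/-- The climbing order is a function, so being led to `g` is invariant along a step, unless the step
starts at `g` itself, in which case it enters `c`. -/
theorem iff_of_nxt (h : HeadSplit π C i c x g) {a b : PTree V} (hab : Nxt π a b) (hbc : b ≠ c) :
    ReflTransGen (Nxt π) a g ↔ ReflTransGen (Nxt π) b g := by
  constructor
  · intro ha
    rcases ReflTransGen.cases_head ha with rfl | ⟨b', hab', hb'⟩
    · exact absurd (hab.functional h.regular h.nxt_g) hbc
    · rwa [hab.functional h.regular hab']
  · exact fun hb => .head hab hb

/-- The input branch of a par link is no climbing step, but its premise `a` is led to its conclusion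
`b`. If `g` came strictly before `b` on that way, it would be followed by `c`, after which the only
output is a leaf; `b` is not a leaf. -/
theorem iff_of_premise (h : HeadSplit π C i c x g) {a b : PTree V} (hb : b ∈ π.occ)
    (hab : a.IsPremise b) (hbc : b ≠ c) :
    ReflTransGen (Nxt π) a g ↔ ReflTransGen (Nxt π) b g := by
  have ha := mem_occ_of_premise hab hb
  rcases h.regular.polar.occ ha with hao | hai
  · exact h.iff_of_nxt (.out hb hab hao) hbc
  · rcases h.regular.polar.occ hb with hbo | hbi
    · have hreach := h.regular.reaches_par h.uniq hb hab hbo hai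
      refine ⟨fun hag => ?_, fun hbg => hreach.trans hbg⟩
      rcases ReflTransGen.total_of_right_unique
        (fun _ _ _ h1 h2 => h1.functional h.regular h2) hreach hag with h1 | h1
      · exact h1
      · rcases ReflTransGen.cases_head h1 with rfl | ⟨c', hc', hcb⟩
        · exact .refl
        · rw [hc'.functional h.regular h.nxt_g] at hcb
          rw [h.spine_c.eq_output h.regular h.out_mem hcb hbo] at hab
          exact absurd hab not_isPremise_leaf
    · refine (h.iff_of_nxt (.spine hb hab hbi hai) ?_).symm
      rintro rfl
      exact not_root_of_premise h.regular.linked.nodup hb hab h.root_mem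

theorem iff_of_subtree (h : HeadSplit π C i c x g) {t u : PTree V} (ht : t ∈ π.occ)
    (hct : c ∉ t.subtrees) (hu : u ∈ t.subtrees) :
    ReflTransGen (Nxt π) u g ↔ ReflTransGen (Nxt π) t g := by
  have main : ∀ t t' : PTree V, t ∈ π.occ → c ∉ t.subtrees → t'.IsPremise t →
      (t' ∈ π.occ → c ∉ t'.subtrees → u ∈ t'.subtrees →
        (ReflTransGen (Nxt π) u g ↔ ReflTransGen (Nxt π) t' g)) →
      u ∈ t'.subtrees → (ReflTransGen (Nxt π) u g ↔ ReflTransGen (Nxt π) t g) := by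
    intro t t' ht hct ht' ih hu
    have hne : t ≠ c := by rintro rfl; simp at hct
    rw [ih (mem_occ_of_premise ht' ht)
      (fun hc => hct (PTree.subtrees_trans hc ht'.mem_subtrees)) hu,
      h.iff_of_premise ht ht' hne]
  induction t with
  | leaf F j => simp [PTree.subtrees] at hu; rw [hu]
  | tens a b iha ihb =>
    have hu' := hu
    simp only [PTree.subtrees, List.mem_cons, List.mem_append] at hu'
    rcases hu' with rfl | hu' | hu'
    · rfl
    · exact main _ a ht hct (.tens_left _ _) iha hu'
    · exact main _ b ht hct (.tens_right _ _) ihb hu'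
  | par a b iha ihb =>
    have hu' := hu
    simp only [PTree.subtrees, List.mem_cons, List.mem_append] at hu'
    rcases hu' with rfl | hu' | hu'
    · rfl
    · exact main _ a ht hct (.par_left _ _) iha hu'
    · exact main _ b ht hct (.par_right _ _) ihb hu'

theorem iff_of_leaf (h : HeadSplit π C i c x g) {F G : LF V} {j : ℕ}
    (hF : PTree.leaf F j ∈ π.occ) (hG : PTree.leaf G j ∈ π.occ) :
    ReflTransGen (Nxt π) (.leaf F j) g ↔ ReflTransGen (Nxt π) (.leaf G j) g := by
  have hne : ∀ {H : LF V}, PTree.leaf H j ≠ c := by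
    rintro H rfl
    exact not_isPremise_leaf h.x_premise
  rcases h.regular.linked.eq_or_eq_dual hF hG with rfl | rfl
  · rfl
  · rcases h.regular.polar.occ hF with ho | hi
    · have := h.iff_of_nxt (.ax hG (LF.isInput_dual.2 ho)) hne
      rw [LF.dual_dual] at this
      exact this.symm
    · exact h.iff_of_nxt (.ax hF hi) hne

/-- Once the link of `c` is removed, being led to `g` is constant on trees and across axioms: this
link is the only tie between the part of `g` and the rest. -/
theorem iff_of_index (h : HeadSplit π C i c x g) {t t' : PTree V} (ht : t ∈ π.occ)
    (ht' : t' ∈ π.occ) (hct : c ∉ t.subtrees) (hct' : c ∉ t'.subtrees) {j : ℕ}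
    (hj : j ∈ t.idx) (hj' : j ∈ t'.idx) :
    ReflTransGen (Nxt π) t g ↔ ReflTransGen (Nxt π) t' g := by
  obtain ⟨F, hF⟩ := PTree.exists_leaf_of_mem_idx hj
  obtain ⟨G, hG⟩ := PTree.exists_leaf_of_mem_idx hj'
  rw [← h.iff_of_subtree ht hct hF, ← h.iff_of_subtree ht' hct' hG]
  exact h.iff_of_leaf (mem_occ_of_subtree hF ht) (mem_occ_of_subtree hG ht')

/-- Otherwise `c`, `x`, `g`, `c` would be a cycle of the climbing order. -/
theorem not_x (h : HeadSplit π C i c x g) : ¬ ReflTransGen (Nxt π) x g := fun hx =>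
  h.regular.not_transGen_self c (TransGen.trans_right (.head h.nxt_c hx) (.single h.nxt_g))

theorem not_o (h : HeadSplit π C i c x g) : ¬ ReflTransGen (Nxt π) (.leaf C.pos i) g := by
  intro ho
  rcases ReflTransGen.cases_head ho with hog | ⟨b, hb, -⟩
  · exact not_root_of_premise h.regular.linked.nodup (mem_occ_of_mem h.root_mem) h.g_premise
      (hog ▸ h.out_mem)
  · exact h.regular.not_nxt_output_root h.out_mem C.isOutput_pos hb

end HeadSplit

/-- A family of input conclusions that is closed under the axiom links is empty. -/
theorem not_closed {M : Struct V} (hL : M.IsLinked) (hA : π.Acyclic)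
    (hocc : ∀ a ∈ M.occ, a ∈ π.occ) {B : Struct V} (hBM : ∀ t ∈ B, t ∈ M)
    (hB : ∀ t ∈ B, t.formula.IsInput) (Q : PTree V → Prop)
    (hQ : ∀ t ∈ B, Q t → ∀ t' ∈ M, ∀ i, i ∈ t.idx → i ∈ t'.idx → t' ∈ B ∧ Q t') :
    ∀ t ∈ B, ¬ Q t := by
  classical
  intro t ht hQt
  let P : PTree V → Bool := fun t => decide (t ∈ B ∧ Q t)
  have hreg : Regular (List.filter P M) := by
    refine ⟨hL.filter P ?_, hA.mono ?_, ?_⟩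
    · intro t ht t' ht' hPt hPt' i hi hi'
      simp only [P, decide_eq_true_eq] at hPt hPt'
      exact hPt' (hQ t hPt.1 hPt.2 t' ht' i hi hi')
    · intro a ha
      obtain ⟨s, hs, has⟩ := mem_occ.1 ha
      exact hocc a (mem_occ.2 ⟨s, (List.mem_filter.1 hs).1, has⟩)
    · intro s hs
      have := (List.mem_filter.1 hs).2
      simp only [P, decide_eq_true_eq] at this
      exact .inr (hB s this.1)
  have := hreg.eq_nil (fun s hs => by
    have := (List.mem_filter.1 hs).2
    simp only [P, decide_eq_true_eq] at this
    exact hB s this.1)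
  rw [List.filter_eq_nil_iff] at this
  exact this t (hBM t ht) (by simp [P, ht, hQt])

end Struct

end Lambek


namespace Lambek

universe u v

variable {V : Type u}

namespace Struct

open Relation

variable {π : Struct V}

/-- Acyclicity and the exclusion of subnets with a single conclusion are inherited by any smaller
set of occurrences; only the other conditions depend on the conclusions and their arrangement. -/
theorem IsProofNet.of_subset {ρ : Struct V} (h : π.IsProofNet) (hL : ρ.IsLinked)
    (hP : ρ.Planar) (hI : ρ.Intuitionistic) (hocc : ∀ a ∈ ρ.occ, a ∈ π.occ) : ρ.IsProofNet :=
  ⟨⟨hL, h.acyclic.mono hocc, hI, hP⟩, fun c hc => h.nonempty_antecedents c (hocc c hc)⟩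

theorem Intuitionistic.of_concat {L : Struct V} {o : PTree V} (h : Intuitionistic (L ++ [o])) :
    o.formula.IsOutput ∧ ∀ t ∈ L, t.formula.IsInput := by
  obtain ⟨L', o', heq, ho, hL⟩ := h
  obtain ⟨rfl, h⟩ := List.append_inj' heq rfl
  simp only [List.cons.injEq, and_true] at h
  exact ⟨h ▸ ho, hL⟩

theorem Intuitionistic.uniq (h : π.Intuitionistic) :
    ∀ r ∈ π, ∀ r' ∈ π, r.formula.IsOutput → r'.formula.IsOutput → r = r' := by
  obtain ⟨L, o, rfl, -, hL⟩ := h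
  have key : ∀ r ∈ L ++ [o], r.formula.IsOutput → r = o := by
    intro r hr hro
    rcases List.mem_append.1 hr with hr | hr
    · exact absurd hro (hL r hr).not_isOutput
    · simpa using hr
  intro r hr r' hr' hro hro'
  rw [key r hr hro, key r' hr' hro']

theorem not_mem_subtrees_of_nodup {A B : Struct V} {c t : PTree V}
    (hn : (leaves (A ++ c :: B)).Nodup) (ht : t ∈ A ∨ t ∈ B) : c ∉ t.subtrees := by
  intro hc
  obtain ⟨x, hx⟩ := List.exists_mem_of_ne_nil _ c.leaves_ne_nil
  have hxt := PTree.leaves_subset_of_mem_subtrees hc hx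
  rw [leaves_append, leaves_cons] at hn
  obtain ⟨-, hn2, hd⟩ := List.nodup_append'.1 hn
  rcases ht with ht | ht
  · exact hd (List.mem_flatMap.2 ⟨t, ht, hxt⟩) (List.mem_append_left _ hx)
  · exact (List.nodup_append'.1 hn2).2.2 hx (List.mem_flatMap.2 ⟨t, ht, hxt⟩)

theorem PTree.not_mem_subtrees_of_premise {a c : PTree V} (h : a.IsPremise c) :
    c ∉ a.subtrees := fun hc => by
  have := PTree.size_le_of_mem_subtrees hc
  have := h.size_lt
  omega

-- Splitting off the argument of the last tensor link

section Split

variable {A B : Struct V} {C : Cat V} {i : ℕ} {x g : PTree V}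

theorem headSplit {c : PTree V} (h : IsProofNet (A ++ c :: (B ++ [.leaf C.pos i])))
    (hx : Spine (.leaf C.neg i) x) (hxc : x.IsPremise c) (hgc : g.IsPremise c)
    (hg : g.formula.IsOutput) : HeadSplit (A ++ c :: (B ++ [.leaf C.pos i])) C i c x g := by
  have hI : Intuitionistic ((A ++ c :: B) ++ [.leaf C.pos i]) := by
    simpa using h.intuitionistic
  exact ⟨h.toIsPreNet.regular, h.intuitionistic.uniq, by simp, by simp,
    hI.of_concat.2 c (by simp), hx, hxc, hgc, hg⟩

theorem inputs_of_net {c : PTree V} (h : IsProofNet (A ++ c :: (B ++ [.leaf C.pos i]))) :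
    (∀ t ∈ A, t.formula.IsInput) ∧ ∀ t ∈ B, t.formula.IsInput := by
  have hI : Intuitionistic ((A ++ c :: B) ++ [.leaf C.pos i]) := by
    simpa using h.intuitionistic
  exact ⟨fun t ht => hI.of_concat.2 t (by simp [ht]), fun t ht => hI.of_concat.2 t (by simp [ht])⟩

/-- The conclusions led to `g` form the net of the argument, the others the net of the remaining
branch. The axiom from `x` to the output separates `A` from `g` and `B`, so none of the former lies
in `A`; inside `B` they are contiguous to `g`. -/
theorem split_right (h : IsProofNet (A ++ .tens x g :: (B ++ [.leaf C.pos i])))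
    (hx : Spine (.leaf C.neg i) x) (hg : g.formula.IsOutput) :
    ∃ D B', B = D ++ B' ∧ IsProofNet (D ++ [g]) ∧
      IsProofNet (A ++ x :: (B' ++ [.leaf C.pos i])) ∧
      (indices (D ++ [g])).Disjoint (indices (A ++ x :: (B' ++ [.leaf C.pos i]))) := by
  have hs := headSplit h hx (.tens_left _ _) (.tens_right _ _) hg
  obtain ⟨hA, hB⟩ := inputs_of_net h
  have hn := h.linked.nodup
  set o : PTree V := .leaf C.pos i with ho
  -- Without the tensor link the leaves keep their order, so `M` is still linked and planar.
  set M : Struct V := A ++ x :: g :: (B ++ [o]) with hMdef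
  have hML : M.IsLinked := (isLinked_congr (by simp [M, PTree.leaves])).1 h.linked
  have hMP : M.Planar := (planar_congr (by simp [M])).1 h.planar
  have hMocc : ∀ a ∈ M.occ, a ∈ (A ++ .tens x g :: (B ++ [o])).occ := by
    intro a ha
    simp only [M, occ_append, occ_cons, List.mem_append, PTree.subtrees, List.mem_cons] at ha ⊢
    tauto
  have hMc : ∀ t ∈ M, .tens x g ∉ t.subtrees := by
    intro t ht
    simp only [M, List.mem_append, List.mem_cons] at ht
    rcases ht with ht | rfl | rfl | ht
    · exact not_mem_subtrees_of_nodup hn (.inl ht)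
    · exact PTree.not_mem_subtrees_of_premise (.tens_left _ _)
    · exact PTree.not_mem_subtrees_of_premise (.tens_right _ _)
    · exact not_mem_subtrees_of_nodup hn (.inr (by simpa using ht))
  set S : PTree V → Prop := fun t => ReflTransGen (Nxt (A ++ .tens x g :: (B ++ [o]))) t g
  have hsep : ∀ t ∈ M, ∀ t' ∈ M, ∀ j, j ∈ t.idx → j ∈ t'.idx → S t → S t' :=
    fun t ht t' ht' j hj hj' => (hs.iff_of_index (hMocc _ (mem_occ_of_mem ht))
      (hMocc _ (mem_occ_of_mem ht')) (hMc t ht) (hMc t' ht') hj hj').1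
  have hix : i ∈ x.idx := PTree.idx_subset_of_mem_subtrees hx.mem_subtrees (by simp)
  -- An axiom from such a block to `g` or `B` would cross the axiom `i` between `x` and `o`. These
  -- blocks would thus be a closed family of inputs.
  have hSA : ∀ t ∈ A, ¬ S t := by
    refine not_closed hML h.acyclic hMocc (by simp +contextual [M]) hA S ?_
    intro t ht hSt t' ht' j hj hj'
    have hSt' := hsep t (by simp [M, ht]) t' ht' j hj hj' hSt
    have hji : j ≠ i := by
      rintro rfl
      exact hs.not_x (hsep t (by simp [M, ht]) x (by simp [M]) j hj hix hSt)
    refine ⟨?_, hSt'⟩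
    simp only [M, List.mem_append, List.mem_cons, List.not_mem_nil, or_false] at ht'
    have cross : t' ∈ g :: B → False := by
      intro htB
      refine hMP j i hji ?_
      rw [indices_eq]
      have := four_blocks_sublist (idx := PTree.idx) (A := A) (B := [x]) (C := g :: B) (D := [o])
        ⟨t, ht, hj⟩ ⟨x, by simp, hix⟩ ⟨t', htB, hj'⟩ ⟨o, by simp, by simp [o]⟩
      simpa [M] using this
    rcases ht' with ht' | rfl | rfl | ht' | rfl
    · exact ht'
    · exact absurd hSt' hs.not_x
    · exact (cross (by simp)).elim
    · exact (cross (by simp [ht'])).elim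
    · exact absurd hSt' hs.not_o
  have hMeq : M = (A ++ [x]) ++ g :: (B ++ [o]) := by simp [M]
  obtain ⟨D, B', rfl, hD, hB'⟩ := exists_contiguous (idx := PTree.idx) (S := S)
    (Pre := A ++ [x]) (B := B) (Post := [o]) (g := g)
    (by
      intro j k hjk
      have := hMP j k hjk
      rwa [indices_eq, hMeq] at this)
    .refl
    (by
      intro t ht
      rcases List.mem_append.1 ht with ht | ht
      · exact hSA t ht
      · obtain rfl : t = x := by simpa using ht
        exact hs.not_x)
    (by
      intro t ht
      obtain rfl : t = o := by simpa using ht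
      exact hs.not_o)
    (by rw [← hMeq]; exact hsep)
    (by
      rw [← hMeq]
      exact fun Q hQ => not_closed hML h.acyclic hMocc (by simp +contextual [M]) hB Q hQ)
  have hMeq2 : M = (A ++ [x]) ++ (g :: D) ++ (B' ++ [o]) := by simp [M]
  have hd : (indices (g :: D)).Disjoint (indices ((A ++ [x]) ++ (B' ++ [o]))) := by
    intro j hj hj'
    obtain ⟨t, ht, hjt⟩ := mem_indices.1 hj
    obtain ⟨t', ht', hjt'⟩ := mem_indices.1 hj'
    have hSt : S t := by
      rcases List.mem_cons.1 ht with rfl | ht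
      · exact .refl
      · exact hD t ht
    have hSt' := hsep t (by rw [hMeq2]; simp only [List.mem_append]; tauto) t'
      (by rw [hMeq2]; simp only [List.mem_append] at ht' ⊢; tauto) j hjt hjt' hSt
    simp only [List.mem_append, List.mem_singleton] at ht'
    rcases ht' with (ht' | rfl) | ht' | rfl
    · exact hSA _ ht' hSt'
    · exact hs.not_x hSt'
    · exact hB' _ ht' hSt'
    · exact hs.not_o hSt'
  rw [hMeq2] at hML hMP
  obtain ⟨hL1, hL2⟩ := (isLinked_insert hd).1 hML
  obtain ⟨hP1, hP2⟩ := (planar_insert hd).1 hMP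
  -- In `M` the output `g` comes before `D`; the cyclic order is cut open again after `g`.
  have hL1' : IsLinked ([g] ++ D) := hL1
  have hP1' : Planar ([g] ++ D) := hP1
  refine ⟨D, B', rfl, h.of_subset hL1'.rotate hP1'.rotate ?_ ?_, h.of_subset ?_ ?_ ?_ ?_, ?_⟩
  · exact ⟨D, g, rfl, hg, fun t ht => hB t (by simp [ht])⟩
  · intro a ha
    simp only [occ_append, occ_cons, List.mem_append, PTree.subtrees, List.mem_cons] at ha ⊢
    tauto
  · simpa using hL2
  · simpa using hP2
  · refine ⟨A ++ x :: B', o, by simp, by simp [o, PTree.formula], ?_⟩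
    intro t ht
    simp only [List.mem_append, List.mem_cons] at ht
    rcases ht with ht | rfl | ht
    · exact hA t ht
    · exact hx.isInput
    · exact hB t (by simp [ht])
  · intro a ha
    simp only [occ_append, occ_cons, List.mem_append, PTree.subtrees, List.mem_cons] at ha ⊢
    tauto
  · intro j hj
    have := @hd j
    simp only [indices_append, indices_cons, List.mem_append] at hj this ⊢
    tauto

/-- The mirror image: the axiom `i` now keeps `B` apart, and the conclusions led to `g` are the last
ones of `A`. Contiguity, proved for the blocks after `g`, is applied to the reversed sequence. -/
theorem split_left (h : IsProofNet (A ++ .tens g x :: (B ++ [.leaf C.pos i])))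
    (hx : Spine (.leaf C.neg i) x) (hg : g.formula.IsOutput) :
    ∃ A' D, A = A' ++ D ∧ IsProofNet (D ++ [g]) ∧
      IsProofNet (A' ++ x :: (B ++ [.leaf C.pos i])) ∧
      (indices (D ++ [g])).Disjoint (indices (A' ++ x :: (B ++ [.leaf C.pos i]))) := by
  have hs := headSplit h hx (.tens_right _ _) (.tens_left _ _) hg
  obtain ⟨hA, hB⟩ := inputs_of_net h
  have hn := h.linked.nodup
  set o : PTree V := .leaf C.pos i with ho
  set M : Struct V := A ++ g :: x :: (B ++ [o]) with hMdef
  have hML : M.IsLinked := (isLinked_congr (by simp [M, PTree.leaves])).1 h.linked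
  have hMP : M.Planar := (planar_congr (by simp [M])).1 h.planar
  have hMocc : ∀ a ∈ M.occ, a ∈ (A ++ .tens g x :: (B ++ [o])).occ := by
    intro a ha
    simp only [M, occ_append, occ_cons, List.mem_append, PTree.subtrees, List.mem_cons] at ha ⊢
    tauto
  have hMc : ∀ t ∈ M, .tens g x ∉ t.subtrees := by
    intro t ht
    simp only [M, List.mem_append, List.mem_cons] at ht
    rcases ht with ht | rfl | rfl | ht
    · exact not_mem_subtrees_of_nodup hn (.inl ht)
    · exact PTree.not_mem_subtrees_of_premise (.tens_left _ _)
    · exact PTree.not_mem_subtrees_of_premise (.tens_right _ _)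
    · exact not_mem_subtrees_of_nodup hn (.inr (by simpa using ht))
  set S : PTree V → Prop := fun t => ReflTransGen (Nxt (A ++ .tens g x :: (B ++ [o]))) t g
  have hsep : ∀ t ∈ M, ∀ t' ∈ M, ∀ j, j ∈ t.idx → j ∈ t'.idx → S t → S t' :=
    fun t ht t' ht' j hj hj' => (hs.iff_of_index (hMocc _ (mem_occ_of_mem ht))
      (hMocc _ (mem_occ_of_mem ht')) (hMc t ht) (hMc t' ht') hj hj').1
  have hix : i ∈ x.idx := PTree.idx_subset_of_mem_subtrees hx.mem_subtrees (by simp)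
  have hSB : ∀ t ∈ B, ¬ S t := by
    refine not_closed hML h.acyclic hMocc (by simp +contextual [M]) hB S ?_
    intro t ht hSt t' ht' j hj hj'
    have hSt' := hsep t (by simp [M, ht]) t' ht' j hj hj' hSt
    have hji : j ≠ i := by
      rintro rfl
      exact hs.not_x (hsep t (by simp [M, ht]) x (by simp [M]) j hj hix hSt)
    refine ⟨?_, hSt'⟩
    simp only [M, List.mem_append, List.mem_cons, List.not_mem_nil, or_false] at ht'
    have cross : t' ∈ A ++ [g] → False := by
      intro htA
      refine hMP j i hji ?_
      rw [indices_eq]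
      have := four_blocks_sublist (idx := PTree.idx) (A := A ++ [g]) (B := [x]) (C := B)
        (D := [o]) ⟨t', htA, hj'⟩ ⟨x, by simp, hix⟩ ⟨t, ht, hj⟩ ⟨o, by simp, by simp [o]⟩
      simpa [M] using this
    rcases ht' with ht' | rfl | rfl | ht' | rfl
    · exact (cross (by simp [ht'])).elim
    · exact (cross (by simp)).elim
    · exact absurd hSt' hs.not_x
    · exact ht'
    · exact absurd hSt' hs.not_o
  have hMrev : ∀ t, t ∈ ([o] ++ B.reverse ++ [x]) ++ g :: (A.reverse ++ []) ↔ t ∈ M := by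
    intro t
    simp only [M, List.mem_append, List.mem_cons, List.mem_reverse, List.not_mem_nil]
    tauto
  obtain ⟨D', A', hrev, hD', hA'⟩ := exists_contiguous (idx := fun t => t.idx.reverse) (S := S)
    (Pre := [o] ++ B.reverse ++ [x]) (B := A.reverse) (Post := []) (g := g)
    (by
      intro j k hjk hsub
      -- Reversal turns `j k j k` into `k j k j`.
      refine hMP k j hjk.symm ?_
      have h1 : ([o] ++ B.reverse ++ [x]) ++ g :: (A.reverse ++ []) = M.reverse := by simp [M]
      have h2 : M.reverse.flatMap (fun t => t.idx.reverse) = M.indices.reverse := by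
        rw [indices_eq, List.reverse_flatMap]; rfl
      rw [h1, h2] at hsub
      have := hsub.reverse
      simpa using this)
    .refl
    (by
      intro t ht
      simp only [List.mem_append, List.mem_singleton, List.mem_reverse] at ht
      rcases ht with (rfl | ht) | rfl
      · exact hs.not_o
      · exact hSB t ht
      · exact hs.not_x)
    (by simp)
    (by
      intro t ht t' ht' j hj hj'
      exact hsep t ((hMrev t).1 ht) t' ((hMrev t').1 ht') j (by simpa using hj)
        (by simpa using hj'))
    (by
      intro Q hQ t ht
      refine not_closed hML h.acyclic hMocc (B := A) (by simp +contextual [M]) hA Q ?_ t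
        (by simpa using ht)
      intro t ht hQt t' ht' j hj hj'
      have := hQ t (by simpa using ht) hQt t' ((hMrev t').2 ht') j (by simpa using hj)
        (by simpa using hj')
      simpa using this)
  have hAeq : A = A'.reverse ++ D'.reverse := by
    rw [← List.reverse_append, ← hrev, List.reverse_reverse]
  obtain ⟨D, rfl⟩ : ∃ D, D' = D.reverse := ⟨D'.reverse, by simp⟩
  obtain ⟨A'', rfl⟩ : ∃ A'', A' = A''.reverse := ⟨A'.reverse, by simp⟩
  simp only [List.reverse_reverse] at hAeq
  simp only [List.mem_reverse] at hD' hA'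
  have hMeq2 : M = A'' ++ (D ++ [g]) ++ (x :: (B ++ [o])) := by simp [M, hAeq]
  have hd : (indices (D ++ [g])).Disjoint (indices (A'' ++ (x :: (B ++ [o])))) := by
    intro j hj hj'
    obtain ⟨t, ht, hjt⟩ := mem_indices.1 hj
    obtain ⟨t', ht', hjt'⟩ := mem_indices.1 hj'
    have hSt : S t := by
      rcases List.mem_append.1 ht with ht | ht
      · exact hD' t ht
      · obtain rfl : t = g := by simpa using ht
        exact .refl
    have hSt' := hsep t (by rw [hMeq2]; simp only [List.mem_append] at ht ⊢; tauto) t'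
      (by rw [hMeq2]; simp only [List.mem_append] at ht' ⊢; tauto) j hjt hjt' hSt
    simp only [List.mem_append, List.mem_cons, List.not_mem_nil, or_false] at ht'
    rcases ht' with ht' | rfl | ht' | rfl
    · exact hA' _ ht' hSt'
    · exact hs.not_x hSt'
    · exact hSB _ ht' hSt'
    · exact hs.not_o hSt'
  rw [hMeq2] at hML hMP
  obtain ⟨hL1, hL2⟩ := (isLinked_insert hd).1 hML
  obtain ⟨hP1, hP2⟩ := (planar_insert hd).1 hMP
  refine ⟨A'', D, hAeq, h.of_subset hL1 hP1 ?_ ?_, h.of_subset hL2 hP2 ?_ ?_, hd⟩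
  · exact ⟨D, g, rfl, hg, fun t ht => hA t (by simp [hAeq, ht])⟩
  · intro a ha
    simp only [hAeq, occ_append, occ_cons, List.mem_append, PTree.subtrees, List.mem_cons] at ha ⊢
    tauto
  · refine ⟨A'' ++ x :: B, o, by simp, by simp [o, PTree.formula], ?_⟩
    intro t ht
    simp only [List.mem_append, List.mem_cons] at ht
    rcases ht with ht | rfl | ht
    · exact hA t (by simp [hAeq, ht])
    · exact hx.isInput
    · exact hB t ht
  · intro a ha
    simp only [hAeq, occ_append, occ_cons, List.mem_append, PTree.subtrees, List.mem_cons] at ha ⊢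
    tauto

/-- A net whose output conclusion is linked to another conclusion has no further conclusion. -/
theorem eq_nil_of_linked (h : IsProofNet (A ++ .leaf C.neg i :: (B ++ [.leaf C.pos i]))) :
    A = [] ∧ B = [] := by
  classical
  obtain ⟨hA, hB⟩ := inputs_of_net h
  have hn := h.linked.nodup
  -- The two ends of axiom `i` are the two displayed conclusions, so the remaining conclusions are a
  -- closed family of inputs.
  have hno : ∀ t ∈ A ++ B, i ∉ t.idx := by
    intro t ht hi
    obtain ⟨F, hF⟩ := PTree.exists_leaf_of_mem_idx hi
    have htπ : t ∈ A ++ .leaf C.neg i :: (B ++ [.leaf C.pos i]) := by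
      simp only [List.mem_append, List.mem_cons] at ht ⊢; tauto
    have hx0 : PTree.leaf C.neg i ∈ A ++ .leaf C.neg i :: (B ++ [.leaf C.pos i]) := by simp
    rcases h.linked.eq_or_eq_dual (mem_occ_of_mem hx0)
      (mem_occ_of_subtree hF (mem_occ_of_mem htπ)) with rfl | rfl
    · exact not_mem_subtrees_of_nodup hn (by
        simp only [List.mem_append] at ht ⊢; tauto) hF
    · have hmem : PTree.leaf C.pos i ∈ A ++ .leaf C.neg i :: (B ++ [.leaf C.pos i]) := by simp
      rw [Cat.dual_neg, PTree.leaf_mem_subtrees] at hF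
      have := root_unique hn htπ hmem hF (by simp [PTree.leaves])
      rw [this] at ht
      rcases List.mem_append.1 ht with ht | ht
      · exact absurd (hA _ ht) (by simp [PTree.formula])
      · exact absurd (hB _ ht) (by simp [PTree.formula])
  have key : ∀ t ∈ A ++ B, ¬ True := by
    refine not_closed h.linked h.acyclic (fun _ h => h) ?_ ?_ (fun _ => True) ?_
    · intro t ht
      simp only [List.mem_append, List.mem_cons] at ht ⊢; tauto
    · intro t ht
      rcases List.mem_append.1 ht with ht | ht
      exacts [hA t ht, hB t ht]
    · intro t ht _ t' ht' j hj hj'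
      refine ⟨?_, trivial⟩
      have hji : j ≠ i := by rintro rfl; exact hno t ht hj
      simp only [List.mem_append, List.mem_cons, List.not_mem_nil, or_false] at ht' ⊢
      rcases ht' with ht' | rfl | ht' | rfl
      · exact .inl ht'
      · simp at hj'; exact absurd hj' hji
      · exact .inr ht'
      · simp at hj'; exact absurd hj' hji
  have : A ++ B = [] := List.eq_nil_iff_forall_not_mem.2 fun t ht => key t ht trivial
  simpa using this

/-- The head of a net whose output conclusion is a leaf. -/
theorem exists_spine {L : Struct V} (h : IsProofNet (L ++ [.leaf C.pos i])) :
    ∃ c ∈ L, Spine (.leaf C.neg i) c := by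
  have hR := h.toIsPreNet.regular
  have ho : PTree.leaf C.pos i ∈ L ++ [.leaf C.pos i] := by simp
  have hx0 : PTree.leaf C.neg i ∈ occ (L ++ [.leaf C.pos i]) := by
    have := h.linked.dual_mem (mem_occ_of_mem ho)
    rwa [Cat.dual_pos] at this
  have hfin : Set.Finite {z | z ∈ occ (L ++ [.leaf C.pos i]) ∧ Spine (.leaf C.neg i) z} :=
    (List.finite_toSet _).subset fun z hz => hz.1
  -- The largest occurrence on the spine is a conclusion. It is no premise of a tensor, which would
  -- prolong the spine. It is no input premise of a par link either: it would be led to the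
  -- conclusion of that link, but the only output met from the spine is a leaf.
  obtain ⟨c, ⟨hc, hcs⟩, hmax⟩ := Set.exists_max_image _ PTree.size hfin
    ⟨.leaf C.neg i, hx0, .refl (by simp [PTree.formula])⟩
  rcases root_or_premise hc with hroot | ⟨b, hb, hcb⟩
  · rcases List.mem_append.1 hroot with hroot | hroot
    · exact ⟨c, hroot, hcs⟩
    · obtain rfl : c = _ := by simpa using hroot
      exact absurd hcs.isInput (by simp [PTree.formula])
  · exfalso
    rcases hR.polar.occ hb with hbo | hbi
    · have := hcs.eq_output hR ho (hR.reaches_par h.intuitionistic.uniq hb hcb hbo hcs.isInput) hbo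
      rw [this] at hcb
      exact not_isPremise_leaf hcb
    · have := hmax b ⟨hb, .step hcb hcs.isInput hbi hcs⟩
      have := hcb.size_lt
      omega

end Split

end Struct

end Lambek


namespace Lambek

universe u v

variable {V : Type u}

/-! ### Sequentialisation -/

theorem Cat.pos_eq_par_left {C : Cat V} {F G : LF V} (h : LF.par F G = C.pos)
    (hF : F.IsInput) : ∃ A B : Cat V, C = .under A B ∧ F = A.neg ∧ G = B.pos := by
  cases C with
  | base b => simp [Cat.pos] at h
  | under A B => simp only [Cat.pos, LF.par.injEq] at h; exact ⟨A, B, rfl, h.1, h.2⟩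
  | _ B A =>
    simp only [Cat.pos, LF.par.injEq] at h
    rw [h.1] at hF; simp at hF

theorem Cat.pos_eq_par_right {C : Cat V} {F G : LF V} (h : LF.par F G = C.pos)
    (hG : G.IsInput) : ∃ A B : Cat V, C = .over B A ∧ F = B.pos ∧ G = A.neg := by
  cases C with
  | base b => simp [Cat.pos] at h
  | under A B =>
    simp only [Cat.pos, LF.par.injEq] at h
    rw [h.2] at hG; simp at hG
  | _ B A =>
    simp only [Cat.pos, LF.par.injEq] at h; exact ⟨A, B, rfl, h.1, h.2⟩

-- Antecedents as sequences of input conclusions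

namespace Struct

/-- The conclusions `L` are `Hₙ-, …, H₁-`, where `Γ` is `H₁, …, Hₙ`. -/
def Inputs (L : Struct V) (Γ : List (Cat V)) : Prop :=
  L.map PTree.formula = (Γ.map Cat.neg).reverse

@[simp] theorem inputs_nil_left {Γ : List (Cat V)} : Inputs [] Γ ↔ Γ = [] := by
  rw [Inputs, List.map_nil, eq_comm]; simp

@[simp] theorem inputs_nil_right {L : Struct V} : Inputs L [] ↔ L = [] := by
  simp [Inputs]

/-- The conclusions run from `Hₙ` to `H₁`, so the left block is the end of the antecedent. -/
theorem inputs_append {A B : Struct V} {Γ : List (Cat V)} :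
    Inputs (A ++ B) Γ ↔ ∃ Γ₁ Γ₂, Γ = Γ₂ ++ Γ₁ ∧ Inputs A Γ₁ ∧ Inputs B Γ₂ := by
  constructor
  · intro h
    unfold Inputs at h
    rw [List.map_append, ← List.map_reverse] at h
    obtain ⟨l₁, l₂, hl, h1, h2⟩ := List.map_eq_append_iff.1 h.symm
    refine ⟨l₁.reverse, l₂.reverse, ?_, ?_, ?_⟩
    · rw [← List.reverse_append, ← hl, List.reverse_reverse]
    · simp [Inputs, h1]
    · simp [Inputs, h2]
  · rintro ⟨Γ₁, Γ₂, rfl, h1, h2⟩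
    simp only [Inputs] at h1 h2 ⊢
    simp [h1, h2]

theorem inputs_singleton {t : PTree V} {Γ : List (Cat V)} :
    Inputs [t] Γ ↔ ∃ A, Γ = [A] ∧ t.formula = A.neg := by
  constructor
  · intro h
    unfold Inputs at h
    rw [← List.map_reverse] at h
    have hlen : Γ.length = 1 := by simpa using (congrArg List.length h).symm
    obtain ⟨A, rfl⟩ := List.length_eq_one_iff.1 hlen
    exact ⟨A, rfl, by simpa using h⟩
  · rintro ⟨A, rfl, h⟩
    simp [Inputs, h]

theorem inputs_cons {t : PTree V} {L : Struct V} {Γ : List (Cat V)} :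
    Inputs (t :: L) Γ ↔ ∃ A Γ', Γ = Γ' ++ [A] ∧ t.formula = A.neg ∧ Inputs L Γ' := by
  rw [← List.singleton_append, inputs_append]
  simp only [inputs_singleton]
  constructor
  · rintro ⟨_, Γ', rfl, ⟨A, rfl, h⟩, h'⟩
    exact ⟨A, Γ', rfl, h, h'⟩
  · rintro ⟨A, Γ', rfl, h, h'⟩
    exact ⟨[A], Γ', rfl, ⟨A, rfl, h⟩, h'⟩

theorem exists_inputs {L : Struct V} (h : ∀ t ∈ L, t.formula.IsInput) :
    ∃ Γ : List (Cat V), Inputs L Γ := by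
  induction L with
  | nil => exact ⟨[], by simp⟩
  | cons t L ih =>
    obtain ⟨Γ, hΓ⟩ := ih fun s hs => h s (by simp [hs])
    obtain ⟨A, hA⟩ := (h t (by simp)).exists_neg
    exact ⟨Γ ++ [A], inputs_cons.2 ⟨A, Γ, rfl, hA, hΓ⟩⟩

theorem Inputs.length_eq {L : Struct V} {Γ : List (Cat V)} (h : Inputs L Γ) :
    L.length = Γ.length := by
  simpa using congrArg List.length h

theorem conclusions_iff {L : Struct V} {o : PTree V} {Γ : List (Cat V)} {C : Cat V} :
    (L ++ [o]).map PTree.formula = (Γ.map Cat.neg).reverse ++ [C.pos] ↔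
      Inputs L Γ ∧ o.formula = C.pos := by
  rw [List.map_append]
  constructor
  · intro h
    obtain ⟨h1, h2⟩ := List.append_inj' h rfl
    exact ⟨h1, by simpa using h2⟩
  · rintro ⟨h1, h2⟩
    rw [h1]; simp [h2]

end Struct

open Struct

/-- Deductions of the branch through the spine of a net. -/
theorem exists_branch {C : Cat V} {i : ℕ} {n : ℕ}
    (IH : ∀ π : Struct V, π.size < n → π.IsProofNet → ∀ (Γ : List (Cat V)) (A : Cat V),
      π.map PTree.formula = (Γ.map Cat.neg).reverse ++ [A.pos] →
      ∃ d, Derives d Γ A ∧ d.Normal ∧ Translates d π)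
    {c : PTree V} (hc : Spine (.leaf C.neg i) c) (A B : Struct V) (Y : Cat V)
    (ΓA ΓB : List (Cat V))
    (hnet : IsProofNet (A ++ c :: (B ++ [.leaf C.pos i])))
    (hsize : size (A ++ c :: (B ++ [.leaf C.pos i])) ≤ n)
    (hcY : c.formula = Y.neg) (hA : Inputs A ΓA) (hB : Inputs B ΓB) :
    ∃ Φ : NDTree (Cat V) → NDTree (Cat V), ∀ (e : NDTree (Cat V)) (Δ : List (Cat V)),
      Derives e Δ Y → e.Normal → ¬ e.IsIntro →
      Derives (Φ e) (ΓB ++ Δ ++ ΓA) C ∧ (Φ e).Normal ∧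
      ∀ π, AlongBranch e A c (B ++ [.leaf C.pos i]) π →
        AlongBranch (Φ e) [] (.leaf C.neg i) [.leaf C.pos i] π := by
  -- The spine is peeled from the conclusion `c` up to the axiom, that is from the hypothesis of the
  -- principal branch down to its conclusion. The result is therefore a context `Φ`, in which a
  -- deduction `e` of `Y` can be put at the top of the branch; it must not end with an introduction,
  -- for normality.
  induction hc generalizing A B Y ΓA ΓB with
  | refl _ =>
    obtain ⟨rfl, rfl⟩ := eq_nil_of_linked hnet
    obtain rfl : Y = C := Cat.neg_injective hcY.symm
    obtain rfl := inputs_nil_left.1 hA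
    obtain rfl := inputs_nil_left.1 hB
    exact ⟨id, fun e Δ h1 h2 _ => ⟨by simpa using h1, h2, fun π h => by simpa using h⟩⟩
  | @step x c hxc hxi hci hx ih =>
    cases hxc with
    | tens_left _ g =>
      obtain ⟨P, Q, rfl, hxQ, hgP⟩ := Cat.neg_eq_tens_left hcY hxi
      obtain ⟨D, B', rfl, h1, h2, hd⟩ := split_right hnet hx (by rw [hgP]; simp)
      obtain ⟨ΓD, ΓB', rfl, hD, hB'⟩ := inputs_append.1 hB
      simp only [size_append, size_cons, size_nil, PTree.size] at hsize
      obtain ⟨arg, hd1, hd2, hd3⟩ := IH (D ++ [g])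
        (by simp only [size_append, size_cons, size_nil]; omega) h1 ΓD P
        (conclusions_iff.2 ⟨hD, hgP⟩)
      obtain ⟨Φ, hΦ⟩ := ih A B' Q ΓA ΓB' h2
        (by simp only [size_append, size_cons, size_nil, PTree.size]; omega) hxQ hA hB'
      refine ⟨fun e => Φ (.elimL arg e), fun e Δ he1 he2 he3 => ?_⟩
      obtain ⟨r1, r2, r3⟩ := hΦ (.elimL arg e) (ΓD ++ Δ) (.elimL hd1 he1) ⟨hd2, he2, he3⟩
        (by simp [NDTree.IsIntro])
      refine ⟨by simpa using r1, r2, fun π hπ => r3 π ?_⟩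
      exact .elimL hd3 hd (by simpa using hπ)
    | tens_right g _ =>
      obtain ⟨P, Q, rfl, hgP, hxQ⟩ := Cat.neg_eq_tens_right hcY hxi
      obtain ⟨A', D, rfl, h1, h2, hd⟩ := split_left hnet hx (by rw [hgP]; simp)
      obtain ⟨ΓA', ΓD, rfl, hA', hD⟩ := inputs_append.1 hA
      simp only [size_append, size_cons, size_nil, PTree.size] at hsize
      obtain ⟨arg, hd1, hd2, hd3⟩ := IH (D ++ [g])
        (by simp only [size_append, size_cons, size_nil]; omega) h1 ΓD P
        (conclusions_iff.2 ⟨hD, hgP⟩)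
      obtain ⟨Φ, hΦ⟩ := ih A' B Q ΓA' ΓB h2
        (by simp only [size_append, size_cons, size_nil, PTree.size]; omega) hxQ hA' hB
      refine ⟨fun e => Φ (.elimR e arg), fun e Δ he1 he2 he3 => ?_⟩
      obtain ⟨r1, r2, r3⟩ := hΦ (.elimR e arg) (Δ ++ ΓD) (.elimR he1 hd1) ⟨he2, hd2, he3⟩
        (by simp [NDTree.IsIntro])
      refine ⟨by simpa using r1, r2, fun π hπ => r3 π ?_⟩
      exact .elimR hd3 hd hπ
    | par_left _ _ => exact absurd hci (LF.not_isInput_par _ _)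
    | par_right _ _ => exact absurd hci (LF.not_isInput_par _ _)

/-- The net obtained by removing the par link of the output conclusion, whose input premise is
the first one. -/
theorem Struct.IsProofNet.par_left {L : Struct V} {a b : PTree V}
    (h : IsProofNet (L ++ [.par a b])) (ha : a.formula.IsInput) :
    L ≠ [] ∧ IsProofNet (L ++ [a, b]) := by
  have hI := h.intuitionistic.of_concat
  have hb : b.formula.IsOutput := by
    rcases LF.isOutput_par.1 hI.1 with h | h
    · exact h.2
    · exact absurd ha h.1.not_isInput
  refine ⟨?_, h.of_subset ?_ ?_ ?_ ?_⟩
  -- With `L` empty the net itself would be a forbidden subnet with a single conclusion.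
  · rintro rfl
    exact h.nonempty_antecedents (.par a b) (by simp) h.toIsPreNet
  · exact (isLinked_congr (by simp [PTree.leaves])).1 h.linked
  · exact (planar_congr (by simp)).1 h.planar
  · refine ⟨L ++ [a], b, by simp, hb, fun t ht => ?_⟩
    rcases List.mem_append.1 ht with ht | ht
    · exact hI.2 t ht
    · obtain rfl : t = a := by simpa using ht
      exact ha
  · intro t ht
    simp only [occ_append, occ_cons, occ_nil, PTree.subtrees, List.mem_append, List.mem_cons] at ht ⊢
    tauto

/-- The net obtained by removing the par link of the output conclusion, whose input premise is
the second one. -/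
theorem Struct.IsProofNet.par_right {L : Struct V} {a b : PTree V}
    (h : IsProofNet (L ++ [.par b a])) (ha : a.formula.IsInput) :
    L ≠ [] ∧ IsProofNet (a :: (L ++ [b])) := by
  have hI := h.intuitionistic.of_concat
  have hb : b.formula.IsOutput := by
    rcases LF.isOutput_par.1 hI.1 with h | h
    · exact absurd ha h.2.not_isInput
    · exact h.1
  refine ⟨?_, h.of_subset ?_ ?_ ?_ ?_⟩
  · rintro rfl
    exact h.nonempty_antecedents (.par b a) (by simp) h.toIsPreNet
  · have : IsLinked ((L ++ [b]) ++ [a]) :=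
      (isLinked_congr (by simp [PTree.leaves])).1 h.linked
    exact this.rotate
  · have : Planar ((L ++ [b]) ++ [a]) := (planar_congr (by simp)).1 h.planar
    exact this.rotate
  · refine ⟨a :: L, b, by simp, hb, fun t ht => ?_⟩
    rcases List.mem_cons.1 ht with rfl | ht
    · exact ha
    · exact hI.2 t ht
  · intro t ht
    simp only [occ_append, occ_cons, occ_nil, PTree.subtrees, List.mem_append, List.mem_cons] at ht ⊢
    tauto

/-- Each proof net is the translation of a normal deduction. -/
theorem exists_deduction (n : ℕ) : ∀ π : Struct V, π.size = n → π.IsProofNet →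
    ∀ (Γ : List (Cat V)) (C : Cat V),
      π.map PTree.formula = (Γ.map Cat.neg).reverse ++ [C.pos] →
      ∃ d, Derives d Γ C ∧ d.Normal ∧ Translates d π := by
  induction n using Nat.strong_induction_on with
  | _ n ih =>
    intro π hn hπ Γ C hΓ
    have IH : ∀ π : Struct V, π.size < n → π.IsProofNet → ∀ (Γ : List (Cat V)) (A : Cat V),
      π.map PTree.formula = (Γ.map Cat.neg).reverse ++ [A.pos] →
      ∃ d, Derives d Γ A ∧ d.Normal ∧ Translates d π :=
      fun π h => ih _ h π rfl
    obtain ⟨L, o, rfl, -, -⟩ := hπ.intuitionistic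
    obtain ⟨hL, ho⟩ := conclusions_iff.1 hΓ
    have hΓne : L ≠ [] → Γ ≠ [] := by
      rintro h rfl
      exact h (inputs_nil_right.1 hL)
    simp only [size_append, size_cons, size_nil] at hn
    cases o with
    | leaf F i =>
      obtain rfl : F = C.pos := ho
      -- The conclusion `c` below the other end of the output axiom is the head; its category `Y` is
      -- the hypothesis that ends the principal branch.
      obtain ⟨c, hc, hsp⟩ := exists_spine hπ
      obtain ⟨A, B, rfl⟩ := List.append_of_mem hc
      obtain ⟨ΓA, Γ', rfl, hA, hcB⟩ := inputs_append.1 hL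
      obtain ⟨Y, ΓB, rfl, hcY, hB⟩ := inputs_cons.1 hcB
      have hnet : IsProofNet (A ++ c :: (B ++ [.leaf C.pos i])) := by simpa using hπ
      obtain ⟨Φ, hΦ⟩ := exists_branch IH hsp A B Y ΓA ΓB hnet
        (by simp only [size_append, size_cons, size_nil] at hn ⊢; omega) hcY hA hB
      obtain ⟨r1, r2, r3⟩ := hΦ (.hyp Y) [Y] (.hyp Y) trivial (by simp [NDTree.IsIntro])
      refine ⟨_, r1, r2, ?_⟩
      have := Translates.branch C i (r3 _ (.hyp hcY))
      simpa using this
    | tens a b => exact absurd ho.symm (by intro h; have := C.isOutput_pos; rw [h] at this; simp [PTree.formula] at this)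
    | par a b =>
      have hCo := C.isOutput_pos
      rw [← ho] at hCo
      rcases LF.isOutput_par.1 hCo with h | h
      · obtain ⟨P, Q, rfl, haP, hbQ⟩ := Cat.pos_eq_par_left ho h.1
        obtain ⟨hne, hnet⟩ := hπ.par_left h.1
        have hnet' : L ++ [a, b] = (L ++ [a]) ++ [b] := by simp
        obtain ⟨d, d1, d2, d3⟩ := IH (L ++ [a, b])
          (by simp only [size_append, size_cons, size_nil, PTree.size] at hn ⊢; omega) hnet
          (P :: Γ) Q (by
            rw [hnet', conclusions_iff, inputs_append]
            exact ⟨⟨Γ, [P], rfl, hL, inputs_singleton.2 ⟨P, rfl, haP⟩⟩, hbQ⟩)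
        exact ⟨.introL d, .introL (hΓne hne) d1, d2, .introL d3⟩
      · obtain ⟨P, Q, rfl, hbQ, haP⟩ := Cat.pos_eq_par_right ho h.2
        obtain ⟨hne, hnet⟩ := hπ.par_right h.2
        have hnet' : b :: (L ++ [a]) = (b :: L) ++ [a] := by simp
        obtain ⟨d, d1, d2, d3⟩ := IH (b :: (L ++ [a]))
          (by simp only [size_append, size_cons, size_nil, PTree.size] at hn ⊢; omega) hnet
          (Γ ++ [P]) Q (by
            rw [hnet', conclusions_iff, inputs_cons]
            exact ⟨⟨P, Γ, rfl, haP, hL⟩, hbQ⟩)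
        exact ⟨.introR d, .introR (hΓne hne) d1, d2, .introR d3⟩

end Lambek


namespace Lambek

universe u v

variable {V : Type u}

/-! ### Composition of proof nets -/

/-- A cycle is rotated to begin at `q` and `q` is cut out: a walk between two distinct neighbours
remains. It serves to examine the cycles through the conclusion of a new link. -/
theorem exists_detour_of_isCycle {α : Type*} {G : SimpleGraph α} {t q : α}
    {p : G.Walk t t} (hp : p.IsCycle) (hq : q ∈ p.support) :
    ∃ (u v : α) (w : G.Walk u v), u ≠ v ∧ G.Adj q u ∧ G.Adj q v ∧ s(u, q) ∈ p.edges ∧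
      s(v, q) ∈ p.edges ∧ q ∉ w.support := by
  classical
  have hc := hp.rotate hq
  have he := (p.rotate_edges q hq).perm
  generalize p.rotate q hq = c at hc he
  cases c with
  | nil => exact absurd rfl hc.ne_nil
  | cons h w =>
    rw [SimpleGraph.Walk.cons_isCycle_iff] at hc
    obtain ⟨hw, hqu⟩ := hc
    rename_i u
    have hr := hw.reverse
    have hqr : s(q, u) ∉ w.reverse.edges := by simpa using hqu
    have hsub : ∀ e ∈ w.reverse.edges, e ∈ p.edges := fun e hm => by
      refine he.mem_iff.1 ?_
      simp only [SimpleGraph.Walk.edges_reverse, List.mem_reverse] at hm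
      simp [hm]
    have hu : s(u, q) ∈ p.edges := he.mem_iff.1 (by simp [Sym2.eq_swap])
    generalize w.reverse = r at hr hqr hsub
    cases r with
    | nil => exact absurd h (G.loopless.irrefl _)
    | cons h' w' =>
      rename_i v
      rw [SimpleGraph.Walk.cons_isPath_iff] at hr
      refine ⟨u, v, w'.reverse, ?_, h, h', hu, hsub _ (by simp [Sym2.eq_swap]), by simpa using hr.2⟩
      rintro rfl
      simp at hqr

namespace Struct

variable {π ρ : Struct V} {q a b t : PTree V}

/-- The neighbours of a conclusion that is not a leaf are its premises. -/
theorem graph_adj_root (hn : ρ.leaves.Nodup) (hq : q ∈ ρ) (hleaf : ∀ F i, q ≠ .leaf F i)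
    (h : ρ.graph.Adj q t) : t.IsPremise q := by
  obtain ⟨h1, h2, -, h | h | h⟩ := graph_adj.1 h
  · exact absurd hq (not_root_of_premise hn h2 h)
  · exact h
  · cases h; exact absurd rfl (hleaf _ _)

/-- Adjacency depends only on the trees, so a cycle of `ρ` through occurrences of `π` is a cycle of
`π`. -/
theorem Acyclic.of_avoids (hπ : π.Acyclic) {p : ρ.graph.Walk t t} (hp : p.IsCycle)
    (h : ∀ x ∈ p.support, x ∈ π.occ) :
    ∃ a b : PTree V, s(a, PTree.par a b) ∈ p.edges ∧ s(b, PTree.par a b) ∈ p.edges := by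
  have hE : ∀ e ∈ p.edges, e ∈ π.graph.edgeSet := by
    intro e he
    induction e with | _ x y => ?_
    have hxy := p.adj_of_mem_edges he
    obtain ⟨-, -, h3⟩ := graph_adj.1 hxy
    exact graph_adj.2 ⟨h _ (p.fst_mem_support_of_mem_edges he),
      h _ (p.snd_mem_support_of_mem_edges he), h3⟩
  have := hπ t _ (hp.transfer hE)
  rwa [SimpleGraph.Walk.edges_transfer] at this

theorem mem_occ_of_mem_support {p : ρ.graph.Walk t t} (hp : p.IsCycle) {x : PTree V}
    (hx : x ∈ p.support) : x ∈ ρ.occ := by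
  obtain ⟨e, he, hxe⟩ := (SimpleGraph.Walk.mem_support_iff_exists_mem_edges_of_not_nil
    (hp.not_nil)).1 hx
  induction e with | _ y z => ?_
  obtain ⟨h1, h2, -⟩ := graph_adj.1 (p.adj_of_mem_edges he)
  rcases Sym2.mem_iff.1 hxe with rfl | rfl <;> assumption

/-- A cycle through the new conclusion has to use both branches of its par link, as the criterion
wants; the other cycles are old. -/
theorem Acyclic.par_intro (hn : ρ.leaves.Nodup) (hq : .par a b ∈ ρ)
    (hocc : ∀ t ∈ ρ.occ, t ≠ .par a b → t ∈ π.occ) (hπ : π.Acyclic) : ρ.Acyclic := by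
  intro t p hp
  by_cases h : PTree.par a b ∈ p.support
  · obtain ⟨u, v, -, huv, hu, hv, hue, hve, -⟩ := exists_detour_of_isCycle hp h
    have hu' := graph_adj_root hn hq (by simp) hu
    have hv' := graph_adj_root hn hq (by simp) hv
    refine ⟨a, b, ?_⟩
    cases hu' <;> cases hv' <;> first | exact absurd rfl huv | exact ⟨hue, hve⟩ | exact ⟨hve, hue⟩
  · refine hπ.of_avoids hp fun x hx => hocc x (mem_occ_of_mem_support hp hx) ?_
    rintro rfl
    exact h hx

/-- Adjacent occurrences share an axiom index, so only the new conclusion `q` leads from one part to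
the other. -/
theorem stays_in_part {π₁ π₂ : Struct V} (hd : π₁.indices.Disjoint π₂.indices)
    (hocc : ∀ t ∈ ρ.occ, t ≠ q → t ∈ π₁.occ ∨ t ∈ π₂.occ) {s t : PTree V}
    (p : ρ.graph.Walk s t) (hq : q ∉ p.support) (hs : s ∈ π₁.occ) : ∀ x ∈ p.support, x ∈ π₁.occ := by
  induction p with
  | nil => simpa using hs
  | @cons s r t h w ih =>
    simp only [SimpleGraph.Walk.support_cons, List.mem_cons, not_or] at hq
    have hr : r ∈ π₁.occ := by
      obtain ⟨-, hr, -, h⟩ := graph_adj.1 h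
      refine (hocc r hr ?_).resolve_right fun hr2 => ?_
      · rintro rfl
        exact hq.2 w.start_mem_support
      have hshare : ∃ i, i ∈ s.idx ∧ i ∈ r.idx := by
        rcases h with h | h | h
        · obtain ⟨i, hi⟩ := s.exists_mem_idx
          exact ⟨i, hi, PTree.idx_subset_of_mem_subtrees h.mem_subtrees hi⟩
        · obtain ⟨i, hi⟩ := r.exists_mem_idx
          exact ⟨i, PTree.idx_subset_of_mem_subtrees h.mem_subtrees hi, hi⟩
        · cases h; exact ⟨_, by rw [PTree.idx_leaf]; exact List.mem_singleton_self _, by simp⟩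
      obtain ⟨i, hi1, hi2⟩ := hshare
      exact hd (idx_subset_of_mem_occ hs hi1) (idx_subset_of_mem_occ hr2 hi2)
    intro x hx
    rcases List.mem_cons.1 hx with rfl | hx
    · exact hs
    · exact ih hq.2 hr x hx

theorem not_mem_both {π₁ π₂ : Struct V} (hd : π₁.indices.Disjoint π₂.indices)
    (h1 : t ∈ π₁.occ) (h2 : t ∈ π₂.occ) : False := by
  obtain ⟨i, hi⟩ := t.exists_mem_idx
  exact hd (idx_subset_of_mem_occ h1 hi) (idx_subset_of_mem_occ h2 hi)

/-- A cycle through the new tensor would join its premises without passing through it, although they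
lie in separate parts. -/
theorem Acyclic.tens_intro {π₁ π₂ : Struct V} (hd : π₁.indices.Disjoint π₂.indices)
    (hn : ρ.leaves.Nodup) (hq : .tens a b ∈ ρ)
    (hocc : ∀ t ∈ ρ.occ, t ≠ .tens a b → t ∈ π₁.occ ∨ t ∈ π₂.occ)
    (ha : a ∈ π₁.occ) (hb : b ∈ π₂.occ)
    (h1 : π₁.Acyclic) (h2 : π₂.Acyclic) : ρ.Acyclic := by
  intro t p hp
  have hocc' : ∀ t ∈ ρ.occ, t ≠ .tens a b → t ∈ π₂.occ ∨ t ∈ π₁.occ :=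
    fun t ht hne => (hocc t ht hne).symm
  by_cases h : PTree.tens a b ∈ p.support
  · obtain ⟨u, v, w, huv, hu, hv, hue, hve, hw⟩ := exists_detour_of_isCycle hp h
    have hu' := graph_adj_root hn hq (by simp) hu
    have hv' := graph_adj_root hn hq (by simp) hv
    exfalso
    cases hu' <;> cases hv'
    · exact huv rfl
    · exact not_mem_both hd (stays_in_part hd hocc w hw ha _ w.end_mem_support) hb
    · exact not_mem_both hd ha (stays_in_part hd.symm hocc' w hw hb _ w.end_mem_support)
    · exact huv rfl
  · have ht := mem_occ_of_mem_support hp p.start_mem_support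
    have hne : t ≠ .tens a b := by
      rintro rfl
      exact h p.start_mem_support
    rcases hocc t ht hne with ht | ht
    · exact h1.of_avoids hp (stays_in_part hd hocc p h ht)
    · exact h2.of_avoids hp (stays_in_part hd.symm hocc' p h ht)

/-- The axiom. -/
theorem isProofNet_ax (C : Cat V) (i : ℕ) : IsProofNet [.leaf C.neg i, .leaf C.pos i] where
  linked := by
    intro j hj
    simp only [indices_cons, indices_nil, PTree.idx_leaf] at hj
    obtain rfl : j = i := by simpa using hj
    exact ⟨C.neg, by simp [PTree.leaves]⟩
  acyclic := by
    intro t p hp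
    exfalso
    -- A cycle needs a vertex with two distinct neighbours, but there are only two vertices.
    obtain ⟨u, v, -, huv, hu, hv, -, -, -⟩ := exists_detour_of_isCycle hp p.start_mem_support
    obtain ⟨ht, hu, hu', -⟩ := graph_adj.1 hu
    obtain ⟨-, hv, hv', -⟩ := graph_adj.1 hv
    simp only [occ_cons, occ_nil, PTree.subtrees, List.append_nil, List.singleton_append,
      List.mem_cons, List.not_mem_nil, or_false] at ht hu hv
    rcases ht with h | h <;> rcases hu with h1 | h1 <;> rcases hv with h2 | h2 <;> simp_all
  intuitionistic := ⟨[.leaf C.neg i], .leaf C.pos i, rfl, by simp [PTree.formula],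
    by simp [PTree.formula]⟩
  planar := by
    intro j k hjk h
    have := h.length_le
    simp [indices_cons] at this
  nonempty_antecedents := by
    intro c hc h
    have hc' : ∃ F, c = .leaf F i := by
      simp only [occ_cons, occ_nil, PTree.subtrees, List.append_nil, List.singleton_append,
        List.mem_cons, List.not_mem_nil, or_false] at hc
      rcases hc with rfl | rfl <;> exact ⟨_, rfl⟩
    obtain ⟨F, rfl⟩ := hc'
    obtain ⟨G, hG⟩ := h.linked i (by simp [indices_cons])
    have := congrArg List.length hG
    simp [PTree.leaves] at this

/-- The premises of the par links are arbitrary here, so that both rules are covered. -/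
theorem not_isPreNet_root {L : Struct V} {q : PTree V} (hL : L ≠ []) (hI : ∀ t ∈ L, t.formula.IsInput)
    (hlink : IsLinked (L ++ [q])) (hA : Acyclic (L ++ [q])) : ¬ IsPreNet [q] := by
  intro h
  obtain ⟨t, ht⟩ := List.exists_mem_of_ne_nil _ hL
  -- If `[q]` were linked, it would contain both ends of its axioms, and the inputs `L` would be a
  -- nonempty closed family.
  refine not_closed hlink hA (fun a ha => ha) (B := L) (fun t ht => by simp [ht]) hI
    (fun _ => True) ?_ t ht trivial
  intro t ht _ t' ht' i hi hi'
  refine ⟨?_, trivial⟩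
  rcases List.mem_append.1 ht' with ht' | ht'
  · exact ht'
  obtain rfl : t' = q := by simpa using ht'
  obtain ⟨F, hF⟩ := h.linked i (by simpa [indices_cons] using hi')
  obtain ⟨G, hG⟩ := hlink i (mem_indices.2 ⟨t, by simp [ht], hi⟩)
  rw [leaves_append, List.filter_append, hF] at hG
  have hlen := congrArg List.length hG
  simp only [List.length_append, List.length_cons, List.length_nil] at hlen
  have hnil : L.leaves.filter (fun x => decide (x.2 = i)) = [] :=
    List.eq_nil_of_length_eq_zero (by omega)
  rw [List.filter_eq_nil_iff] at hnil
  have hiL : i ∈ L.indices := mem_indices.2 ⟨t, ht, hi⟩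
  obtain ⟨x, hx, rfl⟩ := List.mem_map.1 hiL
  exact absurd (decide_eq_true rfl) (hnil x hx)

theorem IsProofNet.par_left_intro {L : Struct V} (h : IsProofNet (L ++ [a, b])) (hL : L ≠ []) :
    IsProofNet (L ++ [.par a b]) := by
  have h' : IsProofNet ((L ++ [a]) ++ [b]) := by simpa using h
  obtain ⟨hb, hI⟩ := h'.intuitionistic.of_concat
  have hlink : IsLinked (L ++ [.par a b]) := (isLinked_congr (by simp [PTree.leaves])).1 h.linked
  have hocc : ∀ t ∈ occ (L ++ [.par a b]), t ≠ .par a b → t ∈ occ (L ++ [a, b]) := by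
    intro t ht hne
    simp only [occ_append, occ_cons, occ_nil, PTree.subtrees, List.mem_append, List.mem_cons] at ht ⊢
    tauto
  have hA : Acyclic (L ++ [.par a b]) := h.acyclic.par_intro hlink.nodup (by simp) hocc
  have hIL : ∀ t ∈ L, t.formula.IsInput := fun t ht => hI t (by simp [ht])
  refine ⟨⟨hlink, hA, ⟨L, _, rfl, LF.isOutput_par.2 (.inl ⟨hI a (by simp), hb⟩), hIL⟩,
    (planar_congr (by simp)).1 h.planar⟩, fun c hc hcn => ?_⟩
  by_cases hcq : c = .par a b
  · subst hcq
    exact not_isPreNet_root hL hIL hlink hA hcn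
  · exact h.nonempty_antecedents c (hocc c hc hcq) hcn

theorem IsProofNet.par_right_intro {L : Struct V} (h : IsProofNet (a :: (L ++ [b]))) (hL : L ≠ []) :
    IsProofNet (L ++ [.par b a]) := by
  have h' : IsProofNet ((a :: L) ++ [b]) := by simpa using h
  obtain ⟨hb, hI⟩ := h'.intuitionistic.of_concat
  have hlink : IsLinked (L ++ [.par b a]) := by
    have : IsLinked ((L ++ [b]) ++ [a]) := IsLinked.rotate (π := [a]) h.linked
    exact (isLinked_congr (by simp [PTree.leaves])).1 this
  have hpl : Planar (L ++ [.par b a]) := by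
    have : Planar ((L ++ [b]) ++ [a]) := Planar.rotate (π := [a]) h.planar
    exact (planar_congr (by simp)).1 this
  have hocc : ∀ t ∈ occ (L ++ [.par b a]), t ≠ .par b a → t ∈ occ (a :: (L ++ [b])) := by
    intro t ht hne
    simp only [occ_append, occ_cons, occ_nil, PTree.subtrees, List.mem_append, List.mem_cons] at ht ⊢
    tauto
  have hA : Acyclic (L ++ [.par b a]) := h.acyclic.par_intro hlink.nodup (by simp) hocc
  have hIL : ∀ t ∈ L, t.formula.IsInput := fun t ht => hI t (by simp [ht])
  refine ⟨⟨hlink, hA, ⟨L, _, rfl, LF.isOutput_par.2 (.inr ⟨hb, hI a (by simp)⟩), hIL⟩, hpl⟩,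
    fun c hc hcn => ?_⟩
  by_cases hcq : c = .par b a
  · subst hcq
    exact not_isPreNet_root hL hIL hlink hA hcn
  · exact h.nonempty_antecedents c (hocc c hc hcq) hcn

theorem not_isPreNet_of_isInput (h : q.formula.IsInput) : ¬ IsPreNet [q] := fun hn =>
  (Intuitionistic.of_concat (L := []) hn.intuitionistic).1.not_isInput h

/-- The block `g, D`, a rotation of the argument net, is inserted just after `x`, and the link then
joins two neighbours without moving a leaf. In the mirror rule the block `D, g` is inserted before
`x` and needs no rotation. -/
theorem IsProofNet.tens_left_intro {L R D : Struct V} {o x g : PTree V}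
    (h : IsProofNet (L ++ x :: (R ++ [o]))) (hD : IsProofNet (D ++ [g]))
    (hd : (indices (D ++ [g])).Disjoint (indices (L ++ x :: (R ++ [o])))) :
    IsProofNet (L ++ .tens x g :: (D ++ (R ++ [o]))) := by
  have h' : IsProofNet ((L ++ x :: R) ++ [o]) := by simpa using h
  obtain ⟨ho, hI⟩ := h'.intuitionistic.of_concat
  obtain ⟨hg, hID⟩ := hD.intuitionistic.of_concat
  have hx := hI x (by simp)
  have hd' : (indices (g :: D)).Disjoint (indices ((L ++ [x]) ++ (R ++ [o]))) := by
    intro i hi hi'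
    refine hd (a := i) ?_ ?_
    · simp only [indices_append, indices_cons, indices_nil, List.mem_append] at hi ⊢; tauto
    · simpa using hi'
  have hlink : IsLinked (L ++ .tens x g :: (D ++ (R ++ [o]))) :=
    (isLinked_congr (by simp [PTree.leaves])).1 ((isLinked_insert hd').2
      ⟨IsLinked.rotate hD.linked, by simpa using h.linked⟩)
  have hpl : Planar (L ++ .tens x g :: (D ++ (R ++ [o]))) :=
    (planar_congr (by simp)).1 ((planar_insert hd').2
      ⟨Planar.rotate hD.planar, by simpa using h.planar⟩)
  have hocc : ∀ t ∈ occ (L ++ .tens x g :: (D ++ (R ++ [o]))), t ≠ .tens x g →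
      t ∈ occ (L ++ x :: (R ++ [o])) ∨ t ∈ occ (D ++ [g]) := by
    intro t ht hne
    simp only [occ_append, occ_cons, occ_nil, PTree.subtrees, List.mem_append, List.mem_cons] at ht ⊢
    tauto
  have hq : (PTree.tens x g).formula.IsInput := LF.isInput_tens.2 (.inr ⟨hx, hg⟩)
  refine ⟨⟨hlink, ?_, ⟨L ++ .tens x g :: (D ++ R), o, by simp, ho, ?_⟩, hpl⟩, fun c hc hcn => ?_⟩
  · exact Acyclic.tens_intro hd.symm hlink.nodup (by simp) hocc (mem_occ_of_mem (by simp))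
      (mem_occ_of_mem (by simp)) h.acyclic hD.acyclic
  · intro t ht
    simp only [List.mem_append, List.mem_cons] at ht
    rcases ht with ht | rfl | ht | ht
    · exact hI t (by simp [ht])
    · exact hq
    · exact hID t ht
    · exact hI t (by simp [ht])
  · by_cases hcq : c = .tens x g
    · subst hcq
      exact not_isPreNet_of_isInput hq hcn
    · rcases hocc c hc hcq with hc | hc
      · exact h.nonempty_antecedents c hc hcn
      · exact hD.nonempty_antecedents c hc hcn

theorem IsProofNet.tens_right_intro {L R D : Struct V} {o x g : PTree V}
    (h : IsProofNet (L ++ x :: (R ++ [o]))) (hD : IsProofNet (D ++ [g]))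
    (hd : (indices (D ++ [g])).Disjoint (indices (L ++ x :: (R ++ [o])))) :
    IsProofNet ((L ++ D) ++ .tens g x :: (R ++ [o])) := by
  have h' : IsProofNet ((L ++ x :: R) ++ [o]) := by simpa using h
  obtain ⟨ho, hI⟩ := h'.intuitionistic.of_concat
  obtain ⟨hg, hID⟩ := hD.intuitionistic.of_concat
  have hx := hI x (by simp)
  have hlink : IsLinked ((L ++ D) ++ .tens g x :: (R ++ [o])) :=
    (isLinked_congr (by simp [PTree.leaves])).1 ((isLinked_insert hd).2
      ⟨hD.linked, by simpa using h.linked⟩)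
  have hpl : Planar ((L ++ D) ++ .tens g x :: (R ++ [o])) :=
    (planar_congr (by simp)).1 ((planar_insert hd).2
      ⟨hD.planar, by simpa using h.planar⟩)
  have hocc : ∀ t ∈ occ ((L ++ D) ++ .tens g x :: (R ++ [o])), t ≠ .tens g x →
      t ∈ occ (D ++ [g]) ∨ t ∈ occ (L ++ x :: (R ++ [o])) := by
    intro t ht hne
    simp only [occ_append, occ_cons, occ_nil, PTree.subtrees, List.mem_append, List.mem_cons] at ht ⊢
    tauto
  have hq : (PTree.tens g x).formula.IsInput := LF.isInput_tens.2 (.inl ⟨hg, hx⟩)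
  refine ⟨⟨hlink, ?_, ⟨(L ++ D) ++ .tens g x :: R, o, by simp, ho, ?_⟩, hpl⟩, fun c hc hcn => ?_⟩
  · exact Acyclic.tens_intro hd hlink.nodup (by simp) hocc (mem_occ_of_mem (by simp))
      (mem_occ_of_mem (by simp)) hD.acyclic h.acyclic
  · intro t ht
    simp only [List.mem_append, List.mem_cons] at ht
    rcases ht with (ht | ht) | rfl | ht
    · exact hI t (by simp [ht])
    · exact hID t ht
    · exact hq
    · exact hI t (by simp [ht])
  · by_cases hcq : c = .tens g x
    · subst hcq
      exact not_isPreNet_of_isInput hq hcn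
    · rcases hocc c hc hcq with hc | hc
      · exact hD.nonempty_antecedents c hc hcn
      · exact h.nonempty_antecedents c hc hcn

end Struct

end Lambek


namespace Lambek

universe u v

variable {V : Type u}

/-! ### The inductive translation yields proof nets -/

open Struct

/-- Shape of the translation: conclusions match the hypotheses and the conclusion. -/
theorem typing {d : NDTree (Cat V)} : ∀ {Γ : List (Cat V)} {C : Cat V}, Derives d Γ C →
    (∀ {L R π : Struct V} {x : PTree V}, AlongBranch d L x R π →
      x.formula = C.neg ∧ ∃ M, π = L ++ (M ++ R) ∧ Inputs M Γ ∧ x ∈ M.occ) ∧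
    (∀ {π : Struct V}, Translates d π → ∃ L o, π = L ++ [o] ∧ Inputs L Γ ∧ o.formula = C.pos) := by
  have of_branch : ∀ {d : NDTree (Cat V)} {Γ : List (Cat V)} {C B : Cat V} {i : ℕ} {π : Struct V},
      (∀ {L R π : Struct V} {x : PTree V}, AlongBranch d L x R π →
        x.formula = C.neg ∧ ∃ M, π = L ++ (M ++ R) ∧ Inputs M Γ ∧ x ∈ M.occ) →
      AlongBranch d [] (.leaf B.neg i) [.leaf B.pos i] π →
      ∃ L o, π = L ++ [o] ∧ Inputs L Γ ∧ o.formula = C.pos := by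
    intro d Γ C B i π h hb
    obtain ⟨h1, M, rfl, hM, -⟩ := h hb
    obtain rfl : B = C := Cat.neg_injective h1
    exact ⟨M, _, rfl, hM, rfl⟩
  induction d with
  | hyp A =>
    intro Γ C hd
    cases hd
    have key : ∀ {L R π : Struct V} {x : PTree V}, AlongBranch (.hyp A) L x R π →
        x.formula = A.neg ∧ ∃ M, π = L ++ (M ++ R) ∧ Inputs M [A] ∧ x ∈ M.occ := by
      intro L R π x h
      cases h with | hyp hx => ?_
      exact ⟨hx, [x], rfl, inputs_singleton.2 ⟨A, rfl, hx⟩, mem_occ_of_mem (by simp)⟩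
    refine ⟨key, fun h => ?_⟩
    cases h with | branch B i hb => exact of_branch key hb
  | introL d ih =>
    intro Γ C hd
    cases hd with | @introL _ A B _ hne hd => ?_
    refine ⟨fun h => (nomatch h), fun h => ?_⟩
    cases h with
    | @introL _ L a b h =>
      obtain ⟨L', o, he, hL, ho⟩ := (ih hd).2 h
      obtain ⟨rfl, rfl⟩ : L ++ [a] = L' ∧ b = o := by
        have : (L ++ [a]) ++ [b] = L' ++ [o] := by simpa using he
        simpa using List.append_inj' this rfl
      obtain ⟨Γ₁, Γ₂, hΓ, h1, h2⟩ := inputs_append.1 hL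
      obtain ⟨A', rfl, ha⟩ := inputs_singleton.1 h2
      obtain ⟨rfl, rfl⟩ : A = A' ∧ Γ = Γ₁ := by simpa using hΓ
      exact ⟨L, _, rfl, h1, by simp [PTree.formula, ha, ho, Cat.pos]⟩
    | branch B i hb => exact nomatch hb
  | introR d ih =>
    intro Γ C hd
    cases hd with | @introR _ A B _ hne hd => ?_
    refine ⟨fun h => (nomatch h), fun h => ?_⟩
    cases h with
    | @introR _ L a b h =>
      obtain ⟨L', o, he, hL, ho⟩ := (ih hd).2 h
      obtain ⟨rfl, rfl⟩ : a :: L = L' ∧ b = o := by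
        have : (a :: L) ++ [b] = L' ++ [o] := by simpa using he
        simpa using List.append_inj' this rfl
      obtain ⟨A', Γ', hΓ, ha, h2⟩ := inputs_cons.1 hL
      obtain ⟨rfl, h3⟩ := List.append_inj' hΓ rfl
      obtain rfl : A = A' := by simpa using h3
      exact ⟨L, _, rfl, h2, by simp [PTree.formula, ha, ho, Cat.pos]⟩
    | branch B i hb => exact nomatch hb
  | elimL arg fn iha ihf =>
    intro Γ C hd
    cases hd with | @elimL _ _ A _ Δ Γ da df => ?_
    have key : ∀ {L R π : Struct V} {x : PTree V}, AlongBranch (.elimL arg fn) L x R π →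
        x.formula = C.neg ∧ ∃ M, π = L ++ (M ++ R) ∧ Inputs M (Δ ++ Γ) ∧ x ∈ M.occ := by
      intro L R π x h
      cases h with | @elimL _ _ _ _ D _ _ g ha hdis hf => ?_
      obtain ⟨D', g', he, hD, hg⟩ := (iha da).2 ha
      obtain ⟨rfl, h3⟩ := List.append_inj' he rfl
      obtain ⟨h1, M, rfl, hM, hx⟩ := (ihf df).1 hf
      simp only [PTree.formula, Cat.neg, LF.tens.injEq] at h1
      exact ⟨h1.1, M ++ D, by simp, inputs_append.2 ⟨Γ, Δ, rfl, hM, hD⟩, by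
        rw [occ_append, List.mem_append]
        exact .inl (mem_occ_of_premise (.tens_left _ _) hx)⟩
    refine ⟨key, fun h => ?_⟩
    cases h with | branch B i hb => exact of_branch key hb
  | elimR fn arg ihf iha =>
    intro Γ C hd
    cases hd with | @elimR _ _ A _ Γ Δ df da => ?_
    have key : ∀ {L R π : Struct V} {x : PTree V}, AlongBranch (.elimR fn arg) L x R π →
        x.formula = C.neg ∧ ∃ M, π = L ++ (M ++ R) ∧ Inputs M (Γ ++ Δ) ∧ x ∈ M.occ := by
      intro L R π x h
      cases h with | @elimR _ _ _ _ D _ _ g ha hdis hf => ?_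
      obtain ⟨D', g', he, hD, hg⟩ := (iha da).2 ha
      obtain ⟨rfl, h3⟩ := List.append_inj' he rfl
      obtain ⟨h1, M, rfl, hM, hx⟩ := (ihf df).1 hf
      simp only [PTree.formula, Cat.neg, LF.tens.injEq] at h1
      exact ⟨h1.2, D ++ M, by simp, inputs_append.2 ⟨Δ, Γ, rfl, hD, hM⟩, by
        rw [occ_append, List.mem_append]
        exact .inr (mem_occ_of_premise (.tens_right _ _) hx)⟩
    refine ⟨key, fun h => ?_⟩
    cases h with | branch B i hb => exact of_branch key hb

theorem AlongBranch.typed {d : NDTree (Cat V)} {Γ : List (Cat V)} {C : Cat V} {L R π : Struct V}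
    {x : PTree V} (h : AlongBranch d L x R π) (hd : Derives d Γ C) :
    x.formula = C.neg ∧ ∃ M, π = L ++ (M ++ R) ∧ Inputs M Γ ∧ x ∈ M.occ :=
  (typing hd).1 h

theorem Translates.typed {d : NDTree (Cat V)} {Γ : List (Cat V)} {C : Cat V} {L : Struct V}
    {o : PTree V} (h : Translates d (L ++ [o])) (hd : Derives d Γ C) :
    Inputs L Γ ∧ o.formula = C.pos := by
  obtain ⟨L', o', he, h1, h2⟩ := (typing hd).2 h
  obtain ⟨rfl, h3⟩ := List.append_inj' he rfl
  obtain rfl : o = o' := by simpa using h3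
  exact ⟨h1, h2⟩

theorem Translates.exists_concat {d : NDTree (Cat V)} {Γ : List (Cat V)} {C : Cat V} {π : Struct V}
    (h : Translates d π) (hd : Derives d Γ C) : ∃ L o, π = L ++ [o] := by
  obtain ⟨L, o, he, -, -⟩ := (typing hd).2 h
  exact ⟨L, o, he⟩

/-- A branch that starts from a net, in the first place from an axiom, is a net at each stage:
eliminations and introductions are the compositions above, and the nonempty antecedent of an
introduction is the nonempty `L` of the par rules. -/
theorem sound {d : NDTree (Cat V)} : ∀ {Γ : List (Cat V)} {C : Cat V}, Derives d Γ C →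
    (∀ {L R π : Struct V} {x o : PTree V}, AlongBranch d L x (R ++ [o]) π →
      IsProofNet (L ++ x :: (R ++ [o])) → IsProofNet π) ∧
    (∀ {π : Struct V}, Translates d π → IsProofNet π) := by
  have of_branch : ∀ {d : NDTree (Cat V)} {B : Cat V} {i : ℕ} {π : Struct V},
      (∀ {L R π : Struct V} {x o : PTree V}, AlongBranch d L x (R ++ [o]) π →
        IsProofNet (L ++ x :: (R ++ [o])) → IsProofNet π) →
      AlongBranch d [] (.leaf B.neg i) [.leaf B.pos i] π → IsProofNet π :=
    fun h hb => h (R := []) hb (isProofNet_ax _ _)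
  induction d with
  | hyp A =>
    intro Γ C hd
    have key : ∀ {L R π : Struct V} {x o : PTree V}, AlongBranch (.hyp A) L x (R ++ [o]) π →
        IsProofNet (L ++ x :: (R ++ [o])) → IsProofNet π := by
      intro L R π x o h hn
      cases h with | hyp hx => exact hn
    refine ⟨key, fun h => ?_⟩
    cases h with | branch B i hb => exact of_branch key hb
  | introL d ih =>
    intro Γ C hd
    cases hd with | @introL _ A B _ hne hd => ?_
    refine ⟨fun h => (nomatch h), fun h => ?_⟩
    cases h with
    | @introL _ L a b h =>
      refine ((ih hd).2 h).par_left_intro ?_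
      rintro rfl
      have h1 := (Translates.typed (L := [a]) h hd).1.length_eq
      simp only [List.length_cons, List.length_nil] at h1
      exact hne (List.eq_nil_of_length_eq_zero (by omega))
    | branch B i hb => exact nomatch hb
  | introR d ih =>
    intro Γ C hd
    cases hd with | @introR _ A B _ hne hd => ?_
    refine ⟨fun h => (nomatch h), fun h => ?_⟩
    cases h with
    | @introR _ L a b h =>
      refine ((ih hd).2 h).par_right_intro ?_
      rintro rfl
      have h1 := (Translates.typed (L := [a]) h hd).1.length_eq
      simp only [List.length_append, List.length_cons, List.length_nil] at h1
      exact hne (List.eq_nil_of_length_eq_zero (by omega))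
    | branch B i hb => exact nomatch hb
  | elimL arg fn iha ihf =>
    intro Γ C hd
    cases hd with | @elimL _ _ A _ Δ Γ da df => ?_
    have key : ∀ {L R π : Struct V} {x o : PTree V},
        AlongBranch (.elimL arg fn) L x (R ++ [o]) π →
        IsProofNet (L ++ x :: (R ++ [o])) → IsProofNet π := by
      intro L R π x o h hn
      cases h with | @elimL _ _ _ _ D _ _ g ha hdis hf => ?_
      rw [← List.append_assoc] at hf
      refine (ihf df).1 hf ?_
      rw [List.append_assoc]
      exact hn.tens_left_intro ((iha da).2 ha) hdis
    refine ⟨key, fun h => ?_⟩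
    cases h with | branch B i hb => exact of_branch key hb
  | elimR fn arg ihf iha =>
    intro Γ C hd
    cases hd with | @elimR _ _ A _ Γ Δ df da => ?_
    have key : ∀ {L R π : Struct V} {x o : PTree V},
        AlongBranch (.elimR fn arg) L x (R ++ [o]) π →
        IsProofNet (L ++ x :: (R ++ [o])) → IsProofNet π := by
      intro L R π x o h hn
      cases h with | @elimR _ _ _ _ D _ _ g ha hdis hf => ?_
      exact (ihf df).1 hf (hn.tens_right_intro ((iha da).2 ha) hdis)
    refine ⟨key, fun h => ?_⟩
    cases h with | branch B i hb => exact of_branch key hb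

theorem Translates.isNetOf {d : NDTree (Cat V)} {Γ : List (Cat V)} {C : Cat V} {π : Struct V}
    (h : Translates d π) (hd : Derives d Γ C) : π.IsNetOf Γ C := by
  refine ⟨(sound hd).2 h, ?_⟩
  obtain ⟨L, o, rfl⟩ := h.exists_concat hd
  exact conclusions_iff.2 (h.typed hd)

/-! ### Renaming of the axiom indices -/

@[simp] theorem PTree.formula_reindex (f : ℕ → ℕ) (t : PTree V) :
    (t.reindex f).formula = t.formula := by
  induction t <;> simp_all [PTree.reindex, PTree.formula]

@[simp] theorem PTree.idx_reindex (f : ℕ → ℕ) (t : PTree V) :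
    (t.reindex f).idx = t.idx.map f := by
  induction t <;> simp_all [PTree.reindex]

@[simp] theorem Struct.indices_reindex (f : ℕ → ℕ) (π : Struct V) :
    Struct.indices (π.map (PTree.reindex f)) = π.indices.map f := by
  induction π <;> simp_all [indices_cons]

theorem translates_reindex {f : ℕ → ℕ} (hf : Function.Injective f) {d : NDTree (Cat V)} :
    (∀ {L R π : Struct V} {x : PTree V}, AlongBranch d L x R π →
      AlongBranch d (L.map (PTree.reindex f)) (x.reindex f) (R.map (PTree.reindex f))
        (π.map (PTree.reindex f))) ∧
    (∀ {π : Struct V}, Translates d π → Translates d (π.map (PTree.reindex f))) := by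
  have hdisj : ∀ {π ρ : Struct V}, π.indices.Disjoint ρ.indices →
      (Struct.indices (π.map (PTree.reindex f))).Disjoint
        (Struct.indices (ρ.map (PTree.reindex f))) := by
    intro π ρ h
    rw [indices_reindex, indices_reindex]
    exact List.disjoint_map hf h
  induction d with
  | hyp A =>
    have key : ∀ {L R π : Struct V} {x : PTree V}, AlongBranch (.hyp A) L x R π →
        AlongBranch (.hyp A) (L.map (PTree.reindex f)) (x.reindex f) (R.map (PTree.reindex f))
          (π.map (PTree.reindex f)) := by
      intro L R π x h
      cases h with | hyp hx => ?_
      rw [List.map_append, List.map_cons]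
      exact .hyp (by simpa using hx)
    refine ⟨key, fun h => ?_⟩
    cases h with | branch B i hb => exact .branch B (f i) (key hb)
  | introL d ih =>
    refine ⟨fun h => (nomatch h), fun h => ?_⟩
    cases h with
    | @introL _ L a b h =>
      have := ih.2 h
      rw [List.map_append] at this ⊢
      exact .introL this
    | branch B i hb => exact nomatch hb
  | introR d ih =>
    refine ⟨fun h => (nomatch h), fun h => ?_⟩
    cases h with
    | @introR _ L a b h =>
      have := ih.2 h
      rw [List.map_cons, List.map_append] at this
      rw [List.map_append]
      exact .introR this
    | branch B i hb => exact nomatch hb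
  | elimL arg fn iha ihf =>
    have key : ∀ {L R π : Struct V} {x : PTree V}, AlongBranch (.elimL arg fn) L x R π →
        AlongBranch (.elimL arg fn) (L.map (PTree.reindex f)) (x.reindex f)
          (R.map (PTree.reindex f)) (π.map (PTree.reindex f)) := by
      intro L R π x h
      cases h with | @elimL _ _ _ _ D _ _ g ha hdis hf => ?_
      have h1 := iha.2 ha
      have h2 := hdisj hdis
      have h3 := ihf.1 hf
      rw [List.map_append] at h1
      rw [List.map_append, List.map_append] at h2
      rw [List.map_append] at h3
      exact .elimL h1 h2 h3
    refine ⟨key, fun h => ?_⟩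
    cases h with | branch B i hb => exact .branch B (f i) (key hb)
  | elimR fn arg ihf iha =>
    have key : ∀ {L R π : Struct V} {x : PTree V}, AlongBranch (.elimR fn arg) L x R π →
        AlongBranch (.elimR fn arg) (L.map (PTree.reindex f)) (x.reindex f)
          (R.map (PTree.reindex f)) (π.map (PTree.reindex f)) := by
      intro L R π x h
      cases h with | @elimR _ _ _ _ D _ _ g ha hdis hf => ?_
      have h1 := iha.2 ha
      have h2 := hdisj hdis
      have h3 := ihf.1 hf
      rw [List.map_append] at h1
      rw [List.map_append, List.map_append] at h2
      rw [List.map_append] at h3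
      exact .elimR h1 h2 h3
    refine ⟨key, fun h => ?_⟩
    cases h with | branch B i hb => exact .branch B (f i) (key hb)

theorem Translates.reindex {d : NDTree (Cat V)} {π : Struct V} (h : Translates d π) {f : ℕ → ℕ}
    (hf : Function.Injective f) : Translates d (π.map (PTree.reindex f)) :=
  (translates_reindex hf).2 h

theorem Translates.same {d : NDTree (Cat V)} {π ρ : Struct V} (h : Translates d π)
    (hs : π.Same ρ) : Translates d ρ := by
  obtain ⟨f, rfl⟩ := hs
  exact h.reindex f.injective

/-! ### Each normal deduction has a translation -/

/-- By normality the principal branch meets no introduction before its hypothesis, so it can be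
followed to the end. At each elimination the translation of the argument is first renamed away from
the indices in use. -/
theorem translation_exists {d : NDTree (Cat V)} : ∀ {Γ : List (Cat V)} {C : Cat V},
    Derives d Γ C → d.Normal →
    (¬ d.IsIntro → ∀ (L R : Struct V) (x : PTree V), x.formula = C.neg →
      ∃ π, AlongBranch d L x R π) ∧ ∃ π, Translates d π := by
  have of_branch : ∀ {d : NDTree (Cat V)} {C : Cat V},
      (∀ (L R : Struct V) (x : PTree V), x.formula = C.neg → ∃ π, AlongBranch d L x R π) →
      ∃ π, Translates d π := by
    intro d C h
    obtain ⟨π, hπ⟩ := h [] [.leaf C.pos 0] (.leaf C.neg 0) rfl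
    exact ⟨π, .branch C 0 hπ⟩
  have fresh : ∀ {d : NDTree (Cat V)} {Γ : List (Cat V)} {C : Cat V} (ρ : Struct V),
      Derives d Γ C → (∃ π, Translates d π) →
      ∃ D g, Translates d (D ++ [g]) ∧ g.formula = C.pos ∧
        (Struct.indices (D ++ [g])).Disjoint ρ.indices := by
    rintro d Γ C ρ hd ⟨π, hπ⟩
    obtain ⟨f, hf⟩ := exists_perm_disjoint π.indices ρ.indices
    have h1 := hπ.reindex f.injective
    obtain ⟨D, g, he⟩ := h1.exists_concat hd
    rw [← Struct.indices_reindex, he] at hf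
    rw [he] at h1
    exact ⟨D, g, h1, (h1.typed hd).2, hf⟩
  induction d with
  | hyp A =>
    intro Γ C hd _
    cases hd
    have key : ∀ (L R : Struct V) (x : PTree V), x.formula = A.neg →
        ∃ π, AlongBranch (.hyp A) L x R π := fun L R x hx => ⟨_, .hyp hx⟩
    exact ⟨fun _ => key, of_branch key⟩
  | introL d ih =>
    intro Γ C hd hn
    refine ⟨fun h => absurd trivial h, ?_⟩
    cases hd with | @introL _ A B _ hne hd => ?_
    obtain ⟨π, hπ⟩ := (ih hd hn).2
    obtain ⟨L, o, rfl⟩ := hπ.exists_concat hd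
    obtain ⟨h1, h2⟩ := hπ.typed hd
    rcases List.eq_nil_or_concat L with rfl | ⟨L, a, rfl⟩
    · simp at h1
    · exact ⟨L ++ [.par a o], .introL (by simpa using hπ)⟩
  | introR d ih =>
    intro Γ C hd hn
    refine ⟨fun h => absurd trivial h, ?_⟩
    cases hd with | @introR _ A B _ hne hd => ?_
    obtain ⟨π, hπ⟩ := (ih hd hn).2
    obtain ⟨L, o, rfl⟩ := hπ.exists_concat hd
    obtain ⟨h1, h2⟩ := hπ.typed hd
    rcases L with _ | ⟨a, L⟩
    · simp at h1
    · exact ⟨L ++ [.par o a], .introR (by simpa using hπ)⟩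
  | elimL arg fn iha ihf =>
    intro Γ C hd hn
    cases hd with | @elimL _ _ A _ Δ Γ da df => ?_
    have key : ∀ (L R : Struct V) (x : PTree V), x.formula = C.neg →
        ∃ π, AlongBranch (.elimL arg fn) L x R π := by
      intro L R x hx
      obtain ⟨D, g, h1, h2, h3⟩ := fresh (L ++ x :: R) da (iha da hn.1).2
      obtain ⟨π, hπ⟩ := (ihf df hn.2.1).1 hn.2.2 L (D ++ R) (.tens x g)
        (by simp [PTree.formula, Cat.neg, hx, h2])
      exact ⟨π, .elimL h1 h3 hπ⟩
    exact ⟨fun _ => key, of_branch key⟩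
  | elimR fn arg ihf iha =>
    intro Γ C hd hn
    cases hd with | @elimR _ _ A _ Γ Δ df da => ?_
    have key : ∀ (L R : Struct V) (x : PTree V), x.formula = C.neg →
        ∃ π, AlongBranch (.elimR fn arg) L x R π := by
      intro L R x hx
      obtain ⟨D, g, h1, h2, h3⟩ := fresh (L ++ x :: R) da (iha da hn.2.1).2
      obtain ⟨π, hπ⟩ := (ihf df hn.1).1 hn.2.2 (L ++ D) R (.tens g x)
        (by simp [PTree.formula, Cat.neg, hx, h2])
      exact ⟨π, .elimR h1 h3 hπ⟩
    exact ⟨fun _ => key, of_branch key⟩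

end Lambek


namespace Lambek

universe u v w

variable {V : Type u}

/-! ### Uniqueness of the translation -/

open Struct

open Classical in
/-- The tree with its leaf formulae replaced by the symbol of their polarity. -/
noncomputable def PTree.skeleton : PTree V → PTree Unit
  | .leaf F i => .leaf (if F.IsOutput then .atom baseO else .coatom baseO) i
  | .tens a b => .tens a.skeleton b.skeleton
  | .par a b => .par a.skeleton b.skeleton

theorem PTree.skeleton_leaf_pos (C : Cat V) (i : ℕ) :
    (PTree.leaf C.pos i).skeleton = .leaf (.atom baseO) i := by
  simp [PTree.skeleton]

theorem PTree.skeleton_leaf_neg (C : Cat V) (i : ℕ) :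
    (PTree.leaf C.neg i).skeleton = .leaf (.coatom baseO) i := by
  simp [PTree.skeleton]

@[simp] theorem PTree.idx_skeleton (t : PTree V) : t.skeleton.idx = t.idx := by
  induction t <;> simp_all [PTree.skeleton]

@[simp] theorem PTree.skeleton_reindex (f : ℕ → ℕ) (t : PTree V) :
    (t.reindex f).skeleton = t.skeleton.reindex f := by
  induction t <;> simp_all [PTree.skeleton, PTree.reindex]

theorem PTree.reindex_congr {f g : ℕ → ℕ} {t : PTree V} (h : ∀ i ∈ t.idx, f i = g i) :
    t.reindex f = t.reindex g := by
  induction t with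
  | leaf F i => simp [PTree.reindex, h i (by simp)]
  | tens a b iha ihb =>
    simp only [PTree.idx_tens, List.mem_append] at h
    simp [PTree.reindex, iha fun i hi => h i (.inl hi), ihb fun i hi => h i (.inr hi)]
  | par a b iha ihb =>
    simp only [PTree.idx_par, List.mem_append] at h
    simp [PTree.reindex, iha fun i hi => h i (.inl hi), ihb fun i hi => h i (.inr hi)]

/-- The formula at the root and the shape of the tree determine the formula at every leaf. -/
theorem PTree.ext_skeleton {t t' : PTree V} (h : t.skeleton = t'.skeleton)
    (hf : t.formula = t'.formula) : t = t' := by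
  induction t generalizing t' with
  | leaf F i => cases t' <;> simp_all [PTree.skeleton, PTree.formula]
  | tens a b iha ihb =>
    cases t' <;> simp only [PTree.skeleton, PTree.formula, PTree.tens.injEq, LF.tens.injEq,
      reduceCtorEq] at h hf
    rw [iha h.1 hf.1, ihb h.2 hf.2]
  | par a b iha ihb =>
    cases t' <;> simp only [PTree.skeleton, PTree.formula, PTree.par.injEq, LF.par.injEq,
      reduceCtorEq] at h hf
    rw [iha h.1 hf.1, ihb h.2 hf.2]

namespace Struct

/-- The skeleton of the second structure is the skeleton of the first one, renamed by `f`. -/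
def Copies {V' : Type w} (f : ℕ → ℕ) (π : Struct V) (ρ : Struct V') : Prop :=
  ρ.map PTree.skeleton = π.map (PTree.reindex f ∘ PTree.skeleton)

variable {V' : Type w} {f g : ℕ → ℕ}

theorem copies_append {π σ : Struct V} {ρ τ : Struct V'} (h : Copies f π ρ) (h' : Copies f σ τ) :
    Copies f (π ++ σ) (ρ ++ τ) := by
  simp only [Copies, List.map_append] at *
  rw [h, h']

theorem copies_cons {x : PTree V} {y : PTree V'} {π : Struct V} {ρ : Struct V'} :
    Copies f (x :: π) (y :: ρ) ↔ y.skeleton = x.skeleton.reindex f ∧ Copies f π ρ := by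
  simp [Copies]

theorem copies_concat {x : PTree V} {y : PTree V'} {π : Struct V} {ρ : Struct V'} :
    Copies f (π ++ [x]) (ρ ++ [y]) ↔ y.skeleton = x.skeleton.reindex f ∧ Copies f π ρ := by
  simp only [Copies, List.map_append, List.map_cons, List.map_nil, Function.comp]
  constructor
  · intro h
    obtain ⟨h1, h2⟩ := List.append_inj' h rfl
    exact ⟨by simpa using h2, h1⟩
  · rintro ⟨h1, h2⟩
    rw [h1, h2]

theorem copies_nil : Copies f ([] : Struct V) ([] : Struct V') := rfl

theorem Copies.congr {π : Struct V} {ρ : Struct V'} (h : Copies f π ρ)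
    (hfg : ∀ i ∈ π.indices, f i = g i) : Copies g π ρ := by
  unfold Copies at *
  rw [h]
  refine List.map_congr_left fun t ht => ?_
  exact PTree.reindex_congr fun i hi => hfg i (mem_indices.2 ⟨t, ht, by simpa using hi⟩)

theorem indices_skeleton (π : Struct V) : Struct.indices (π.map PTree.skeleton) = π.indices := by
  induction π <;> simp_all [indices_cons]

theorem Copies.indices_eq {π : Struct V} {ρ : Struct V'} (h : Copies f π ρ) :
    ρ.indices = π.indices.map f := by
  rw [← indices_skeleton ρ, h, ← List.map_map, indices_reindex, indices_skeleton]

/-- `ρ` is a copy of `π` by an injective renaming. -/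
def Similar (π : Struct V) (ρ : Struct V') : Prop :=
  ∃ f : ℕ → ℕ, Set.InjOn f {i | i ∈ π.indices} ∧ Copies f π ρ

theorem Similar.exists_perm {π : Struct V} {ρ : Struct V'} (h : Similar π ρ) :
    ∃ f : Equiv.Perm ℕ, Copies f π ρ := by
  obtain ⟨f, hf, hc⟩ := h
  obtain ⟨σ, hσ⟩ := exists_perm_eqOn f _ hf
  exact ⟨σ, hc.congr fun i hi => (hσ i hi).symm⟩

theorem Similar.congr {π π' : Struct V} {ρ ρ' : Struct V'} (h : Similar π ρ)
    (hi : ∀ i ∈ π'.indices, i ∈ π.indices) (hc : ∀ f, Copies f π ρ → Copies f π' ρ') :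
    Similar π' ρ' := by
  obtain ⟨f, hf, h⟩ := h
  exact ⟨f, hf.mono fun i h => hi i h, hc f h⟩

/-- Disjoint copies have a common renaming. -/
theorem Similar.append {π σ : Struct V} {ρ τ : Struct V'} (h : Similar π ρ) (h' : Similar σ τ)
    (hd : π.indices.Disjoint σ.indices) (hd' : ρ.indices.Disjoint τ.indices) :
    Similar (π ++ σ) (ρ ++ τ) := by
  classical
  obtain ⟨f, hf, h⟩ := h
  obtain ⟨g, hg, h'⟩ := h'
  have e1 : ∀ i ∈ π.indices, f i = if i ∈ π.indices then f i else g i := fun i hi => by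
    rw [if_pos hi]
  have e2 : ∀ i ∈ σ.indices, g i = if i ∈ π.indices then f i else g i := fun i hi => by
    rw [if_neg fun hi' => hd hi' hi]
  refine ⟨fun i => if i ∈ π.indices then f i else g i, ?_,
    copies_append (h.congr e1) (h'.congr e2)⟩
  have hm1 : ∀ i ∈ π.indices, f i ∈ ρ.indices := fun i hi => by
    rw [h.indices_eq]; exact List.mem_map_of_mem hi
  have hm2 : ∀ i ∈ σ.indices, g i ∈ τ.indices := fun i hi => by
    rw [h'.indices_eq]; exact List.mem_map_of_mem hi
  intro i hi j hj hij
  simp only [indices_append, List.mem_append, Set.mem_ofPred_eq] at hi hj hij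
  rcases hi with hi | hi <;> rcases hj with hj | hj
  · rw [← e1 i hi, ← e1 j hj] at hij; exact hf hi hj hij
  · rw [← e1 i hi, ← e2 j hj] at hij
    exact absurd (hij ▸ hm1 i hi) fun h => hd' h (hm2 j hj)
  · rw [← e2 i hi, ← e1 j hj] at hij
    exact absurd (hij ▸ hm2 i hi) fun h => hd' (hm1 j hj) h
  · rw [← e2 i hi, ← e2 j hj] at hij; exact hg hi hj hij

end Struct

/-- The rules alone guide the translation; the categories only appear in the axioms, and there the
skeleton keeps just the polarity. Two sets of variables are allowed, so that the same induction
gives uniqueness of the translation and invariance of its frame. -/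
theorem similar_of_erase_eq {V' : Type w} {d : NDTree (Cat V)} : ∀ {d' : NDTree (Cat V')},
    d.erase = d'.erase →
    (∀ {L R π : Struct V} {x : PTree V} {L' R' π' : Struct V'} {x' : PTree V'},
      AlongBranch d L x R π → AlongBranch d' L' x' R' π' →
      (∃ f : ℕ → ℕ, Set.InjOn f {i | i ∈ indices (L ++ x :: R)} ∧ Copies f L L' ∧
        x'.skeleton = x.skeleton.reindex f ∧ Copies f R R') → Similar π π') ∧
    (∀ {π : Struct V} {π' : Struct V'}, Translates d π → Translates d' π' → Similar π π') := by
  have of_branch : ∀ {d : NDTree (Cat V)} {d' : NDTree (Cat V')} {B : Cat V} {B' : Cat V'}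
      {i i' : ℕ} {π : Struct V} {π' : Struct V'},
      (∀ {L R π : Struct V} {x : PTree V} {L' R' π' : Struct V'} {x' : PTree V'},
        AlongBranch d L x R π → AlongBranch d' L' x' R' π' →
        (∃ f : ℕ → ℕ, Set.InjOn f {i | i ∈ indices (L ++ x :: R)} ∧ Copies f L L' ∧
          x'.skeleton = x.skeleton.reindex f ∧ Copies f R R') → Similar π π') →
      AlongBranch d [] (.leaf B.neg i) [.leaf B.pos i] π →
      AlongBranch d' [] (.leaf B'.neg i') [.leaf B'.pos i'] π' → Similar π π' := by
    intro d d' B B' i i' π π' h h1 h2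
    -- A constant renaming is injective here, for the axiom has the single index `i`.
    refine h h1 h2 ⟨fun _ => i', ?_, copies_nil, ?_, ?_⟩
    · intro j hj k hk _
      simp only [List.nil_append, indices_cons, PTree.idx_leaf, indices_nil, Set.mem_ofPred_eq,
        List.mem_append, List.mem_cons, List.not_mem_nil, or_false, or_self] at hj hk
      rw [hj, hk]
    · simp [PTree.skeleton_leaf_neg, PTree.reindex]
    · refine copies_cons.2 ⟨?_, copies_nil⟩
      simp [PTree.skeleton_leaf_pos, PTree.reindex]
  induction d with
  | hyp A =>
    intro d' he
    cases d' with
    | hyp A' =>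
      have key : ∀ {L R π : Struct V} {x : PTree V} {L' R' π' : Struct V'} {x' : PTree V'},
          AlongBranch (.hyp A) L x R π → AlongBranch (.hyp A') L' x' R' π' →
          (∃ f : ℕ → ℕ, Set.InjOn f {i | i ∈ indices (L ++ x :: R)} ∧ Copies f L L' ∧
            x'.skeleton = x.skeleton.reindex f ∧ Copies f R R') → Similar π π' := by
        rintro L R π x L' R' π' x' h h' ⟨f, hf, h1, h2, h3⟩
        cases h; cases h'
        exact ⟨f, hf, copies_append h1 (copies_cons.2 ⟨h2, h3⟩)⟩
      refine ⟨key, fun h h' => ?_⟩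
      cases h with | branch B i hb => ?_
      cases h' with | branch B' i' hb' => ?_
      exact of_branch key hb hb'
    | _ => simp [NDTree.erase] at he
  | introL d ih =>
    intro d' he
    cases d' with
    | introL d' =>
      refine ⟨fun h => (nomatch h), fun h h' => ?_⟩
      cases h with
      | branch B i hb => exact nomatch hb
      | @introL _ L a b h => ?_
      cases h' with
      | branch B i hb => exact nomatch hb
      | @introL _ L' a' b' h' => ?_
      refine ((ih (by simpa [NDTree.erase] using he)).2 h h').congr ?_ ?_
      · intro i hi
        simpa using hi
      · intro f hf
        have hf' : Copies f ((L ++ [a]) ++ [b]) ((L' ++ [a']) ++ [b']) := by simpa using hf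
        rw [copies_concat, copies_concat] at hf'
        rw [copies_concat]
        exact ⟨by simp [PTree.skeleton, PTree.reindex, hf'.1, hf'.2.1], hf'.2.2⟩
    | _ => simp [NDTree.erase] at he
  | introR d ih =>
    intro d' he
    cases d' with
    | introR d' =>
      refine ⟨fun h => (nomatch h), fun h h' => ?_⟩
      cases h with
      | branch B i hb => exact nomatch hb
      | @introR _ L a b h => ?_
      cases h' with
      | branch B i hb => exact nomatch hb
      | @introR _ L' a' b' h' => ?_
      refine ((ih (by simpa [NDTree.erase] using he)).2 h h').congr ?_ ?_
      · intro i hi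
        simp only [indices_append, indices_cons, indices_nil, PTree.idx_par, List.mem_append] at hi ⊢
        tauto
      · intro f hf
        rw [copies_cons, copies_concat] at hf
        rw [copies_concat]
        exact ⟨by simp [PTree.skeleton, PTree.reindex, hf.1, hf.2.1], hf.2.2⟩
    | _ => simp [NDTree.erase] at he
  | elimL arg fn iha ihf =>
    intro d' he
    cases d' with
    | elimL arg' fn' =>
      simp only [NDTree.erase, NDTree.elimL.injEq] at he
      have key : ∀ {L R π : Struct V} {x : PTree V} {L' R' π' : Struct V'} {x' : PTree V'},
          AlongBranch (.elimL arg fn) L x R π → AlongBranch (.elimL arg' fn') L' x' R' π' →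
          (∃ f : ℕ → ℕ, Set.InjOn f {i | i ∈ indices (L ++ x :: R)} ∧ Copies f L L' ∧
            x'.skeleton = x.skeleton.reindex f ∧ Copies f R R') → Similar π π' := by
        rintro L R π x L' R' π' x' h h' ⟨f, hf, h1, h2, h3⟩
        cases h with | @elimL _ _ _ _ D _ _ g ha hdis hb => ?_
        cases h' with | @elimL _ _ _ _ D' _ _ g' ha' hdis' hb' => ?_
        -- The copy of the argument and the copy of what is built so far receive a common renaming
        -- `k`, because the indices are kept apart on both sides.
        obtain ⟨k, hk, hc⟩ := ((iha he.1).2 ha ha').append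
          ⟨f, hf, copies_append h1 (copies_cons.2 ⟨h2, h3⟩)⟩ hdis hdis'
        have hlen : L.length = L'.length := by simpa using (congrArg List.length h1).symm
        -- Equal lengths allow the glued copy to be cut again at the same places.
        have hlenD : (D ++ [g]).length = (D' ++ [g']).length := by
          have h5 := congrArg List.length hc
          have h6 := congrArg List.length h3
          simp only [List.length_map, List.length_append, List.length_cons] at h5 h6 ⊢
          omega
        simp only [Copies, List.map_append (l₁ := D ++ [g]), List.map_append (l₁ := D' ++ [g'])] at hc
        obtain ⟨hc1, hc2⟩ := List.append_inj hc (by simpa using hlenD.symm)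
        rw [List.map_append, List.map_append] at hc2
        obtain ⟨hc2, hc3⟩ := List.append_inj hc2 (by simpa using hlen.symm)
        obtain ⟨hg, hD⟩ := copies_concat.1 hc1
        obtain ⟨hx, hR⟩ := copies_cons.1 hc3
        refine (ihf he.2).1 hb hb' ⟨k, hk.mono ?_, hc2, ?_, copies_append hD hR⟩
        · intro i hi
          simp only [indices_append, indices_cons, indices_nil, PTree.idx_tens, List.mem_append,
            Set.mem_ofPred_eq] at hi ⊢
          tauto
        · simp [PTree.skeleton, PTree.reindex, hx, hg]
      refine ⟨key, fun h h' => ?_⟩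
      cases h with | branch B i hb => ?_
      cases h' with | branch B' i' hb' => ?_
      exact of_branch key hb hb'
    | _ => simp [NDTree.erase] at he
  | elimR fn arg ihf iha =>
    intro d' he
    cases d' with
    | elimR fn' arg' =>
      simp only [NDTree.erase, NDTree.elimR.injEq] at he
      have key : ∀ {L R π : Struct V} {x : PTree V} {L' R' π' : Struct V'} {x' : PTree V'},
          AlongBranch (.elimR fn arg) L x R π → AlongBranch (.elimR fn' arg') L' x' R' π' →
          (∃ f : ℕ → ℕ, Set.InjOn f {i | i ∈ indices (L ++ x :: R)} ∧ Copies f L L' ∧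
            x'.skeleton = x.skeleton.reindex f ∧ Copies f R R') → Similar π π' := by
        rintro L R π x L' R' π' x' h h' ⟨f, hf, h1, h2, h3⟩
        cases h with | @elimR _ _ _ _ D _ _ g ha hdis hb => ?_
        cases h' with | @elimR _ _ _ _ D' _ _ g' ha' hdis' hb' => ?_
        obtain ⟨k, hk, hc⟩ := ((iha he.2).2 ha ha').append
          ⟨f, hf, copies_append h1 (copies_cons.2 ⟨h2, h3⟩)⟩ hdis hdis'
        have hlen : L.length = L'.length := by simpa using (congrArg List.length h1).symm
        have hlenD : (D ++ [g]).length = (D' ++ [g']).length := by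
          have h5 := congrArg List.length hc
          have h6 := congrArg List.length h3
          simp only [List.length_map, List.length_append, List.length_cons] at h5 h6 ⊢
          omega
        simp only [Copies, List.map_append (l₁ := D ++ [g]), List.map_append (l₁ := D' ++ [g'])] at hc
        obtain ⟨hc1, hc2⟩ := List.append_inj hc (by simpa using hlenD.symm)
        rw [List.map_append, List.map_append] at hc2
        obtain ⟨hc2, hc3⟩ := List.append_inj hc2 (by simpa using hlen.symm)
        obtain ⟨hg, hD⟩ := copies_concat.1 hc1
        obtain ⟨hx, hR⟩ := copies_cons.1 hc3
        refine (ihf he.1).1 hb hb' ⟨k, hk.mono ?_, copies_append hc2 hD, ?_, hR⟩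
        · intro i hi
          simp only [indices_append, indices_cons, indices_nil, PTree.idx_tens, List.mem_append,
            Set.mem_ofPred_eq] at hi ⊢
          tauto
        · simp [PTree.skeleton, PTree.reindex, hx, hg]
      refine ⟨key, fun h h' => ?_⟩
      cases h with | branch B i hb => ?_
      cases h' with | branch B' i' hb' => ?_
      exact of_branch key hb hb'
    | _ => simp [NDTree.erase] at he

/-- Translations of one and the same deduction differ only by the axiom indices. -/
theorem Translates.unique {d : NDTree (Cat V)} {π ρ : Struct V} (h : Translates d π)
    (h' : Translates d ρ) (hf : π.map PTree.formula = ρ.map PTree.formula) : π.Same ρ := by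
  obtain ⟨f, hc⟩ := ((similar_of_erase_eq rfl).2 h h').exists_perm
  refine ⟨f, ?_⟩
  clear h h'
  induction π generalizing ρ with
  | nil => simpa [Copies] using hc
  | cons t π ih =>
    cases ρ with
    | nil => simp at hf
    | cons t' ρ =>
      simp only [List.map_cons, List.cons.injEq] at hf ⊢
      obtain ⟨h1, h2⟩ := copies_cons.1 hc
      exact ⟨PTree.ext_skeleton (by simpa using h1) (by simpa using hf.1.symm), ih hf.2 h2⟩

end Lambek


namespace Lambek

universe u v

variable {V : Type u}

/-! ### The climbing algorithm -/

open Struct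

/-- The conditions under which a descent stops. -/
def Struct.Stops (ρ : Struct V) (x : PTree V) : Prop :=
  x ∈ ρ ∨ ∃ b : PTree V, .par x b ∈ ρ.occ ∨ .par b x ∈ ρ.occ

theorem indices_subset_tens_left {L R D : Struct V} {x g : PTree V} :
    indices (D ++ [g]) ⊆ indices (L ++ .tens x g :: (D ++ R)) ∧
      indices (L ++ x :: R) ⊆ indices (L ++ .tens x g :: (D ++ R)) := by
  constructor <;> intro i hi <;>
    simp only [indices_append, indices_cons, indices_nil, PTree.idx_tens, List.mem_append] at hi ⊢ <;>
    tauto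

theorem indices_subset_tens_right {L R D : Struct V} {x g : PTree V} :
    indices (D ++ [g]) ⊆ indices ((L ++ D) ++ .tens g x :: R) ∧
      indices (L ++ x :: R) ⊆ indices ((L ++ D) ++ .tens g x :: R) := by
  constructor <;> intro i hi <;>
    simp only [indices_append, indices_cons, indices_nil, PTree.idx_tens, List.mem_append] at hi ⊢ <;>
    tauto

/-- This separates the names in an application: those of the argument use only indices of `D ++
[g]`, those of the function contain `x` or avoid these indices. -/
theorem not_disjoint_of_grown {L R D : Struct V} {x g v : PTree V}
    (hdis : (indices (D ++ [g])).Disjoint (indices (L ++ x :: R)))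
    (h1 : v.idx ⊆ indices (D ++ [g]))
    (h2 : x ∈ v.subtrees ∨ v.idx.Disjoint (indices (D ++ [g]))) : False := by
  obtain ⟨j, hj⟩ := v.exists_mem_idx
  rcases h2 with h | h
  · obtain ⟨i, hi⟩ := x.exists_mem_idx
    exact hdis (h1 (PTree.idx_subset_of_mem_subtrees h hi))
      (by simp [indices_append, indices_cons, hi])
  · exact h hj (h1 hj)

/-- The climb through the whole net `ρ` retraces the construction of each part: a descent follows
the growing conclusion `x`, and climbing from `g` reads the argument. It is required that the inputs
of the part be places of `ρ` where descents stop. The last clause locates the names, which makes the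
names of the two subterms of an application distinct. -/
theorem reads_of_translates (ρ : Struct V) {d : NDTree (Cat V)} :
    ∀ {Γ : List (Cat V)} {C : Cat V}, Derives d Γ C →
    (∀ {L R M : Struct V} {x : PTree V}, AlongBranch d L x R (L ++ (M ++ R)) →
      (∀ t ∈ M.occ, t ∈ ρ.occ) → (∀ y ∈ M, ρ.Stops y) →
      ∃ t, Descends ρ x t ∧ t.HasType (M.reverse.zip Γ) C ∧ t.vars.Nodup ∧ t.toND = d ∧
        ∀ v ∈ t.vars, v ∈ M.occ ∧ (x ∈ v.subtrees ∨ v.idx.Disjoint (indices (L ++ x :: R)))) ∧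
    (∀ {L : Struct V} {o : PTree V}, Translates d (L ++ [o]) →
      (∀ t ∈ occ (L ++ [o]), t ∈ ρ.occ) → (∀ y ∈ L, ρ.Stops y) →
      ∃ t, Climbs ρ o t ∧ t.HasType (L.reverse.zip Γ) C ∧ t.vars.Nodup ∧ t.toND = d ∧
        ∀ v ∈ t.vars, v ∈ occ (L ++ [o])) := by
  have of_branch : ∀ {d : NDTree (Cat V)} {Γ : List (Cat V)} {C B : Cat V} {i : ℕ} {L : Struct V}
      {o : PTree V}, Derives d Γ C →
      (∀ {L R M : Struct V} {x : PTree V}, AlongBranch d L x R (L ++ (M ++ R)) →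
        (∀ t ∈ M.occ, t ∈ ρ.occ) → (∀ y ∈ M, ρ.Stops y) →
        ∃ t, Descends ρ x t ∧ t.HasType (M.reverse.zip Γ) C ∧ t.vars.Nodup ∧ t.toND = d ∧
        ∀ v ∈ t.vars, v ∈ M.occ ∧ (x ∈ v.subtrees ∨ v.idx.Disjoint (indices (L ++ x :: R)))) →
      AlongBranch d [] (.leaf B.neg i) [.leaf B.pos i] (L ++ [o]) →
      (∀ t ∈ occ (L ++ [o]), t ∈ ρ.occ) → (∀ y ∈ L, ρ.Stops y) →
      ∃ t, Climbs ρ o t ∧ t.HasType (L.reverse.zip Γ) C ∧ t.vars.Nodup ∧ t.toND = d ∧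
        ∀ v ∈ t.vars, v ∈ occ (L ++ [o]) := by
    intro d Γ C B i L o hd h hb hocc hst
    obtain ⟨hB, M, he, hM, hx⟩ := hb.typed hd
    obtain rfl : B = C := Cat.neg_injective hB
    obtain ⟨rfl, rfl⟩ : L = M ∧ o = .leaf B.pos i := by simpa using he
    have hocc' : ∀ t ∈ L.occ, t ∈ ρ.occ := fun t ht => hocc t (by simp [ht])
    obtain ⟨t, h1, h2, h3, h4, h5⟩ := h (L := []) (M := L) hb hocc' hst
    exact ⟨t, .ax (hocc' _ hx) h1, h2, h3, h4, fun v hv => by simp [(h5 v hv).1]⟩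
  induction d with
  | hyp A =>
    intro Γ C hd
    have hd0 := hd
    cases hd
    have key : ∀ {L R M : Struct V} {x : PTree V}, AlongBranch (.hyp A) L x R (L ++ (M ++ R)) →
        (∀ t ∈ M.occ, t ∈ ρ.occ) → (∀ y ∈ M, ρ.Stops y) →
        ∃ t, Descends ρ x t ∧ t.HasType (M.reverse.zip [A]) A ∧ t.vars.Nodup ∧ t.toND = .hyp A ∧
        ∀ v ∈ t.vars, v ∈ M.occ ∧
          (x ∈ v.subtrees ∨ v.idx.Disjoint (indices (L ++ x :: R))) := by
      intro L R M x h hocc hst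
      generalize hπ : L ++ (M ++ R) = π at h
      cases h with | hyp hx => ?_
      obtain rfl : M = [x] := by
        have : L ++ (M ++ R) = L ++ ([x] ++ R) := by simpa using hπ
        exact List.append_cancel_right (List.append_cancel_left this)
      refine ⟨.var x A, .head (hst x (by simp)) hx, .var x A, by simp [LTerm.vars], rfl, ?_⟩
      intro v hv
      obtain rfl : v = x := by simpa [LTerm.vars] using hv
      exact ⟨mem_occ_of_mem (by simp), .inl (PTree.self_mem_subtrees _)⟩
    refine ⟨key, fun h => ?_⟩
    cases h with | branch B i hb => exact of_branch hd0 key hb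
  | introL d ih =>
    intro Γ C hd
    cases hd with | @introL _ A B _ hne hd => ?_
    refine ⟨fun h => (nomatch h), fun {L o} h hocc hst => ?_⟩
    generalize hπ : L ++ [o] = π at h
    cases h with
    | branch B i hb => exact nomatch hb
    | @introL _ L' a b h => ?_
    obtain ⟨rfl, ho⟩ := List.append_inj' hπ rfl
    obtain rfl : o = _ := by simpa using ho
    have h' : Translates d ((L ++ [a]) ++ [b]) := by simpa using h
    obtain ⟨hin, -⟩ := h'.typed hd
    obtain ⟨Γ₁, Γ₂, hΓ, hL, h2⟩ := inputs_append.1 hin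
    obtain ⟨A', rfl, ha⟩ := inputs_singleton.1 h2
    obtain ⟨rfl, rfl⟩ : A = A' ∧ Γ = Γ₁ := by simpa using hΓ
    have hp : PTree.par a b ∈ ρ.occ := hocc _ (by simp [PTree.self_mem_subtrees])
    obtain ⟨t, h1, h2, h3, h4, h5⟩ := (ih hd).2 h' (fun t ht => hocc t (by
        simp only [occ_append, occ_cons, occ_nil, PTree.subtrees, List.mem_append,
          List.mem_cons] at ht ⊢
        tauto)) (fun y hy => by
        rcases List.mem_append.1 hy with hy | hy
        · exact hst y hy
        · obtain rfl : y = a := by simpa using hy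
          -- The input `a` is a conclusion of the part only; in `ρ` it is a premise of this par
          -- link, where descents stop as well.
          exact .inr ⟨b, .inl hp⟩)
    refine ⟨.lamL a A t, .par_left ha h1, .lamL ?_ (by simpa using h2), h3, by simp [LTerm.toND, h4],
      fun v hv => ?_⟩
    · intro h0
      have := congrArg List.length h0
      rw [List.length_zip, List.length_reverse, hL.length_eq, min_self] at this
      exact hne (List.eq_nil_of_length_eq_zero this)
    · have := h5 v hv
      simp only [occ_append, occ_cons, occ_nil, PTree.subtrees, List.mem_append,
          List.mem_cons] at this ⊢
      tauto
  | introR d ih =>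
    intro Γ C hd
    cases hd with | @introR _ A B _ hne hd => ?_
    refine ⟨fun h => (nomatch h), fun {L o} h hocc hst => ?_⟩
    generalize hπ : L ++ [o] = π at h
    cases h with
    | branch B i hb => exact nomatch hb
    | @introR _ L' a b h => ?_
    obtain ⟨rfl, ho⟩ := List.append_inj' hπ rfl
    obtain rfl : o = _ := by simpa using ho
    have h' : Translates d ((a :: L) ++ [b]) := by simpa using h
    obtain ⟨hin, -⟩ := h'.typed hd
    obtain ⟨A', Γ', hΓ, ha, hL⟩ := inputs_cons.1 hin
    obtain ⟨rfl, h3⟩ := List.append_inj' hΓ rfl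
    obtain rfl : A = A' := by simpa using h3
    have hp : PTree.par b a ∈ ρ.occ := hocc _ (by simp [PTree.self_mem_subtrees])
    obtain ⟨t, h1, h2, h3, h4, h5⟩ := (ih hd).2 h' (fun t ht => hocc t (by
        simp only [List.cons_append, occ_append, occ_cons, occ_nil, PTree.subtrees, List.mem_append,
          List.mem_cons] at ht ⊢
        tauto)) (fun y hy => by
        rcases List.mem_cons.1 hy with rfl | hy
        · exact .inr ⟨b, .inr hp⟩
        · exact hst y hy)
    refine ⟨.lamR a A t, .par_right ha h1, .lamR ?_ ?_, h3, by simp [LTerm.toND, h4],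
      fun v hv => ?_⟩
    · intro h0
      have := congrArg List.length h0
      rw [List.length_zip, List.length_reverse, hL.length_eq, min_self] at this
      exact hne (List.eq_nil_of_length_eq_zero this)
    · rw [List.reverse_cons, List.zip_append (by simpa using hL.length_eq)] at h2
      simpa using h2
    · have := h5 v hv
      simp only [List.cons_append, occ_append, occ_cons, occ_nil, PTree.subtrees, List.mem_append,
          List.mem_cons] at this ⊢
      tauto
  | elimL arg fn iha ihf =>
    intro Γ C hd
    have hd0 := hd
    cases hd with | @elimL _ _ A _ Δ Γ da df => ?_
    have key : ∀ {L R M : Struct V} {x : PTree V},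
        AlongBranch (.elimL arg fn) L x R (L ++ (M ++ R)) →
        (∀ t ∈ M.occ, t ∈ ρ.occ) → (∀ y ∈ M, ρ.Stops y) →
        ∃ t, Descends ρ x t ∧ t.HasType (M.reverse.zip (Δ ++ Γ)) C ∧ t.vars.Nodup ∧
        t.toND = .elimL arg fn ∧
        ∀ v ∈ t.vars, v ∈ M.occ ∧
          (x ∈ v.subtrees ∨ v.idx.Disjoint (indices (L ++ x :: R))) := by
      intro L R M x h hocc hst
      generalize hπ : L ++ (M ++ R) = π at h
      cases h with | @elimL _ _ _ _ D _ _ g ha hdis hf => ?_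
      obtain ⟨-, M', he, hM', hx⟩ := hf.typed df
      obtain rfl : M = M' ++ D := by
        have : L ++ (M ++ R) = L ++ ((M' ++ D) ++ R) := by rw [hπ, he]; simp
        exact List.append_cancel_right (List.append_cancel_left this)
      have hD := (ha.typed da).1
      have hq : PTree.tens x g ∈ ρ.occ := hocc _ (by simp [hx])
      obtain ⟨u, u1, u2, u3, u4, u5⟩ := (iha da).2 ha (fun t ht => by
          rw [occ_append, List.mem_append] at ht
          rcases ht with ht | ht
          · exact hocc t (by simp [ht])
          · simp only [occ_cons, occ_nil, List.append_nil] at ht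
            exact mem_occ_of_subtree ht (mem_occ_of_premise (.tens_right _ _) hq))
        (fun y hy => hst y (by simp [hy]))
      obtain ⟨t, t1, t2, t3, t4, t5⟩ := (ihf df).1 (M := M') (he ▸ hf)
        (fun t ht => hocc t (by simp [ht])) (fun y hy => hst y (by simp [hy]))
      have hxq : x ∈ (PTree.tens x g).subtrees := (PTree.IsPremise.tens_left _ _).mem_subtrees
      refine ⟨.appL u t, .tens_left hq u1 t1, ?_, ?_, by simp [LTerm.toND, u4, t4], ?_⟩
      · rw [List.reverse_append, List.zip_append (by simpa using hD.length_eq)]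
        exact .appL u2 t2
      · rw [LTerm.vars, List.nodup_append]
        refine ⟨u3, t3, fun v hv w hw hvw => ?_⟩
        subst hvw
        refine not_disjoint_of_grown hdis (idx_subset_of_mem_occ (u5 v hv))
          ((t5 v hw).2.imp (PTree.subtrees_trans hxq) fun h i hi hi' =>
          h hi (indices_subset_tens_left.1 hi'))
      · intro v hv
        rw [LTerm.vars, List.mem_append] at hv
        rcases hv with hv | hv
        · have h6 := u5 v hv
          refine ⟨?_, .inr fun i hi hi' => hdis (idx_subset_of_mem_occ h6 hi) hi'⟩
          rw [occ_append, List.mem_append] at h6 ⊢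
          rcases h6 with h6 | h6
          · exact .inr h6
          · simp only [occ_cons, occ_nil, List.append_nil] at h6
            exact .inl (mem_occ_of_subtree h6 (mem_occ_of_premise (.tens_right _ _) hx))
        · obtain ⟨h6, h7⟩ := t5 v hv
          refine ⟨by simp [h6], h7.imp (PTree.subtrees_trans hxq) fun h i hi hi' =>
            h hi (indices_subset_tens_left.2 hi')⟩
    refine ⟨key, fun h => ?_⟩
    cases h with | branch B i hb => exact of_branch hd0 key hb
  | elimR fn arg ihf iha =>
    intro Γ C hd
    have hd0 := hd
    cases hd with | @elimR _ _ A _ Γ Δ df da => ?_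
    have key : ∀ {L R M : Struct V} {x : PTree V},
        AlongBranch (.elimR fn arg) L x R (L ++ (M ++ R)) →
        (∀ t ∈ M.occ, t ∈ ρ.occ) → (∀ y ∈ M, ρ.Stops y) →
        ∃ t, Descends ρ x t ∧ t.HasType (M.reverse.zip (Γ ++ Δ)) C ∧ t.vars.Nodup ∧
        t.toND = .elimR fn arg ∧
        ∀ v ∈ t.vars, v ∈ M.occ ∧
          (x ∈ v.subtrees ∨ v.idx.Disjoint (indices (L ++ x :: R))) := by
      intro L R M x h hocc hst
      generalize hπ : L ++ (M ++ R) = π at h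
      cases h with | @elimR _ _ _ _ D _ _ g ha hdis hf => ?_
      obtain ⟨-, M', he, hM', hx⟩ := hf.typed df
      obtain rfl : M = D ++ M' := by
        have : L ++ (M ++ R) = L ++ ((D ++ M') ++ R) := by rw [hπ, he]; simp
        exact List.append_cancel_right (List.append_cancel_left this)
      have hq : PTree.tens g x ∈ ρ.occ := hocc _ (by simp [hx])
      obtain ⟨u, u1, u2, u3, u4, u5⟩ := (iha da).2 ha (fun t ht => by
          rw [occ_append, List.mem_append] at ht
          rcases ht with ht | ht
          · exact hocc t (by simp [ht])
          · simp only [occ_cons, occ_nil, List.append_nil] at ht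
            exact mem_occ_of_subtree ht (mem_occ_of_premise (.tens_left _ _) hq))
        (fun y hy => hst y (by simp [hy]))
      obtain ⟨t, t1, t2, t3, t4, t5⟩ := (ihf df).1 (M := M') (he ▸ hf)
        (fun t ht => hocc t (by simp [ht])) (fun y hy => hst y (by simp [hy]))
      have hxq : x ∈ (PTree.tens g x).subtrees := (PTree.IsPremise.tens_right _ _).mem_subtrees
      refine ⟨.appR t u, .tens_right hq u1 t1, ?_, ?_, by simp [LTerm.toND, u4, t4], ?_⟩
      · rw [List.reverse_append, List.zip_append (by simpa using hM'.length_eq)]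
        exact .appR t2 u2
      · rw [LTerm.vars, List.nodup_append]
        refine ⟨t3, u3, fun v hw w hv hvw => ?_⟩
        subst hvw
        refine not_disjoint_of_grown hdis (idx_subset_of_mem_occ (u5 v hv))
          ((t5 v hw).2.imp (PTree.subtrees_trans hxq) fun h i hi hi' =>
          h hi (indices_subset_tens_right.1 hi'))
      · intro v hv
        rw [LTerm.vars, List.mem_append, @or_comm (v ∈ t.vars)] at hv
        rcases hv with hv | hv
        · have h6 := u5 v hv
          refine ⟨?_, .inr fun i hi hi' => hdis (idx_subset_of_mem_occ h6 hi) hi'⟩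
          rw [occ_append, List.mem_append] at h6 ⊢
          rcases h6 with h6 | h6
          · exact .inl h6
          · simp only [occ_cons, occ_nil, List.append_nil] at h6
            exact .inr (mem_occ_of_subtree h6 (mem_occ_of_premise (.tens_left _ _) hx))
        · obtain ⟨h6, h7⟩ := t5 v hv
          refine ⟨by simp [h6], h7.imp (PTree.subtrees_trans hxq) fun h i hi hi' =>
            h hi (indices_subset_tens_right.2 hi')⟩
    refine ⟨key, fun h => ?_⟩
    cases h with | branch B i hb => exact of_branch hd0 key hb

theorem Translates.exists_reads {d : NDTree (Cat V)} {Γ : List (Cat V)} {C : Cat V} {π : Struct V}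
    (h : Translates d π) (hd : Derives d Γ C) :
    ∃ t, Reads π t ∧ t.HasType (π.dropLast.reverse.zip Γ) C ∧ t.vars.Nodup ∧ t.toND = d := by
  obtain ⟨L, o, rfl⟩ := h.exists_concat hd
  obtain ⟨t, h1, h2, h3, h4, -⟩ := (reads_of_translates (L ++ [o]) hd).2 h (fun t ht => ht)
    fun y hy => .inl (by simp [hy])
  exact ⟨t, ⟨L, o, rfl, h1⟩, by simpa using h2, h3, h4⟩

theorem Climbs.isOutput {π : Struct V} {t : LTerm (PTree V) V} :
    ∀ {o : PTree V}, Climbs π o t → o.formula.IsOutput := by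
  induction t with
  | lamL x A t ih =>
    intro o h
    cases h with
    | par_left ha h => exact LF.isOutput_par.2 (.inl ⟨by rw [ha]; simp, ih h⟩)
    | ax => simp [PTree.formula]
  | lamR x A t ih =>
    intro o h
    cases h with
    | par_right ha h => exact LF.isOutput_par.2 (.inr ⟨ih h, by rw [ha]; simp⟩)
    | ax => simp [PTree.formula]
  | _ =>
    intro o h
    cases h with | ax => simp [PTree.formula]

/-- An occurrence is a premise of at most one link, so a descent never has the choice between
stopping and applying. -/
theorem not_isPremise_of_stops {π : Struct V} (hn : π.leaves.Nodup) {x a b : PTree V}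
    (h : x ∈ π ∨ ∃ b : PTree V, .par x b ∈ π.occ ∨ .par b x ∈ π.occ) (hq : .tens a b ∈ π.occ) :
    ¬ x.IsPremise (.tens a b) := by
  intro hx
  rcases h with h | ⟨c, h | h⟩
  · exact not_root_of_premise hn hq hx h
  · have := premise_unique hn h hq (.par_left _ _) hx
    cases this
  · have := premise_unique hn h hq (.par_right _ _) hx
    cases this

/-- Excludes the other ambiguity of a descent, an occurrence that is both premises of its link. -/
theorem not_mem_occ_tens_self {π : Struct V} (hn : π.leaves.Nodup) {a : PTree V} :
    .tens a a ∉ π.occ := by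
  intro h
  have h1 := (leaves_sublist_of_mem_occ h).nodup hn
  obtain ⟨x, hx⟩ := List.exists_mem_of_ne_nil _ a.leaves_ne_nil
  simp only [PTree.leaves, List.nodup_append] at h1
  exact h1.2.2 x hx x hx rfl

/-- The climbing algorithm is deterministic. -/
theorem climbs_unique {π : Struct V} (hn : π.leaves.Nodup) (t : LTerm (PTree V) V) :
    (∀ x t', Descends π x t → Descends π x t' → t = t') ∧
    (∀ o t', Climbs π o t → Climbs π o t' → t = t') := by
  have of_ax : ∀ {t : LTerm (PTree V) V}, (∀ x t', Descends π x t → Descends π x t' → t = t') →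
      ∀ (C : Cat V) (i : ℕ) (t' : LTerm (PTree V) V), Descends π (.leaf C.neg i) t →
        Climbs π (.leaf C.pos i) t' → t = t' := by
    intro t h C i t' h1 h2
    generalize ho : PTree.leaf C.pos i = o at h2
    cases h2 with
    | @ax C' i' _ hm h2 =>
      simp only [PTree.leaf.injEq] at ho
      obtain ⟨ho, rfl⟩ := ho
      obtain rfl := Cat.pos_injective ho
      exact h _ _ h1 h2
    | _ => cases ho
  have par_aux : ∀ {a b : PTree V} {A : Cat V} {t : LTerm (PTree V) V}, a.formula = A.neg →
      Climbs π a t → False := fun ha h => by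
    have := h.isOutput
    rw [ha] at this
    simp at this
  induction t with
  | var y B =>
    have key : ∀ x t', Descends π x (.var y B) → Descends π x t' → LTerm.var y B = t' := by
      intro x t' h h'
      cases h with | head hx hB => ?_
      cases h' with
      | head _ hB' => rw [Cat.neg_injective (hB.symm.trans hB')]
      | tens_left hq _ _ => exact absurd (.tens_left _ _) (not_isPremise_of_stops hn hx hq)
      | tens_right hq _ _ => exact absurd (.tens_right _ _) (not_isPremise_of_stops hn hx hq)
    refine ⟨key, fun o t' h h' => ?_⟩
    cases h with | ax hm h => exact of_ax key _ _ _ h h'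
  | lamL y B t ih =>
    have key : ∀ x t', Descends π x (.lamL y B t) → Descends π x t' → LTerm.lamL y B t = t' :=
      fun x t' h => nomatch h
    refine ⟨key, fun o t' h h' => ?_⟩
    cases h with
    | ax hm h => exact nomatch h
    | par_left ha h =>
      cases h' with
      | par_left ha' h' => rw [Cat.neg_injective (ha.symm.trans ha'), ih.2 _ _ h h']
      | par_right ha' h' => exact (par_aux (b := y) ha h').elim
  | lamR y B t ih =>
    have key : ∀ x t', Descends π x (.lamR y B t) → Descends π x t' → LTerm.lamR y B t = t' :=
      fun x t' h => nomatch h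
    refine ⟨key, fun o t' h h' => ?_⟩
    cases h with
    | ax hm h => exact nomatch h
    | par_right ha h =>
      cases h' with
      | par_right ha' h' => rw [Cat.neg_injective (ha.symm.trans ha'), ih.2 _ _ h h']
      | par_left ha' h' => exact (par_aux (b := y) ha h').elim
  | appL u t ihu iht =>
    have key : ∀ x t', Descends π x (.appL u t) → Descends π x t' → LTerm.appL u t = t' := by
      intro x t' h h'
      cases h with | @tens_left _ g _ _ hq hu ht => ?_
      cases h' with
      | head hx hB' => exact absurd (.tens_left _ _) (not_isPremise_of_stops hn hx hq)
      | tens_left hq' hu' ht' =>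
        have := premise_unique hn hq hq' (.tens_left _ _) (.tens_left _ _)
        simp only [PTree.tens.injEq, true_and] at this
        subst this
        rw [ihu.2 _ _ hu hu', iht.1 _ _ ht ht']
      | tens_right hq' hu' ht' =>
        have := premise_unique hn hq hq' (.tens_left _ _) (.tens_right _ _)
        simp only [PTree.tens.injEq] at this
        obtain ⟨rfl, rfl⟩ := this
        exact absurd hq (not_mem_occ_tens_self hn)
    refine ⟨key, fun o t' h h' => ?_⟩
    cases h with | ax hm h => exact of_ax key _ _ _ h h'
  | appR t u iht ihu =>
    have key : ∀ x t', Descends π x (.appR t u) → Descends π x t' → LTerm.appR t u = t' := by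
      intro x t' h h'
      cases h with | @tens_right _ g _ _ hq hu ht => ?_
      cases h' with
      | head hx hB' => exact absurd (.tens_right _ _) (not_isPremise_of_stops hn hx hq)
      | tens_right hq' hu' ht' =>
        have := premise_unique hn hq hq' (.tens_right _ _) (.tens_right _ _)
        simp only [PTree.tens.injEq, and_true] at this
        subst this
        rw [ihu.2 _ _ hu hu', iht.1 _ _ ht ht']
      | tens_left hq' hu' ht' =>
        have := premise_unique hn hq hq' (.tens_right _ _) (.tens_left _ _)
        simp only [PTree.tens.injEq] at this
        obtain ⟨rfl, rfl⟩ := this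
        exact absurd hq (not_mem_occ_tens_self hn)
    refine ⟨key, fun o t' h h' => ?_⟩
    cases h with | ax hm h => exact of_ax key _ _ _ h h'

theorem Reads.unique {π : Struct V} (hn : π.leaves.Nodup) {t t' : LTerm (PTree V) V}
    (h : Reads π t) (h' : Reads π t') : t = t' := by
  obtain ⟨L, o, rfl, h⟩ := h
  obtain ⟨L', o', he, h'⟩ := h'
  obtain ⟨rfl, ho⟩ := List.append_inj' he rfl
  obtain rfl : o = o' := by simpa using ho
  exact (climbs_unique hn t).2 o t' h h'

/-! ### The bijection between normal deductions and proof nets -/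

/-- A net is the translation of at most one deduction. -/
theorem Translates.injective {d d' : NDTree (Cat V)} {Γ Γ' : List (Cat V)} {C C' : Cat V}
    {π : Struct V} (h : Translates d π) (hd : Derives d Γ C) (h' : Translates d' π)
    (hd' : Derives d' Γ' C') : d = d' := by
  obtain ⟨t, h1, -, -, rfl⟩ := h.exists_reads hd
  obtain ⟨t', h1', -, -, rfl⟩ := h'.exists_reads hd'
  rw [h1.unique (h.isNetOf hd).1.linked.nodup h1']

/-- The map is a chosen translation, well defined by uniqueness up to names. It is injective since a
net reads as a single term, from which each deduction it translates is recovered, and surjective by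
sequentialisation. -/
theorem exists_equiv (Γ : List (Cat V)) (C : Cat V) :
    ∃ e : NormalDeduction Γ C ≃ ProofNet Γ C,
      (∀ (d : NormalDeduction Γ C) (π : Struct V),
        Translates d.1 π ↔ ∃ h : π.IsNetOf Γ C, e d = ProofNet.mk π h) ∧
      (∀ (π : Struct V) (h : π.IsNetOf Γ C),
        (∃! t : LTerm (PTree V) V, Reads π t) ∧
        ∀ t : LTerm (PTree V) V, Reads π t →
          t.HasType (π.dropLast.reverse.zip Γ) C ∧ t.vars.Nodup ∧
          t.toND = (e.symm (ProofNet.mk π h)).1) := by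
  choose tr htr using fun d : NormalDeduction Γ C => (translation_exists d.2.1 d.2.2).2
  let f : NormalDeduction Γ C → ProofNet Γ C := fun d => ProofNet.mk (tr d) ((htr d).isNetOf d.2.1)
  have hf : ∀ d π, Translates d.1 π ↔ ∃ h : π.IsNetOf Γ C, f d = ProofNet.mk π h := by
    intro d π
    constructor
    · intro h
      refine ⟨h.isNetOf d.2.1, Quotient.sound ?_⟩
      exact (htr d).unique h (((htr d).isNetOf d.2.1).2.trans (h.isNetOf d.2.1).2.symm)
    · rintro ⟨h, he⟩
      exact (htr d).same (Quotient.exact he)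
  have hinj : Function.Injective f := by
    intro d d' h
    have h1 := (hf d _).2 ⟨_, h⟩
    exact Subtype.ext (h1.injective d.2.1 (htr d') d'.2.1)
  have hsurj : Function.Surjective f := by
    intro q
    induction q using Quotient.inductionOn with | h x => ?_
    obtain ⟨π, h⟩ := x
    obtain ⟨d, h1, h2, h3⟩ := exists_deduction _ π rfl h.1 Γ C h.2
    obtain ⟨h', he⟩ := (hf ⟨d, h1, h2⟩ π).1 h3
    exact ⟨_, he⟩
  refine ⟨Equiv.ofBijective f ⟨hinj, hsurj⟩, hf, fun π h => ?_⟩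
  generalize hd : (Equiv.ofBijective f ⟨hinj, hsurj⟩).symm (ProofNet.mk π h) = d
  have h1 : Translates d.1 π := (hf d π).2 ⟨h, by
    rw [← hd]; exact (Equiv.ofBijective f ⟨hinj, hsurj⟩).apply_symm_apply _⟩
  obtain ⟨t, t1, t2, t3, t4⟩ := h1.exists_reads d.2.1
  have huniq : ∀ t', Reads π t' → t' = t := fun t' ht' => ht'.unique h.1.linked.nodup t1
  exact ⟨⟨t, t1, huniq⟩, fun t' ht' => by rw [huniq t' ht']; exact ⟨t2, t3, t4⟩⟩

end Lambek


namespace Lambek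

universe u v w

variable {V : Type u} {V' : Type w}

/-! ### Substitution -/

/-- Substitution of categories for base categories. -/
def Cat.subst (θ : Base V → Cat V') : Cat V → Cat V'
  | .base b => θ b
  | .under A B => .under (A.subst θ) (B.subst θ)
  | .over B A => .over (B.subst θ) (A.subst θ)

/-- Replacement of the labels of the hypotheses. -/
def NDTree.map {α : Type u} {β : Type w} (f : α → β) : NDTree α → NDTree β
  | .hyp a => .hyp (f a)
  | .introL d => .introL (d.map f)
  | .introR d => .introR (d.map f)
  | .elimL d e => .elimL (d.map f) (e.map f)
  | .elimR d e => .elimR (d.map f) (e.map f)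

@[simp] theorem NDTree.erase_map {α : Type u} {β : Type w} (f : α → β) (d : NDTree α) :
    (d.map f).erase = d.erase := by
  induction d <;> simp_all [NDTree.map, NDTree.erase]

theorem NDTree.isIntro_erase {α : Type u} (d : NDTree α) : d.erase.IsIntro ↔ d.IsIntro := by
  cases d <;> simp [NDTree.erase, NDTree.IsIntro]

theorem NDTree.normal_erase {α : Type u} (d : NDTree α) : d.erase.Normal ↔ d.Normal := by
  induction d <;> simp_all [NDTree.erase, NDTree.Normal, NDTree.isIntro_erase]

theorem NDTree.normal_congr {α : Type u} {β : Type w} {d : NDTree α} {e : NDTree β}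
    (h : d.erase = e.erase) : d.Normal ↔ e.Normal := by
  rw [← d.normal_erase, ← e.normal_erase, h]

theorem Derives.subst {d : NDTree (Cat V)} {Γ : List (Cat V)} {C : Cat V} (h : Derives d Γ C)
    (θ : Base V → Cat V') :
    Derives (d.map (Cat.subst θ)) (Γ.map (Cat.subst θ)) (C.subst θ) := by
  induction h with
  | hyp A => exact .hyp _
  | introL hne _ ih => exact .introL (by simpa using hne) ih
  | introR hne _ ih => exact .introR (by simpa using hne) (by simpa using ih)
  | elimL _ _ ih1 ih2 => rw [List.map_append]; exact .elimL ih1 ih2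
  | elimR _ _ ih1 ih2 => rw [List.map_append]; exact .elimR ih1 ih2

/-! ### Frames of nets -/

open Struct

/-- The frame can be computed from the skeleton, so copies have the same frame up to names. -/
theorem PTree.eraseExcept_skeleton (m : ℕ) (t : PTree V) :
    t.skeleton.eraseExcept m = t.eraseExcept m := by
  induction t with
  | leaf F i =>
    by_cases h : F.IsOutput
    · simp [PTree.skeleton, PTree.eraseExcept, h]
    · have h' : ¬ (LF.coatom baseO).IsOutput := (LF.IsInput.coatom _).not_isOutput
      simp [PTree.skeleton, PTree.eraseExcept, h, h']
  | tens a b iha ihb => simp [PTree.skeleton, PTree.eraseExcept, iha, ihb]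
  | par a b iha ihb => simp [PTree.skeleton, PTree.eraseExcept, iha, ihb]

theorem PTree.eraseExcept_reindex {f : ℕ → ℕ} (hf : Function.Injective f) (m : ℕ) (t : PTree V) :
    (t.reindex f).eraseExcept (f m) = (t.eraseExcept m).reindex f := by
  induction t with
  | leaf F i => simp [PTree.reindex, PTree.eraseExcept, hf.eq_iff]
  | tens a b iha ihb => simp [PTree.reindex, PTree.eraseExcept, iha, ihb]
  | par a b iha ihb => simp [PTree.reindex, PTree.eraseExcept, iha, ihb]

theorem PTree.isOutput_eraseExcept (m : ℕ) (t : PTree V) :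
    (t.formula.IsOutput → (t.eraseExcept m).formula.IsOutput) ∧
      (t.formula.IsInput → (t.eraseExcept m).formula.IsInput) := by
  induction t with
  | leaf F i =>
    refine ⟨fun h => ?_, fun h => ?_⟩
    · simp only [PTree.formula] at h
      simp [PTree.eraseExcept, PTree.formula, h]
    · simp only [PTree.formula] at h
      simp [PTree.eraseExcept, PTree.formula, h.not_isOutput]
  | tens a b iha ihb =>
    simp only [PTree.eraseExcept, PTree.formula]
    refine ⟨fun h => by simp at h, fun h => ?_⟩
    rw [LF.isInput_tens] at h ⊢
    exact h.imp (And.imp iha.1 ihb.2) (And.imp iha.2 ihb.1)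
  | par a b iha ihb =>
    simp only [PTree.eraseExcept, PTree.formula]
    refine ⟨fun h => ?_, fun h => by simp at h⟩
    rw [LF.isOutput_par] at h ⊢
    exact h.imp (And.imp iha.2 ihb.1) (And.imp iha.1 ihb.2)

@[simp] theorem PTree.idx_eraseExcept (m : ℕ) (t : PTree V) : (t.eraseExcept m).idx = t.idx := by
  induction t <;> simp_all [PTree.eraseExcept]

@[simp] theorem Struct.indices_eraseExcept (m : ℕ) (π : Struct V) :
    Struct.indices (π.map (PTree.eraseExcept m)) = π.indices := by
  induction π <;> simp_all [indices_cons]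

@[simp] theorem Struct.mainIndex_concat (L : Struct V) (F : LF V) (i : ℕ) :
    Struct.mainIndex (L ++ [.leaf F i]) = i := by
  simp [Struct.mainIndex]

theorem Struct.Copies.frame_eq {f : ℕ → ℕ} (hf : Function.Injective f) {L : Struct V}
    {L' : Struct V'} {F : LF V} {F' : LF V'} {i i' : ℕ}
    (h : Copies f (L ++ [.leaf F i]) (L' ++ [.leaf F' i'])) :
    Struct.frame (L' ++ [.leaf F' i']) =
      (Struct.frame (L ++ [.leaf F i])).map (PTree.reindex f) := by
  obtain ⟨h1, -⟩ := copies_concat.1 h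
  obtain rfl : i' = f i := by
    simp only [PTree.skeleton, PTree.reindex, PTree.leaf.injEq] at h1
    exact h1.2
  simp only [Struct.frame, mainIndex_concat]
  have h2 := congrArg (List.map (PTree.eraseExcept (f i))) h
  simp only [List.map_map] at h2
  have e1 : PTree.eraseExcept (f i) ∘ PTree.skeleton = PTree.eraseExcept (V := V') (f i) :=
    funext fun t => PTree.eraseExcept_skeleton _ _
  have e2 : PTree.eraseExcept (f i) ∘ PTree.reindex f ∘ PTree.skeleton =
      PTree.reindex f ∘ PTree.eraseExcept (V := V) i :=
    funext fun t => by
      simp only [Function.comp, PTree.eraseExcept_reindex hf, PTree.eraseExcept_skeleton]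
  rw [e1, e2] at h2
  rw [h2, List.map_map]

/-- The new categories are read off from the erased conclusions. They do not come from a
substitution: a leaf with a complex formula becomes a symbol, and occurrences of one base category
may receive different symbols. -/
theorem translates_eraseExcept (m : ℕ) {d : NDTree (Cat V)} :
    ∀ {Γ : List (Cat V)} {C : Cat V}, Derives d Γ C →
    (∀ {L R π : Struct V} {x : PTree V}, AlongBranch d L x R π →
      ∃ (d' : NDTree (Cat Unit)) (Γ' : List (Cat Unit)) (C' : Cat Unit), d'.erase = d.erase ∧
        Derives d' Γ' C' ∧ AlongBranch d' (L.map (PTree.eraseExcept m)) (x.eraseExcept m)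
          (R.map (PTree.eraseExcept m)) (π.map (PTree.eraseExcept m))) ∧
    (∀ {π : Struct V}, Translates d π →
      ∃ (d' : NDTree (Cat Unit)) (Γ' : List (Cat Unit)) (C' : Cat Unit), d'.erase = d.erase ∧
        Derives d' Γ' C' ∧ Translates d' (π.map (PTree.eraseExcept m))) := by
  have of_branch : ∀ {d : NDTree (Cat V)} {B : Cat V} {i : ℕ} {π : Struct V},
      (∀ {L R π : Struct V} {x : PTree V}, AlongBranch d L x R π →
        ∃ (d' : NDTree (Cat Unit)) (Γ' : List (Cat Unit)) (C' : Cat Unit), d'.erase = d.erase ∧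
          Derives d' Γ' C' ∧ AlongBranch d' (L.map (PTree.eraseExcept m)) (x.eraseExcept m)
            (R.map (PTree.eraseExcept m)) (π.map (PTree.eraseExcept m))) →
      AlongBranch d [] (.leaf B.neg i) [.leaf B.pos i] π →
      ∃ (d' : NDTree (Cat Unit)) (Γ' : List (Cat Unit)) (C' : Cat Unit), d'.erase = d.erase ∧
        Derives d' Γ' C' ∧ Translates d' (π.map (PTree.eraseExcept m)) := by
    intro d B i π h hb
    obtain ⟨d', Γ', C', h1, h2, h3⟩ := h hb
    refine ⟨d', Γ', C', h1, h2, .branch (.base (if i = m then .s else baseO)) i ?_⟩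
    simpa [PTree.eraseExcept, Cat.neg, Cat.pos] using h3
  induction d with
  | hyp A =>
    intro Γ C hd
    cases hd
    have key : ∀ {L R π : Struct V} {x : PTree V}, AlongBranch (.hyp A) L x R π →
        ∃ (d' : NDTree (Cat Unit)) (Γ' : List (Cat Unit)) (C' : Cat Unit),
          d'.erase = (NDTree.hyp A).erase ∧
          Derives d' Γ' C' ∧ AlongBranch d' (L.map (PTree.eraseExcept m)) (x.eraseExcept m)
            (R.map (PTree.eraseExcept m)) (π.map (PTree.eraseExcept m)) := by
      intro L R π x h
      cases h with | hyp hx => ?_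
      obtain ⟨A', hA'⟩ := ((x.isOutput_eraseExcept m).2 (by rw [hx]; simp)).exists_neg
      refine ⟨.hyp A', [A'], A', rfl, .hyp A', ?_⟩
      rw [List.map_append, List.map_cons]
      exact .hyp hA'
    refine ⟨key, fun h => ?_⟩
    cases h with | branch B i hb => exact of_branch key hb
  | introL d ih =>
    intro Γ C hd
    cases hd with | @introL _ A B _ hne hd => ?_
    refine ⟨fun h => (nomatch h), fun h => ?_⟩
    cases h with
    | branch B i hb => exact nomatch hb
    | @introL _ L a b h => ?_
    have hL : (L ++ [a]).length = Γ.length + 1 := by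
      have h' : Translates d ((L ++ [a]) ++ [b]) := by simpa using h
      simpa using (h'.typed hd).1.length_eq
    obtain ⟨d', Γ', C', h1, h2, h3⟩ := (ih hd).2 h
    have h4 : Translates d' ((L.map (PTree.eraseExcept m) ++ [a.eraseExcept m]) ++
      [b.eraseExcept m]) := by simpa using h3
    have hlen := (h4.typed h2).1.length_eq
    obtain ⟨Γ₁, Γ₂, rfl, h5, h6⟩ := inputs_append.1 (h4.typed h2).1
    obtain ⟨A', rfl, -⟩ := inputs_singleton.1 h6
    refine ⟨.introL d', Γ₁, .under A' C', by simp [NDTree.erase, h1], .introL ?_ h2, ?_⟩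
    -- Erasure keeps the number of conclusions, so the antecedent is again nonempty.
    · rintro rfl
      simp only [List.length_append, List.length_map, List.length_cons, List.length_nil] at hlen hL
      exact hne (List.eq_nil_of_length_eq_zero (by omega))
    · rw [List.map_append]
      exact .introL (by simpa using h3)
  | introR d ih =>
    intro Γ C hd
    cases hd with | @introR _ A B _ hne hd => ?_
    refine ⟨fun h => (nomatch h), fun h => ?_⟩
    cases h with
    | branch B i hb => exact nomatch hb
    | @introR _ L a b h => ?_
    have hL : (a :: L).length = Γ.length + 1 := by
      have h' : Translates d ((a :: L) ++ [b]) := by simpa using h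
      simpa using (h'.typed hd).1.length_eq
    obtain ⟨d', Γ', C', h1, h2, h3⟩ := (ih hd).2 h
    have h4 : Translates d' ((a.eraseExcept m :: L.map (PTree.eraseExcept m)) ++
      [b.eraseExcept m]) := by simpa using h3
    have hlen := (h4.typed h2).1.length_eq
    obtain ⟨A', Γ₁, rfl, h5, h6⟩ := inputs_cons.1 (h4.typed h2).1
    refine ⟨.introR d', Γ₁, .over C' A', by simp [NDTree.erase, h1], .introR ?_ h2, ?_⟩
    · rintro rfl
      simp only [List.length_append, List.length_map, List.length_cons, List.length_nil] at hlen hL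
      exact hne (List.eq_nil_of_length_eq_zero (by omega))
    · rw [List.map_append]
      exact .introR (by simpa using h3)
  | elimL arg fn iha ihf =>
    intro Γ C hd
    cases hd with | @elimL _ _ A _ Δ Γ da df => ?_
    have key : ∀ {L R π : Struct V} {x : PTree V}, AlongBranch (.elimL arg fn) L x R π →
        ∃ (d' : NDTree (Cat Unit)) (Γ' : List (Cat Unit)) (C' : Cat Unit),
          d'.erase = (NDTree.elimL arg fn).erase ∧
          Derives d' Γ' C' ∧ AlongBranch d' (L.map (PTree.eraseExcept m)) (x.eraseExcept m)
            (R.map (PTree.eraseExcept m)) (π.map (PTree.eraseExcept m)) := by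
      intro L R π x h
      cases h with | @elimL _ _ _ _ D _ _ g ha hdis hf => ?_
      have hx : x.formula = C.neg := by
        have := (hf.typed df).1
        simp only [PTree.formula, Cat.neg, LF.tens.injEq] at this
        exact this.1
      obtain ⟨ea, Γa, Ca, a1, a2, a3⟩ := (iha da).2 ha
      obtain ⟨ef, Γf, Cf, f1, f2, f3⟩ := (ihf df).1 hf
      rw [List.map_append] at a3 f3
      obtain ⟨P, Q, rfl, hQ, hP⟩ := Cat.neg_eq_tens_left (f3.typed f2).1
        ((x.isOutput_eraseExcept m).2 (by rw [hx]; simp))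
      obtain rfl : P = Ca := Cat.pos_injective (hP.symm.trans (a3.typed a2).2)
      refine ⟨.elimL ea ef, _, Q, by simp [NDTree.erase, a1, f1], .elimL a2 f2, .elimL a3 ?_ f3⟩
      have := (indices_eraseExcept m (D ++ [g])).symm ▸
        (indices_eraseExcept m (L ++ x :: R)).symm ▸ hdis
      simpa using this
    refine ⟨key, fun h => ?_⟩
    cases h with | branch B i hb => exact of_branch key hb
  | elimR fn arg ihf iha =>
    intro Γ C hd
    cases hd with | @elimR _ _ A _ Γ Δ df da => ?_
    have key : ∀ {L R π : Struct V} {x : PTree V}, AlongBranch (.elimR fn arg) L x R π →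
        ∃ (d' : NDTree (Cat Unit)) (Γ' : List (Cat Unit)) (C' : Cat Unit),
          d'.erase = (NDTree.elimR fn arg).erase ∧
          Derives d' Γ' C' ∧ AlongBranch d' (L.map (PTree.eraseExcept m)) (x.eraseExcept m)
            (R.map (PTree.eraseExcept m)) (π.map (PTree.eraseExcept m)) := by
      intro L R π x h
      cases h with | @elimR _ _ _ _ D _ _ g ha hdis hf => ?_
      have hx : x.formula = C.neg := by
        have := (hf.typed df).1
        simp only [PTree.formula, Cat.neg, LF.tens.injEq] at this
        exact this.2
      obtain ⟨ea, Γa, Ca, a1, a2, a3⟩ := (iha da).2 ha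
      obtain ⟨ef, Γf, Cf, f1, f2, f3⟩ := (ihf df).1 hf
      rw [List.map_append] at a3 f3
      obtain ⟨P, Q, rfl, hP, hQ⟩ := Cat.neg_eq_tens_right (f3.typed f2).1
        ((x.isOutput_eraseExcept m).2 (by rw [hx]; simp))
      obtain rfl : P = Ca := Cat.pos_injective (hP.symm.trans (a3.typed a2).2)
      refine ⟨.elimR ef ea, _, Q, by simp [NDTree.erase, a1, f1], .elimR f2 a2, .elimR a3 ?_ f3⟩
      have := (indices_eraseExcept m (D ++ [g])).symm ▸
        (indices_eraseExcept m (L ++ x :: R)).symm ▸ hdis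
      simpa using this
    refine ⟨key, fun h => ?_⟩
    cases h with | branch B i hb => exact of_branch key hb

theorem PTree.exists_leaf_of_formula_eq_atom {t : PTree V} {b : Base V}
    (h : t.formula = .atom b) : ∃ i, t = .leaf (.atom b) i := by
  cases t with
  | leaf F i => exact ⟨i, by simpa [PTree.formula] using h⟩
  | _ => simp [PTree.formula] at h

theorem Translates.exists_concat_s {d : NDTree (Cat V)} {Γ : List (Cat V)} {π : Struct V}
    (h : Translates d π) (hd : Derives d Γ Cat.s) : ∃ L i, π = L ++ [.leaf (.atom .s) i] := by
  obtain ⟨L, o, rfl⟩ := h.exists_concat hd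
  obtain ⟨i, rfl⟩ := PTree.exists_leaf_of_formula_eq_atom (h.typed hd).2
  exact ⟨L, i, rfl⟩

theorem PTree.mem_leaves_eraseExcept {m : ℕ} {t : PTree V} {x : LF Unit × ℕ}
    (h : x ∈ (t.eraseExcept m).leaves) (hx : x.2 ≠ m) :
    x.1 = .atom baseO ∨ x.1 = .coatom baseO := by
  induction t with
  | leaf F i =>
    simp only [PTree.eraseExcept, PTree.leaves, List.mem_singleton] at h
    subst h
    simp only at hx
    by_cases hF : F.IsOutput <;> simp [hx, hF]
  | tens a b iha ihb =>
    simp only [PTree.eraseExcept, PTree.leaves, List.mem_append] at h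
    exact h.elim iha ihb
  | par a b iha ihb =>
    simp only [PTree.eraseExcept, PTree.leaves, List.mem_append] at h
    exact h.elim iha ihb

theorem Translates.isProofFrame {d : NDTree (Cat V)} {Γ : List (Cat V)} {π : Struct V}
    (h : Translates d π) (hd : Derives d Γ Cat.s) : IsProofFrame π.frame := by
  obtain ⟨L, i, rfl⟩ := h.exists_concat_s hd
  obtain ⟨d', Γ', C', -, h2, h3⟩ := (translates_eraseExcept i hd).2 h
  simp only [Struct.frame, mainIndex_concat]
  refine ⟨(h3.isNetOf h2).1, L.map (PTree.eraseExcept i), i, ?_, ?_⟩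
  · simp [PTree.eraseExcept]
  · intro x hx hxi
    obtain ⟨t, ht, hx⟩ := List.mem_flatMap.1 hx
    obtain ⟨t, ht, rfl⟩ := List.mem_map.1 ht
    exact PTree.mem_leaves_eraseExcept hx hxi

theorem PTree.eraseExcept_eq_self {m : ℕ} {t : PTree Unit}
    (h : ∀ F i, (F, i) ∈ t.leaves → F = .atom (if i = m then .s else baseO) ∨
      F = .coatom (if i = m then .s else baseO)) : t.eraseExcept m = t := by
  induction t with
  | leaf F i =>
    rcases h F i (by simp [PTree.leaves]) with rfl | rfl
    · simp [PTree.eraseExcept]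
    · have := (LF.IsInput.coatom (if i = m then Base.s else baseO)).not_isOutput
      simp [PTree.eraseExcept, this]
  | tens a b iha ihb =>
    simp only [PTree.leaves, List.mem_append] at h
    simp only [PTree.eraseExcept]
    rw [iha fun F i hF => h F i (.inl hF), ihb fun F i hF => h F i (.inr hF)]
  | par a b iha ihb =>
    simp only [PTree.leaves, List.mem_append] at h
    simp only [PTree.eraseExcept]
    rw [iha fun F i hF => h F i (.inl hF), ihb fun F i hF => h F i (.inr hF)]

/-- A proof frame is its own frame. -/
theorem IsProofFrame.frame_eq {ρ : Struct Unit} (h : IsProofFrame ρ) : ρ.frame = ρ := by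
  obtain ⟨hn, L, m, rfl, hO⟩ := h
  simp only [Struct.frame, mainIndex_concat]
  refine (List.map_congr_left fun t ht => ?_).trans (List.map_id _)
  refine PTree.eraseExcept_eq_self fun F i hF => ?_
  have hF' : (F, i) ∈ leaves (L ++ [.leaf (.atom .s) m]) := List.mem_flatMap.2 ⟨t, ht, hF⟩
  -- The other end of the output axiom is not constrained by the definition of proof frames; it is
  -- the dual of `s` because the structure is linked.
  by_cases him : i = m
  · subst him
    rw [if_pos rfl]
    rcases hn.linked.eq_or_eq_dual (F := .atom .s) (G := F) (i := i)
      (mem_occ_of_mem (by simp)) (leaf_mem_occ.2 hF') with h | h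
    · exact .inl h
    · exact .inr h
  · rw [if_neg him]
    exact hO _ hF' him

/-- The frame of the net depends only on the frame of the deduction. -/
theorem Translates.frame_same {d : NDTree (Cat V)} {d' : NDTree (Cat V')} {Γ : List (Cat V)}
    {Γ' : List (Cat V')} {π : Struct V} {π' : Struct V'} (h : Translates d π)
    (hd : Derives d Γ Cat.s) (h' : Translates d' π') (hd' : Derives d' Γ' Cat.s)
    (he : d.erase = d'.erase) : π.frame.Same π'.frame := by
  obtain ⟨f, hf⟩ := ((similar_of_erase_eq he).2 h h').exists_perm
  obtain ⟨L, i, rfl⟩ := h.exists_concat_s hd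
  obtain ⟨L', i', rfl⟩ := h'.exists_concat_s hd'
  exact ⟨f, hf.frame_eq f.injective⟩

/-- The frame of the deduction can be recovered from the frame of the net. -/
theorem Translates.erase_eq {d : NDTree (Cat V)} {d' : NDTree (Cat V')} {Γ : List (Cat V)}
    {Γ' : List (Cat V')} {π : Struct V} {π' : Struct V'} (h : Translates d π)
    (hd : Derives d Γ Cat.s) (h' : Translates d' π') (hd' : Derives d' Γ' Cat.s)
    (hs : π.frame.Same π'.frame) : d.erase = d'.erase := by
  obtain ⟨e, Δ, C, h1, h2, h3⟩ := (translates_eraseExcept π.mainIndex hd).2 h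
  obtain ⟨e', Δ', C', h1', h2', h3'⟩ := (translates_eraseExcept π'.mainIndex hd').2 h'
  rw [← h1, ← h1', (h3.same hs).injective h2 h3' h2']

/-- Each proof frame is the frame of the translation of a deduction. -/
theorem IsProofFrame.exists_deduction {ρ : Struct Unit} (h : IsProofFrame ρ) :
    ∃ (d : NDTree (Cat V)) (Γ : List (Cat V)) (π : Struct V), Derives d Γ Cat.s ∧ d.Normal ∧
      Translates d π ∧ π.frame.Same ρ := by
  have hframe := h.frame_eq
  obtain ⟨hn, L, m, rfl, hO⟩ := h
  obtain ⟨Γ, hΓ⟩ := exists_inputs (hn.intuitionistic.of_concat).2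
  obtain ⟨d, d1, d2, d3⟩ := Lambek.exists_deduction _ _ rfl hn Γ Cat.s (conclusions_iff.2 ⟨hΓ, rfl⟩)
  -- The deduction obtained is over `Unit`. Sending all base categories to `s` works for every `V`,
  -- even an empty one, and preserves the frame.
  have h1 : Derives _ _ Cat.s := d1.subst fun _ => (Cat.s : Cat V)
  have h2 : (d.map (Cat.subst fun _ => (Cat.s : Cat V))).Normal :=
    (NDTree.normal_congr (by simp)).2 d2
  obtain ⟨π, hπ⟩ := (translation_exists h1 h2).2
  refine ⟨_, _, π, h1, h2, hπ, ?_⟩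
  rw [← hframe]
  exact hπ.frame_same h1 d3 d1 (by simp)

theorem exists_frameEquiv (V : Type u) (W : Type v) :
    ∃ F : NDFrame V ≃ ProofFrame,
      (∀ (Γ : List (Cat V)) (d : NormalDeduction Γ Cat.s) (π : Struct V), Translates d.1 π →
        ∃ h : IsProofFrame π.frame, F d.frame = ProofFrame.mk π.frame h) ∧
      (∀ (G : Grammar W V) (ws : List W) (f : NDFrame V),
        (ws, f.1) ∈ G.ndLanguage ↔ (ws, F f) ∈ G.spfLanguage) := by
  have hw : ∀ f : NDFrame V, ∃ (d : NDTree (Cat V)) (Γ : List (Cat V)) (π : Struct V),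
      Derives d Γ Cat.s ∧ d.erase = f.1 ∧ Translates d π := by
    rintro ⟨f, d, Γ, ⟨h1, h2⟩, h3⟩
    obtain ⟨π, hπ⟩ := (translation_exists h1 h2).2
    exact ⟨d, Γ, π, h1, h3, hπ⟩
  choose D Γ P hD he hP using hw
  let F : NDFrame V → ProofFrame := fun f => ProofFrame.mk (P f).frame ((hP f).isProofFrame (hD f))
  have hF : ∀ (Γ : List (Cat V)) (d : NormalDeduction Γ Cat.s) (π : Struct V), Translates d.1 π →
      ∃ h : IsProofFrame π.frame, F d.frame = ProofFrame.mk π.frame h := by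
    intro Γ d π h
    refine ⟨h.isProofFrame d.2.1, Quotient.sound ?_⟩
    exact (hP _).frame_same (hD _) h d.2.1 (he d.frame)
  have hinj : Function.Injective F := by
    intro f f' h
    have := (hP f).erase_eq (hD f) (hP f') (hD f') (Quotient.exact h)
    exact Subtype.ext (by rw [← he, ← he, this])
  have hsurj : Function.Surjective F := by
    intro q
    induction q using Quotient.inductionOn with | h x => ?_
    obtain ⟨ρ, h⟩ := x
    obtain ⟨d, Δ, π, h1, h2, h3, h4⟩ := h.exists_deduction (V := V)
    obtain ⟨h', h5⟩ := hF Δ ⟨d, h1, h2⟩ π h3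
    exact ⟨_, h5.trans (Quotient.sound h4)⟩
  refine ⟨Equiv.ofBijective F ⟨hinj, hsurj⟩, hF, fun G ws f => ?_⟩
  change (ws, f.1) ∈ G.ndLanguage ↔ (ws, F f) ∈ G.spfLanguage
  constructor
  · rintro ⟨cs, hcs, d, hd⟩
    obtain ⟨π, hπ⟩ := (translation_exists d.2.1 d.2.2).2
    obtain ⟨h, h'⟩ := hF cs d π hπ
    have hf : d.frame = f := Subtype.ext hd
    exact ⟨cs, π, hcs, hπ.isNetOf d.2.1, h, by rw [← h', hf]⟩
  · rintro ⟨cs, π, hcs, hπ, h, h'⟩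
    -- The net of the grammar may differ from the one chosen for `f`; its own deduction uses the
    -- same categories `cs`, and injectivity of `F` shows that its frame is `f`.
    obtain ⟨d, h1, h2, h3⟩ := exists_deduction _ π rfl hπ.1 cs _ hπ.2
    obtain ⟨_, h4⟩ := hF cs ⟨d, h1, h2⟩ π h3
    have hf : NormalDeduction.frame ⟨d, h1, h2⟩ = f := hinj (h4.trans h'.symm)
    exact ⟨cs, hcs, ⟨d, h1, h2⟩, congrArg Subtype.val hf⟩

end Lambek


namespace Lambek

universe u v w

variable {V : Type u} {V' : Type w}

/-! ### Least general generalisation -/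

/-- The base categories that occur in a category. -/
def Cat.bases : Cat V → List (Base V)
  | .base b => [b]
  | .under A B => A.bases ++ B.bases
  | .over B A => B.bases ++ A.bases

theorem Cat.length_bases_pos (A : Cat V) : 0 < A.bases.length := by
  induction A <;> simp_all [Cat.bases]

theorem Cat.bases_subst (θ : Base V → Cat V') (A : Cat V) :
    (A.subst θ).bases = A.bases.flatMap fun b => (θ b).bases := by
  induction A <;> simp_all [Cat.bases, Cat.subst]

theorem Cat.subst_congr {θ η : Base V → Cat V'} {A : Cat V} (h : ∀ b ∈ A.bases, θ b = η b) :
    A.subst θ = A.subst η := by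
  induction A with
  | base b => exact h b (by simp [Cat.bases])
  | under A B ihA ihB =>
    simp only [Cat.bases, List.mem_append] at h
    simp only [Cat.subst]
    rw [ihA fun b hb => h b (.inl hb), ihB fun b hb => h b (.inr hb)]
  | _ B A ihB ihA =>
    simp only [Cat.bases, List.mem_append] at h
    simp only [Cat.subst]
    rw [ihB fun b hb => h b (.inl hb), ihA fun b hb => h b (.inr hb)]

theorem Cat.subst_subst {V'' : Type v} (θ : Base V → Cat V') (η : Base V' → Cat V'') (A : Cat V) :
    (A.subst θ).subst η = A.subst fun b => (θ b).subst η := by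
  induction A <;> simp_all [Cat.subst]

theorem Cat.exists_base {A : Cat V} (h : A.bases.length = 1) : ∃ b, A = .base b := by
  cases A with
  | base b => exact ⟨b, rfl⟩
  | under A B =>
    have := A.length_bases_pos
    have := B.length_bases_pos
    simp only [Cat.bases, List.length_append] at h
    omega
  | _ B A =>
    have := A.length_bases_pos
    have := B.length_bases_pos
    simp only [Cat.bases, List.length_append] at h
    omega

/-- The least general generalisation of two categories: a variable stands for each pair of
subcategories that do not match. -/
def Cat.lgg : Cat V → Cat V' → Cat (Cat V × Cat V')
  | .base .s, .base .s => .base .s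
  | .under A B, .under A' B' => .under (A.lgg A') (B.lgg B')
  | .over B A, .over B' A' => .over (B.lgg B') (A.lgg A')
  | A, B => .base (.var (A, B))

/-- The substitution that gives back the first category. -/
def Base.fst : Base (Cat V × Cat V') → Cat V
  | .s => .base .s
  | .var p => p.1

/-- The substitution that gives back the second category. -/
def Base.snd : Base (Cat V × Cat V') → Cat V'
  | .s => .base .s
  | .var p => p.2

theorem Cat.lgg_subst_fst (A : Cat V) (B : Cat V') : (A.lgg B).subst Base.fst = A := by
  fun_induction Cat.lgg A B <;> simp_all [Cat.subst, Base.fst]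

theorem Cat.lgg_subst_snd (A : Cat V) (B : Cat V') : (A.lgg B).subst Base.snd = B := by
  fun_induction Cat.lgg A B <;> simp_all [Cat.subst, Base.snd]

/-- A rule only asks that certain subcategories be equal. The generalisation commutes with both
slashes, and a mismatched pair is its own variable, so equal pairs have equal generalisations and
the rules still apply. -/
theorem Derives.lgg {d : NDTree (Cat V)} {Γ : List (Cat V)} {C : Cat V} (h : Derives d Γ C) :
    ∀ {d' : NDTree (Cat V')} {Γ' : List (Cat V')} {C' : Cat V'}, Derives d' Γ' C' →
      d.erase = d'.erase → Γ.length = Γ'.length ∧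
      ∃ e, Derives e (List.zipWith Cat.lgg Γ Γ') (C.lgg C') ∧ e.erase = d.erase := by
  induction h with
  | hyp A =>
    intro d' Γ' C' h' he
    cases h' with
    | hyp A' => exact ⟨rfl, .hyp _, .hyp _, rfl⟩
    | _ => simp [NDTree.erase] at he
  | @introL d A B Γ hne h ih =>
    intro d' Γ' C' h' he
    cases h' with
    | @introL d' A' B' Γ' hne' h' =>
      obtain ⟨hl, e, e1, e2⟩ := ih h' (by simpa [NDTree.erase] using he)
      have hl' : Γ.length = Γ'.length := by simpa using hl
      refine ⟨hl', .introL e, ?_, by simp [NDTree.erase, e2]⟩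
      have := Derives.introL (A := A.lgg A') (B := B.lgg B') ?_ e1
      · simpa [Cat.lgg] using this
      · simp [hne, hne']
    | _ => simp [NDTree.erase] at he
  | @introR d A B Γ hne h ih =>
    intro d' Γ' C' h' he
    cases h' with
    | @introR d' A' B' Γ' hne' h' =>
      obtain ⟨hl, e, e1, e2⟩ := ih h' (by simpa [NDTree.erase] using he)
      have hl' : Γ.length = Γ'.length := by simpa using hl
      refine ⟨hl', .introR e, ?_, by simp [NDTree.erase, e2]⟩
      rw [List.zipWith_append hl'] at e1
      have := Derives.introR (A := A.lgg A') (B := B.lgg B') ?_ e1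
      · simpa [Cat.lgg] using this
      · simp [hne, hne']
    | _ => simp [NDTree.erase] at he
  | @elimL arg fn A B Δ Γ h1 h2 ih1 ih2 =>
    intro d' Γ' C' h' he
    cases h' with
    | @elimL arg' fn' A' B' Δ' Γ' h1' h2' =>
      simp only [NDTree.erase, NDTree.elimL.injEq] at he
      obtain ⟨hl1, e1, d1, r1⟩ := ih1 h1' he.1
      obtain ⟨hl2, e2, d2, r2⟩ := ih2 h2' he.2
      refine ⟨by simp [hl1, hl2], .elimL e1 e2, ?_, by simp [NDTree.erase, r1, r2]⟩
      rw [List.zipWith_append hl1]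
      exact .elimL d1 (by simpa [Cat.lgg] using d2)
    | _ => simp [NDTree.erase] at he
  | @elimR fn arg A B Γ Δ h2 h1 ih2 ih1 =>
    intro d' Γ' C' h' he
    cases h' with
    | @elimR fn' arg' A' B' Γ' Δ' h2' h1' =>
      simp only [NDTree.erase, NDTree.elimR.injEq] at he
      obtain ⟨hl1, e1, d1, r1⟩ := ih1 h1' he.2
      obtain ⟨hl2, e2, d2, r2⟩ := ih2 h2' he.1
      refine ⟨by simp [hl1, hl2], .elimR e2 e1, ?_, by simp [NDTree.erase, r1, r2]⟩
      rw [List.zipWith_append hl2]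
      exact .elimR (by simpa [Cat.lgg] using d2) d1
    | _ => simp [NDTree.erase] at he

/-! ### Lexicons -/

/-- Assignments of at most one category to each word. -/
abbrev Lexicon (W : Type v) (V : Type u) : Type (max u v) := W → Option (Cat V)

namespace Lexicon

variable {W : Type v}

/-- The structured sentences generated by a lexicon. -/
def language (K : Lexicon W V) : Set (List W × NDTree Unit) :=
  {e | ∃ Γ : List (Cat V), e.1.map K = Γ.map some ∧
    ∃ d : NDTree (Cat V), Derives d Γ Cat.s ∧ d.Normal ∧ d.erase = e.2}

/-- The pointwise least general generalisation. -/
def lgg (H : Lexicon W V) (G : Lexicon W V') : Lexicon W (Cat V × Cat V') := fun w =>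
  (H w).bind fun a => (G w).map fun b => a.lgg b

theorem lgg_eq_some {H : Lexicon W V} {G : Lexicon W V'} {w : W} {c : Cat (Cat V × Cat V')} :
    H.lgg G w = some c ↔ ∃ a b, H w = some a ∧ G w = some b ∧ a.lgg b = c := by
  simp [lgg, Option.bind_eq_some_iff]

theorem inter_subset_language_lgg (H : Lexicon W V) (G : Lexicon W V') :
    H.language ∩ G.language ⊆ (H.lgg G).language := by
  rintro ⟨ws, f⟩ ⟨⟨Γ, hΓ, d, h1, h2, h3⟩, Γ', hΓ', d', h1', h2', h3'⟩
  simp only at hΓ hΓ' h3 h3'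
  obtain ⟨hl, e, e1, e2⟩ := h1.lgg h1' (h3.trans h3'.symm)
  refine ⟨List.zipWith Cat.lgg Γ Γ', ?_, e, e1, (NDTree.normal_congr e2).2 h2, e2.trans h3⟩
  clear h1 h1' e1 h3 h3' e2 h2 h2'
  simp only
  induction ws generalizing Γ Γ' with
  | nil =>
    obtain rfl : Γ = [] := by simpa using hΓ.symm
    simp
  | cons w ws ih =>
    cases Γ with
    | nil => simp at hΓ
    | cons A Γ =>
      cases Γ' with
      | nil => simp at hl
      | cons A' Γ' =>
        simp only [List.map_cons, List.cons.injEq] at hΓ hΓ'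
        simp only [List.map_cons, List.zipWith_cons_cons, List.cons.injEq]
        exact ⟨lgg_eq_some.2 ⟨A, A', hΓ.1, hΓ'.1, rfl⟩,
          ih Γ hΓ.2 Γ' hΓ'.2 (by simpa using hl)⟩

theorem language_subset_of_subst {K : Lexicon W V} {G : Lexicon W V'} (θ : Base V → Cat V')
    (hs : θ .s = Cat.s) (h : ∀ w c, K w = some c → G w = some (c.subst θ)) :
    K.language ⊆ G.language := by
  rintro ⟨ws, f⟩ ⟨Γ, hΓ, d, h1, h2, h3⟩
  have hd : Derives (d.map (Cat.subst θ)) (Γ.map (Cat.subst θ)) Cat.s := by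
    have := h1.subst θ
    rwa [show Cat.s.subst θ = Cat.s from hs] at this
  refine ⟨Γ.map (Cat.subst θ), ?_, _, hd, (NDTree.normal_congr (by simp)).2 h2, by simpa using h3⟩
  clear h1 hd h2 h3
  simp only at hΓ ⊢
  induction ws generalizing Γ with
  | nil =>
    obtain rfl : Γ = [] := by simpa using hΓ.symm
    simp
  | cons w ws ih =>
    cases Γ with
    | nil => simp at hΓ
    | cons A Γ =>
      simp only [List.map_cons, List.cons.injEq] at hΓ ⊢
      exact ⟨h w A hΓ.1, ih Γ hΓ.2⟩

/-- The base categories used by an entry. -/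
def entry (K : Lexicon W V) (w : W) : List (Base V) := (K w).elim [] Cat.bases

theorem entry_of_some {K : Lexicon W V} {w : W} {c : Cat V} (h : K w = some c) :
    K.entry w = c.bases := by simp [entry, h]

/-- Renaming of the variables. -/
def rename (K : Lexicon W V) (r : V → V') : Lexicon W V' := fun w =>
  (K w).map (Cat.subst fun
    | .s => .base .s
    | .var x => .base (.var (r x)))

theorem entry_rename (K : Lexicon W V) (r : V → V') (w : W) :
    (K.rename r).entry w = (K.entry w).map fun
      | .s => .s
      | .var x => .var (r x) := by
  rw [entry, entry, rename]
  cases K w with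
  | none => rfl
  | some c =>
    simp only [Option.map_some, Option.elim_some, Cat.bases_subst]
    rw [List.map_eq_flatMap]
    congr 1
    funext b
    cases b <;> rfl

variable [Fintype W]

/-- The number of occurrences of base categories. -/
def weight (K : Lexicon W V) : ℕ := ∑ w, (K.entry w).length

open Classical in
/-- The variables that occur in a lexicon. -/
noncomputable def support (K : Lexicon W V) : Finset V :=
  ((Finset.univ : Finset W).toList.flatMap fun w => (K.entry w).filterMap fun
    | .s => none
    | .var x => some x).toFinset

theorem mem_support {K : Lexicon W V} {x : V} : x ∈ K.support ↔ ∃ w, .var x ∈ K.entry w := by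
  classical
  simp only [support, List.mem_toFinset, List.mem_flatMap, Finset.mem_toList, Finset.mem_univ,
    true_and, List.mem_filterMap]
  refine exists_congr fun w => ?_
  constructor
  · rintro ⟨b, hb, h⟩
    cases b with
    | s => simp at h
    | var y => obtain rfl : y = x := by simpa using h
               exact hb
  · exact fun h => ⟨_, h, rfl⟩

theorem card_support_le (K : Lexicon W V) : K.support.card ≤ K.weight := by
  classical
  refine (List.toFinset_card_le _).trans ?_
  rw [List.length_flatMap, Finset.sum_map_toList]
  exact Finset.sum_le_sum fun w _ => List.length_filterMap_le _ _

/-- The order in which lexicons are tried. -/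
noncomputable def key (K : Lexicon W V) : ℕ :=
  K.weight * (K.weight + 1) + (K.weight - K.support.card)

/-- All variables are small. -/
def Small (K : Lexicon W ℕ) : Prop := ∀ x ∈ K.support, x < K.weight

/-- The second summand of `key` is at most the weight `w`, less than the gap `2 * (w + 1)` between
successive values of `w * (w + 1)`. Keys are thus compared by weight first; at equal weight a
smaller key means more variables. -/
theorem key_le_key {K : Lexicon W V} {H : Lexicon W V'} (h : H.key ≤ K.key) :
    H.weight ≤ K.weight := by
  by_contra hlt
  push Not at hlt
  have h1 : K.weight * (K.weight + 1) + K.weight < H.weight * (H.weight + 1) := by nlinarith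
  have h2 : K.weight * (K.weight + 1) ≤ K.key ∧ K.key ≤ K.weight * (K.weight + 1) + K.weight :=
    ⟨Nat.le_add_right _ _, by unfold key; omega⟩
  have h3 : H.weight * (H.weight + 1) ≤ H.key := Nat.le_add_right _ _
  omega

theorem card_le_card_of_key {K : Lexicon W V} {H : Lexicon W V'} (h : H.key ≤ K.key)
    (hw : H.weight = K.weight) : K.support.card ≤ H.support.card := by
  have h1 := K.card_support_le
  have h2 := H.card_support_le
  unfold key at h
  rw [hw] at h
  omega

theorem weight_rename (K : Lexicon W V) (r : V → V') : (K.rename r).weight = K.weight := by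
  simp [weight, entry_rename]

theorem support_rename [DecidableEq V'] (K : Lexicon W V) (r : V → V') :
    (K.rename r).support = K.support.image r := by
  ext x
  simp only [mem_support, entry_rename, Finset.mem_image, List.mem_map]
  constructor
  · rintro ⟨w, b, hb, h⟩
    cases b with
    | s => simp at h
    | var y => exact ⟨y, ⟨w, hb⟩, by simpa using h⟩
  · rintro ⟨y, ⟨w, hw⟩, rfl⟩
    exact ⟨w, _, hw, rfl⟩

/-- Numbering the variables in use gives names below their number, which is at most the weight. The
search can thus be confined to small lexicons over `ℕ`. -/
theorem exists_small (K : Lexicon W V) : ∃ H : Lexicon W ℕ, H.Small ∧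
    K.language ⊆ H.language ∧ H.weight = K.weight ∧ H.support.card = K.support.card := by
  classical
  let r : V → ℕ := fun x => if h : x ∈ K.support then (K.support.equivFin ⟨x, h⟩ : ℕ) else 0
  have hr : ∀ x (h : x ∈ K.support), r x = (K.support.equivFin ⟨x, h⟩ : ℕ) := fun x h => dif_pos h
  refine ⟨K.rename r, ?_, language_subset_of_subst _ rfl fun w c h => by rw [rename, h]; rfl,
    K.weight_rename r, ?_⟩
  · intro y hy
    rw [support_rename, Finset.mem_image] at hy
    obtain ⟨x, hx, rfl⟩ := hy
    rw [weight_rename, hr x hx]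
    exact (Fin.is_lt _).trans_le K.card_support_le
  · rw [support_rename]
    refine Finset.card_image_of_injOn fun x hx y hy hxy => ?_
    rw [hr x hx, hr y hy] at hxy
    simpa using K.support.equivFin.injective (Fin.ext hxy)

/-- A lexicon with the smallest key among those that generate a language is a most general one. -/
theorem language_subset_of_key_le {H : Lexicon W ℕ} {G : Lexicon W V}
    (hG : G.language ⊆ H.language)
    (hmin : ∀ H' : Lexicon W ℕ, H'.Small → G.language ⊆ H'.language → H.key ≤ H'.key) :
    H.language ⊆ G.language := by
  classical
  let K := H.lgg G
  have hK : G.language ⊆ K.language := fun e he => inter_subset_language_lgg H G ⟨hG he, he⟩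
  obtain ⟨K', hK', hKK', hw, hc⟩ := K.exists_small
  -- `K` has pairs of categories as variables; minimality is applied to a small copy of it over `ℕ`,
  -- with the same key.
  have hkey : H.key ≤ K.key := by
    have := hmin K' hK' (hK.trans hKK')
    unfold key at this ⊢
    rwa [hw, hc] at this
  have hsome : ∀ w c, K w = some c → H w = some (c.subst Base.fst) ∧ G w = some (c.subst Base.snd) := by
    intro w c h
    obtain ⟨a, b, ha, hb, rfl⟩ := lgg_eq_some.1 h
    rw [Cat.lgg_subst_fst, Cat.lgg_subst_snd]
    exact ⟨ha, hb⟩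
  -- A substitution never shortens a category, and keeps its length only if all its base categories
  -- go to base categories.
  have hlen : ∀ l : List (Base (Cat ℕ × Cat V)),
      l.length ≤ (l.flatMap fun b => (Base.fst b).bases).length ∧
      (l.length = (l.flatMap fun b => (Base.fst b).bases).length →
        ∀ b ∈ l, (Base.fst b).bases.length = 1) := by
    intro l
    induction l with
    | nil => simp
    | cons b l ih =>
      have := (Base.fst b).length_bases_pos
      simp only [List.flatMap_cons, List.length_append, List.length_cons]
      refine ⟨by omega, fun h c hc => ?_⟩
      rcases List.mem_cons.1 hc with rfl | hc
      · omega
      · exact ih.2 (by omega) c hc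
  have hentry : ∀ w, (K.entry w).length ≤ (H.entry w).length := by
    intro w
    cases h : K w with
    | none => simp [entry, h]
    | some c =>
      rw [entry_of_some h, entry_of_some (hsome w c h).1, Cat.bases_subst]
      exact (hlen _).1
  have hweight : K.weight = H.weight :=
    le_antisymm (Finset.sum_le_sum fun w _ => hentry w) (key_le_key hkey)
  have hentry' : ∀ w, (K.entry w).length = (H.entry w).length := fun w =>
    (Finset.sum_eq_sum_iff_of_le fun w _ => hentry w).1 hweight w (Finset.mem_univ w)
  -- Equality of the weights is equality entry by entry, and no category has length zero; hence `H`
  -- has no entry that `K` lacks.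
  have hsupp : ∀ w c, H w = some c → ∃ c', K w = some c' ∧ c'.subst Base.fst = c := by
    intro w c h
    cases hKw : K w with
    | none =>
      have h1 := hentry' w
      have h2 := c.length_bases_pos
      rw [entry_of_some h] at h1
      simp only [entry, hKw, Option.elim_none, List.length_nil] at h1
      omega
    | some c' =>
      have := (hsome w c' hKw).1
      rw [h] at this
      exact ⟨c', rfl, (Option.some.inj this).symm⟩
  have hone : ∀ w, ∀ b ∈ K.entry w, (Base.fst b).bases.length = 1 := by
    intro w b hb
    cases h : K w with
    | none => simp [entry, h] at hb
    | some c =>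
      have h1 := hentry' w
      rw [entry_of_some h] at hb h1
      rw [entry_of_some (hsome w c h).1, Cat.bases_subst] at h1
      exact (hlen _).2 h1 b hb
  -- the variables of `K` are mapped to base categories, injectively and away from `s`
  have himage : H.support.image (fun x => Cat.base (Base.var x)) ⊆
      K.support.image (fun p => p.1) := by
    intro A hA
    obtain ⟨x, hx, rfl⟩ := Finset.mem_image.1 hA
    obtain ⟨w, hw⟩ := mem_support.1 hx
    cases h : H w with
    | none => simp [entry, h] at hw
    | some c =>
      obtain ⟨c', hc', rfl⟩ := hsupp w c h
      rw [entry_of_some h, Cat.bases_subst, List.mem_flatMap] at hw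
      obtain ⟨b, hb, hxb⟩ := hw
      rw [← entry_of_some hc'] at hb
      obtain ⟨b', hb'⟩ := Cat.exists_base (hone w b hb)
      rw [hb', Cat.bases, List.mem_singleton] at hxb
      subst hxb
      cases b with
      | s => simp [Base.fst] at hb'
      | var p => exact Finset.mem_image.2 ⟨p, mem_support.2 ⟨w, hb⟩, hb'⟩
  have hcard1 : (H.support.image (fun x => Cat.base (Base.var x))).card = H.support.card :=
    Finset.card_image_of_injective _ fun x y h => by simpa using h
  -- At equal weight, minimality of the key says that `H` has at least as many variables as `K`.
  -- Since the variables of `H` are images of variables of `K`, the first projection is a bijection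
  -- between them.
  have hcard2 := card_le_card_of_key hkey hweight.symm
  have himage' : H.support.image (fun x => Cat.base (Base.var x)) =
      K.support.image (fun p => p.1) :=
    Finset.eq_of_subset_of_card_le himage (by rw [hcard1]; exact Finset.card_image_le.trans hcard2)
  have hinj : Set.InjOn (fun p : Cat ℕ × Cat V => p.1) (K.support : Set (Cat ℕ × Cat V)) := by
    rw [← Finset.card_image_iff]
    refine le_antisymm Finset.card_image_le ?_
    rw [← himage', hcard1]
    exact hcard2
  -- the inverse renaming, followed by the substitution that gives `G`
  let η : Base ℕ → Cat V := fun
    | .s => .base .s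
    | .var x => if h : ∃ p ∈ K.support, p.1 = .base (.var x) then h.choose.2 else .base .s
  refine language_subset_of_subst η rfl fun w c h => ?_
  obtain ⟨c', hc', rfl⟩ := hsupp w c h
  rw [(hsome w c' hc').2, Cat.subst_subst]
  refine congrArg some (Cat.subst_congr fun b hb => ?_)
  cases b with
  | s => rfl
  | var p =>
    rw [← entry_of_some hc'] at hb
    have hp : p ∈ K.support := mem_support.2 ⟨w, hb⟩
    have hp' := Finset.mem_image_of_mem (fun p => p.1) hp
    rw [← himage'] at hp'
    obtain ⟨x, -, hx⟩ := Finset.mem_image.1 hp'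
    have hex : ∃ q ∈ K.support, q.1 = .base (.var x) := ⟨p, hp, hx.symm⟩
    have hq : hex.choose = p := hinj hex.choose_spec.1 hp (hex.choose_spec.2.trans hx)
    simp only [Base.fst, Base.snd]
    rw [← hx]
    simp only [Cat.subst, η]
    rw [dif_pos hex, hq]

end Lexicon

end Lambek


namespace Lambek

universe u v

variable {V : Type u}

/-! ### Course-of-values recursion on lists -/

/-- The values at `0, …, n - 1` of the function defined by the course-of-values recursion `g`. -/
def recTable {σ : Type u} (g : List σ → σ) (n : ℕ) : List σ :=
  n.rec [] fun _ l => l ++ [g l]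

/-- The function defined by the course-of-values recursion `g`. -/
def listRec {σ : Type u} (g : List σ → σ) (n : ℕ) : σ := g (recTable g n)

@[simp] theorem length_recTable {σ : Type u} (g : List σ → σ) (n : ℕ) :
    (recTable g n).length = n := by
  induction n with
  | zero => rfl
  | succ n ih =>
    change (recTable g n ++ [g (recTable g n)]).length = n + 1
    simp [ih]

theorem getD_recTable {σ : Type u} (g : List σ → σ) (d : σ) {n k : ℕ} (h : k < n) :
    (recTable g n).getD k d = listRec g k := by
  induction n with
  | zero => omega
  | succ n ih =>
    change (recTable g n ++ [listRec g n]).getD k d = listRec g k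
    rcases Nat.lt_succ_iff_lt_or_eq.1 h with h | rfl
    · rw [List.getD_append _ _ _ _ (by simpa using h), ih h]
    · rw [List.getD_append_right _ _ _ _ (by simp)]
      simp

/-- The whole table of earlier values is the state of an ordinary primitive recursion. -/
theorem primrec_listRec {α : Type u} {σ : Type v} [Primcodable α] [Primcodable σ]
    {g : α → List σ → σ} (hg : Primrec₂ g) : Primrec₂ fun a n => listRec (g a) n := by
  have h1 : Primrec₂ fun (a : α) (p : ℕ × List σ) => p.2 ++ [g a p.2] :=
    Primrec.list_concat.comp (Primrec.snd.comp Primrec.snd)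
      (hg.comp Primrec.fst (Primrec.snd.comp Primrec.snd))
  have h2 := Primrec.nat_rec (f := fun _ : α => ([] : List σ)) (Primrec.const []) h1
  exact hg.comp Primrec.fst h2

/-! ### Codes of categories -/

/-- The tags 1, 2, 3 separate the constructors, and a pair is at least the sum of its components, so
the code 0 is left to `s`. -/
theorem catCode_injective : Function.Injective catCode := by
  intro A
  induction A with
  | base b =>
    cases b with
    | s =>
      intro B h
      cases B with
      | base b =>
        cases b with
        | s => rfl
        | var n => have := Nat.add_le_pair 1 n; simp only [catCode] at h; omega
      | under A B =>
        have := Nat.add_le_pair 2 (Nat.pair (catCode A) (catCode B)); simp only [catCode] at h; omega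
      | _ B A =>
        have := Nat.add_le_pair 3 (Nat.pair (catCode B) (catCode A)); simp only [catCode] at h; omega
    | var n =>
      intro B h
      cases B with
      | base b =>
        cases b with
        | s => have := Nat.add_le_pair 1 n; simp only [catCode] at h; omega
        | var n => simpa [catCode] using h
      | _ => simp [catCode] at h
  | under A B ihA ihB =>
    intro C h
    cases C with
    | base b =>
      cases b with
      | s =>
        have := Nat.add_le_pair 2 (Nat.pair (catCode A) (catCode B)); simp only [catCode] at h; omega
      | var n => simp [catCode] at h
    | under A' B' =>
      simp only [catCode, Nat.pair_eq_pair, true_and] at h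
      rw [ihA h.1, ihB h.2]
    | _ => simp [catCode] at h
  | _ B A ihB ihA =>
    intro C h
    cases C with
    | base b =>
      cases b with
      | s =>
        have := Nat.add_le_pair 3 (Nat.pair (catCode B) (catCode A)); simp only [catCode] at h; omega
      | var n => simp [catCode] at h
    | under A' B' => simp [catCode] at h
    | _ B' A' =>
      simp only [catCode, Nat.pair_eq_pair, true_and] at h
      rw [ihA h.2, ihB h.1]

theorem catCode_under_iff {C : Cat ℕ} {a b : ℕ} :
    catCode C = Nat.pair 2 (Nat.pair a b) ↔
      ∃ A B, C = .under A B ∧ catCode A = a ∧ catCode B = b := by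
  constructor
  · intro h
    cases C with
    | base c =>
      cases c with
      | s => have := Nat.add_le_pair 2 (Nat.pair a b); simp only [catCode] at h; omega
      | var n => simp [catCode] at h
    | under A B =>
      simp only [catCode, Nat.pair_eq_pair, true_and] at h
      exact ⟨A, B, rfl, h.1, h.2⟩
    | _ B A => simp [catCode] at h
  · rintro ⟨A, B, rfl, rfl, rfl⟩
    rfl

theorem catCode_over_iff {C : Cat ℕ} {a b : ℕ} :
    catCode C = Nat.pair 3 (Nat.pair b a) ↔
      ∃ B A, C = .over B A ∧ catCode B = b ∧ catCode A = a := by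
  constructor
  · intro h
    cases C with
    | base c =>
      cases c with
      | s => have := Nat.add_le_pair 3 (Nat.pair b a); simp only [catCode] at h; omega
      | var n => simp [catCode] at h
    | under A B => simp [catCode] at h
    | _ B A =>
      simp only [catCode, Nat.pair_eq_pair, true_and] at h
      exact ⟨B, A, rfl, h.1, h.2⟩
  · rintro ⟨A, B, rfl, rfl, rfl⟩
    rfl

/-- Codes of base categories. -/
def baseCode : Base ℕ → ℕ
  | .s => 0
  | .var n => n + 1

/-- The recursion step for `baseList`. -/
def baseListStep (l : List (Option (List ℕ))) : Option (List ℕ) :=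
  if l.length = 0 then some [0]
  else if l.length.unpair.1 = 1 then some [l.length.unpair.2 + 1]
  else if l.length.unpair.1 = 2 ∨ l.length.unpair.1 = 3 then
    (l.getD l.length.unpair.2.unpair.1 none).bind fun x =>
      (l.getD l.length.unpair.2.unpair.2 none).map fun y => x ++ y
  else none

/-- The codes of the base categories of the category with a given code, if there is one. -/
def baseList (c : ℕ) : Option (List ℕ) := listRec baseListStep c

theorem baseList_var (n : ℕ) : baseList (Nat.pair 1 n) = some [n + 1] := by
  have h := Nat.add_le_pair 1 n
  simp only [baseList, listRec, baseListStep, length_recTable, Nat.unpair_pair]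
  rw [if_neg (by omega), if_pos trivial]

/-- Both components are smaller than the code because the tag is positive; the lookups fall inside
the table and the default value plays no role. -/
theorem baseList_binary {t : ℕ} (ht : t = 2 ∨ t = 3) (a b : ℕ) :
    baseList (Nat.pair t (Nat.pair a b)) =
      (baseList a).bind fun x => (baseList b).map fun y => x ++ y := by
  have h := Nat.add_le_pair t (Nat.pair a b)
  have h' := Nat.add_le_pair a b
  conv_lhs =>
    simp only [baseList, listRec, baseListStep, length_recTable, Nat.unpair_pair]
  rw [if_neg (by omega), if_neg (by omega), if_pos ht, getD_recTable _ _ (by omega),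
    getD_recTable _ _ (by omega)]
  rfl

theorem baseList_catCode (A : Cat ℕ) : baseList (catCode A) = some (A.bases.map baseCode) := by
  induction A with
  | base b => cases b with
    | s => rfl
    | var n => exact baseList_var n
  | under A B ihA ihB => simp [catCode, baseList_binary, ihA, ihB, Cat.bases]
  | _ B A ihB ihA => simp [catCode, baseList_binary, ihA, ihB, Cat.bases]

/-- `baseList` also serves as a test for being the code of a category. -/
theorem exists_catCode_eq {c : ℕ} (h : (baseList c).isSome) : ∃ A, catCode A = c := by
  induction c using Nat.strong_induction_on with
  | _ c ih =>
    obtain ⟨t, p, rfl⟩ : ∃ t p, c = Nat.pair t p := ⟨_, _, (Nat.pair_unpair c).symm⟩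
    by_cases h0 : Nat.pair t p = 0
    · exact ⟨.base .s, by rw [h0]; rfl⟩
    by_cases h1 : t = 1
    · subst h1
      exact ⟨.base (.var p), rfl⟩
    by_cases h2 : t = 2 ∨ t = 3
    · obtain ⟨a, b, rfl⟩ : ∃ a b, p = Nat.pair a b := ⟨_, _, (Nat.pair_unpair p).symm⟩
      rw [baseList_binary h2] at h
      have h3 := Nat.add_le_pair t (Nat.pair a b)
      have h4 := Nat.add_le_pair a b
      obtain ⟨x, hx⟩ := Option.isSome_iff_exists.1 h
      obtain ⟨y, hy, hx⟩ := Option.bind_eq_some_iff.1 hx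
      obtain ⟨z, hz, -⟩ := Option.map_eq_some_iff.1 hx
      obtain ⟨A, rfl⟩ := ih a (by omega) (by simp [hy])
      obtain ⟨B, rfl⟩ := ih b (by omega) (by simp [hz])
      rcases h2 with rfl | rfl
      · exact ⟨.under A B, rfl⟩
      · exact ⟨.over A B, rfl⟩
    · simp only [baseList, listRec, baseListStep, length_recTable, Nat.unpair_pair] at h
      rw [if_neg h0, if_neg h1, if_neg h2] at h
      simp at h

theorem primrec_baseList : Primrec baseList := by
  have hn : Primrec fun l : List (Option (List ℕ)) => l.length := Primrec.list_length
  have hu := Primrec.unpair.comp hn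
  have hv := Primrec.unpair.comp (Primrec.snd.comp hu)
  have ht : ∀ k, PrimrecPred fun l : List (Option (List ℕ)) => l.length.unpair.1 = k := fun k =>
    Primrec.eq.comp (Primrec.fst.comp hu) (Primrec.const k)
  have hg1 : Primrec fun l : List (Option (List ℕ)) =>
      l.getD l.length.unpair.2.unpair.1 none :=
    (Primrec.list_getD none).comp Primrec.id (Primrec.fst.comp hv)
  have hg2 : Primrec fun l : List (Option (List ℕ)) =>
      l.getD l.length.unpair.2.unpair.2 none :=
    (Primrec.list_getD none).comp Primrec.id (Primrec.snd.comp hv)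
  have hbind : Primrec fun l : List (Option (List ℕ)) =>
      (l.getD l.length.unpair.2.unpair.1 none).bind fun x =>
        (l.getD l.length.unpair.2.unpair.2 none).map fun y => x ++ y := by
    refine Primrec.option_bind hg1 ?_
    refine Primrec.option_map (hg2.comp Primrec.fst) ?_
    exact Primrec.list_append.comp (Primrec.snd.comp Primrec.fst) Primrec.snd
  have hstep : Primrec baseListStep := by
    refine Primrec.ite (Primrec.eq.comp hn (Primrec.const 0)) (Primrec.const _) ?_
    refine Primrec.ite (ht 1) ?_ ?_
    · exact Primrec.option_some.comp (Primrec.list_cons.comp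
        (Primrec.succ.comp (Primrec.snd.comp hu)) (Primrec.const []))
    · exact Primrec.ite ((ht 2).or (ht 3)) hbind (Primrec.const none)
  have h := primrec_listRec (α := Unit) (g := fun _ => baseListStep) (hstep.comp Primrec.snd)
  exact h.comp (Primrec.const ()) Primrec.id

/-! ### Typings of frames -/

/-- The labels of the hypotheses. -/
def NDTree.labels {α : Type u} : NDTree α → List α
  | .hyp a => [a]
  | .introL d => d.labels
  | .introR d => d.labels
  | .elimL d e => d.labels ++ e.labels
  | .elimR d e => d.labels ++ e.labels

/-- Left introduction on codes. -/
def codeIntroL (x : List ℕ × ℕ) : Option (List ℕ × ℕ) :=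
  if 2 ≤ x.1.length then some (x.1.tail, Nat.pair 2 (Nat.pair x.1.headI x.2)) else none

/-- Right introduction on codes. -/
def codeIntroR (x : List ℕ × ℕ) : Option (List ℕ × ℕ) :=
  if 2 ≤ x.1.length then
    some (x.1.reverse.tail.reverse, Nat.pair 3 (Nat.pair x.2 x.1.reverse.headI)) else none

/-- Left elimination on codes. -/
def codeElimL (x y : List ℕ × ℕ) : Option (List ℕ × ℕ) :=
  if y.2.unpair.1 = 2 ∧ y.2.unpair.2.unpair.1 = x.2 then
    some (x.1 ++ y.1, y.2.unpair.2.unpair.2) else none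

/-- Right elimination on codes. -/
def codeElimR (x y : List ℕ × ℕ) : Option (List ℕ × ℕ) :=
  if x.2.unpair.1 = 3 ∧ x.2.unpair.2.unpair.2 = y.2 then
    some (x.1 ++ y.1, x.2.unpair.2.unpair.1) else none

/-- The recursion step for `typings`. -/
def typingsStep (B : ℕ) (l : List (List (List ℕ × ℕ))) : List (List ℕ × ℕ) :=
  if l.length = 0 then
    (List.range B).filterMap fun a => (baseList a).map fun _ => ([a], a)
  else if l.length.unpair.1 = 1 then (l.getD l.length.unpair.2 []).filterMap codeIntroL
  else if l.length.unpair.1 = 2 then (l.getD l.length.unpair.2 []).filterMap codeIntroR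
  else if l.length.unpair.1 = 3 then
    (l.getD l.length.unpair.2.unpair.1 []).flatMap fun x =>
      (l.getD l.length.unpair.2.unpair.2 []).filterMap fun y => codeElimL x y
  else
    (l.getD l.length.unpair.2.unpair.1 []).flatMap fun x =>
      (l.getD l.length.unpair.2.unpair.2 []).filterMap fun y => codeElimR x y

/-- The codes of the sequents derived by the deductions with a given frame whose hypotheses have
codes below `B`. -/
def typings (B n : ℕ) : List (List ℕ × ℕ) := listRec (typingsStep B) n

theorem typings_zero (B : ℕ) : typings B 0 =
    (List.range B).filterMap fun a => (baseList a).map fun _ => ([a], a) := rfl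

theorem typings_introL (B n : ℕ) :
    typings B (Nat.pair 1 n) = (typings B n).filterMap codeIntroL := by
  have h := Nat.add_le_pair 1 n
  conv_lhs => simp only [typings, listRec, typingsStep, length_recTable, Nat.unpair_pair]
  rw [if_neg (by omega), if_pos trivial, getD_recTable _ _ (by omega)]
  rfl

theorem typings_introR (B n : ℕ) :
    typings B (Nat.pair 2 n) = (typings B n).filterMap codeIntroR := by
  have h := Nat.add_le_pair 2 n
  conv_lhs => simp only [typings, listRec, typingsStep, length_recTable, Nat.unpair_pair]
  rw [if_neg (by omega), if_neg (by omega), if_pos trivial, getD_recTable _ _ (by omega)]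
  rfl

theorem typings_elimL (B a b : ℕ) : typings B (Nat.pair 3 (Nat.pair a b)) =
    (typings B a).flatMap fun x => (typings B b).filterMap fun y => codeElimL x y := by
  have h := Nat.add_le_pair 3 (Nat.pair a b)
  have h' := Nat.add_le_pair a b
  conv_lhs => simp only [typings, listRec, typingsStep, length_recTable, Nat.unpair_pair]
  rw [if_neg (by omega), if_neg (by omega), if_neg (by omega), if_pos trivial,
    getD_recTable _ _ (by omega), getD_recTable _ _ (by omega)]
  rfl

theorem typings_elimR (B a b : ℕ) : typings B (Nat.pair 4 (Nat.pair a b)) =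
    (typings B a).flatMap fun x => (typings B b).filterMap fun y => codeElimR x y := by
  have h := Nat.add_le_pair 4 (Nat.pair a b)
  have h' := Nat.add_le_pair a b
  conv_lhs => simp only [typings, listRec, typingsStep, length_recTable, Nat.unpair_pair]
  rw [if_neg (by omega), if_neg (by omega), if_neg (by omega), if_neg (by omega),
    getD_recTable _ _ (by omega), getD_recTable _ _ (by omega)]
  rfl

/-- The code of a sequent. -/
def sequentCode (Γ : List (Cat ℕ)) (C : Cat ℕ) : List ℕ × ℕ := (Γ.map catCode, catCode C)

/-- The bound 2 on the length is the nonempty antecedent that an introduction must leave. -/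
theorem codeIntroL_eq_some {Γ : List (Cat ℕ)} {B : Cat ℕ} {z : List ℕ × ℕ} :
    codeIntroL (sequentCode Γ B) = some z ↔
      ∃ A Γ', Γ = A :: Γ' ∧ Γ' ≠ [] ∧ z = sequentCode Γ' (.under A B) := by
  unfold codeIntroL sequentCode
  rcases Γ with _ | ⟨A, _ | ⟨A', Γ⟩⟩
  · simp
  · simp
  · simp [catCode, eq_comm]

theorem codeIntroR_eq_some {Γ : List (Cat ℕ)} {B : Cat ℕ} {z : List ℕ × ℕ} :
    codeIntroR (sequentCode Γ B) = some z ↔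
      ∃ A Γ', Γ = Γ' ++ [A] ∧ Γ' ≠ [] ∧ z = sequentCode Γ' (.over B A) := by
  rcases List.eq_nil_or_concat Γ with rfl | ⟨Γ, A, rfl⟩
  · simp [codeIntroR, sequentCode]
  · have key : (∃ A' Γ', Γ ++ [A] = Γ' ++ [A'] ∧ Γ' ≠ [] ∧ z = sequentCode Γ' (.over B A')) ↔
        Γ ≠ [] ∧ z = sequentCode Γ (.over B A) := by
      constructor
      · rintro ⟨A', Γ', h, h1, h2⟩
        obtain ⟨rfl, h⟩ := List.append_inj' h rfl
        obtain rfl : A = A' := by simpa using h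
        exact ⟨h1, h2⟩
      · exact fun h => ⟨A, Γ, rfl, h⟩
    rw [List.concat_eq_append, key]
    unfold codeIntroR sequentCode
    rcases Γ with _ | ⟨A', Γ⟩
    · simp
    · simp [catCode, eq_comm]

theorem codeElimL_eq_some {Δ Γ : List (Cat ℕ)} {A C : Cat ℕ} {z : List ℕ × ℕ} :
    codeElimL (sequentCode Δ A) (sequentCode Γ C) = some z ↔
      ∃ B, C = .under A B ∧ z = sequentCode (Δ ++ Γ) B := by
  unfold codeElimL sequentCode
  simp only [Option.ite_none_right_eq_some, Option.some.injEq]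
  constructor
  · rintro ⟨⟨h1, h2⟩, rfl⟩
    obtain ⟨A', B, rfl, h3, h4⟩ := catCode_under_iff (C := C)
      (a := (catCode C).unpair.2.unpair.1) (b := (catCode C).unpair.2.unpair.2)
      |>.1 (by rw [Nat.pair_unpair, ← h1, Nat.pair_unpair])
    rw [← h3] at h2
    obtain rfl := catCode_injective h2
    exact ⟨B, rfl, by simp [h4.symm]⟩
  · rintro ⟨B, rfl, rfl⟩
    simp [catCode]

theorem codeElimR_eq_some {Δ Γ : List (Cat ℕ)} {A C : Cat ℕ} {z : List ℕ × ℕ} :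
    codeElimR (sequentCode Γ C) (sequentCode Δ A) = some z ↔
      ∃ B, C = .over B A ∧ z = sequentCode (Γ ++ Δ) B := by
  unfold codeElimR sequentCode
  simp only [Option.ite_none_right_eq_some, Option.some.injEq]
  constructor
  · rintro ⟨⟨h1, h2⟩, rfl⟩
    obtain ⟨B, A', rfl, h3, h4⟩ := catCode_over_iff (C := C)
      (b := (catCode C).unpair.2.unpair.1) (a := (catCode C).unpair.2.unpair.2)
      |>.1 (by rw [Nat.pair_unpair, ← h1, Nat.pair_unpair])
    rw [← h4] at h2
    obtain rfl := catCode_injective h2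
    exact ⟨B, rfl, by simp [h3.symm]⟩
  · rintro ⟨B, rfl, rfl⟩
    simp [catCode]

/-- The frame and the labels of the hypotheses determine the sequent, so trying all labels with
codes below `B`, also for the cancelled hypotheses, yields a finite list. -/
theorem mem_typings {B : ℕ} {f : NDTree Unit} : ∀ {z : List ℕ × ℕ}, z ∈ typings B (frameCode f) ↔
    ∃ d Γ C, Derives d Γ C ∧ d.erase = f ∧ (∀ A ∈ d.labels, catCode A < B) ∧
      z = sequentCode Γ C := by
  induction f with
  | hyp a =>
    intro z
    simp only [frameCode, typings_zero, List.mem_filterMap, List.mem_range, Option.map_eq_some_iff]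
    constructor
    · rintro ⟨c, hc, x, hx, rfl⟩
      obtain ⟨A, rfl⟩ := exists_catCode_eq (c := c) (by simp [hx])
      exact ⟨.hyp A, [A], A, .hyp A, rfl, by simpa [NDTree.labels] using hc, rfl⟩
    · rintro ⟨d, Γ, C, hd, he, hl, rfl⟩
      cases hd with
      | hyp A =>
        exact ⟨catCode C, hl C (by simp [NDTree.labels]), _, baseList_catCode C, rfl⟩
      | _ => simp [NDTree.erase] at he
  | introL f ih =>
    intro z
    simp only [frameCode, typings_introL, List.mem_filterMap, ih]
    constructor
    · rintro ⟨_, ⟨d, Γ, C, hd, he, hl, rfl⟩, h⟩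
      obtain ⟨A, Γ', rfl, hne, rfl⟩ := codeIntroL_eq_some.1 h
      exact ⟨.introL d, Γ', _, .introL hne hd, by simp [NDTree.erase, he], hl, rfl⟩
    · rintro ⟨d, Γ, C, hd, he, hl, rfl⟩
      cases hd with
      | introL hne hd =>
        exact ⟨_, ⟨_, _, _, hd, by simpa [NDTree.erase] using he, hl, rfl⟩,
          codeIntroL_eq_some.2 ⟨_, _, rfl, hne, rfl⟩⟩
      | _ => simp [NDTree.erase] at he
  | introR f ih =>
    intro z
    simp only [frameCode, typings_introR, List.mem_filterMap, ih]
    constructor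
    · rintro ⟨_, ⟨d, Γ, C, hd, he, hl, rfl⟩, h⟩
      obtain ⟨A, Γ', rfl, hne, rfl⟩ := codeIntroR_eq_some.1 h
      exact ⟨.introR d, Γ', _, .introR hne hd, by simp [NDTree.erase, he], hl, rfl⟩
    · rintro ⟨d, Γ, C, hd, he, hl, rfl⟩
      cases hd with
      | introR hne hd =>
        exact ⟨_, ⟨_, _, _, hd, by simpa [NDTree.erase] using he, hl, rfl⟩,
          codeIntroR_eq_some.2 ⟨_, _, rfl, hne, rfl⟩⟩
      | _ => simp [NDTree.erase] at he
  | elimL f g ihf ihg =>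
    intro z
    simp only [frameCode, typings_elimL, List.mem_flatMap, List.mem_filterMap, ihf, ihg]
    constructor
    · rintro ⟨_, ⟨d, Γ, C, hd, he, hl, rfl⟩, _, ⟨d', Γ', C', hd', he', hl', rfl⟩, h⟩
      obtain ⟨D, rfl, rfl⟩ := codeElimL_eq_some.1 h
      refine ⟨.elimL d d', _, D, .elimL hd hd', by simp [NDTree.erase, he, he'], ?_, rfl⟩
      simp only [NDTree.labels, List.mem_append]
      exact fun A hA => hA.elim (hl A) (hl' A)
    · rintro ⟨d, Γ, C, hd, he, hl, rfl⟩
      cases hd with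
      | elimL h1 h2 =>
        simp only [NDTree.erase, NDTree.elimL.injEq] at he
        simp only [NDTree.labels, List.mem_append] at hl
        exact ⟨_, ⟨_, _, _, h1, he.1, fun A hA => hl A (.inl hA), rfl⟩, _,
          ⟨_, _, _, h2, he.2, fun A hA => hl A (.inr hA), rfl⟩,
          codeElimL_eq_some.2 ⟨_, rfl, rfl⟩⟩
      | _ => simp [NDTree.erase] at he
  | elimR f g ihf ihg =>
    intro z
    simp only [frameCode, typings_elimR, List.mem_flatMap, List.mem_filterMap, ihf, ihg]
    constructor
    · rintro ⟨_, ⟨d, Γ, C, hd, he, hl, rfl⟩, _, ⟨d', Γ', C', hd', he', hl', rfl⟩, h⟩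
      obtain ⟨D, rfl, rfl⟩ := codeElimR_eq_some.1 h
      refine ⟨.elimR d d', _, D, .elimR hd hd', by simp [NDTree.erase, he, he'], ?_, rfl⟩
      simp only [NDTree.labels, List.mem_append]
      exact fun A hA => hA.elim (hl A) (hl' A)
    · rintro ⟨d, Γ, C, hd, he, hl, rfl⟩
      cases hd with
      | elimR h1 h2 =>
        simp only [NDTree.erase, NDTree.elimR.injEq] at he
        simp only [NDTree.labels, List.mem_append] at hl
        exact ⟨_, ⟨_, _, _, h1, he.1, fun A hA => hl A (.inl hA), rfl⟩, _,
          ⟨_, _, _, h2, he.2, fun A hA => hl A (.inr hA), rfl⟩,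
          codeElimR_eq_some.2 ⟨_, rfl, rfl⟩⟩
      | _ => simp [NDTree.erase] at he

theorem primrec_typings : Primrec₂ typings := by
  have pair2 : ∀ {α : Type} [Primcodable α] {f g : α → ℕ} (t : ℕ), Primrec f → Primrec g →
      Primrec fun a => Nat.pair t (Nat.pair (f a) (g a)) := fun t hf hg =>
    Primrec₂.natPair.comp (Primrec.const t) (Primrec₂.natPair.comp hf hg)
  have hlen2 : PrimrecPred fun x : List ℕ × ℕ => 2 ≤ x.1.length :=
    Primrec.nat_le.comp (Primrec.const 2) (Primrec.list_length.comp Primrec.fst)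
  have hIL : Primrec codeIntroL :=
    Primrec.ite hlen2 (Primrec.option_some.comp (Primrec.pair (Primrec.list_tail.comp Primrec.fst)
      (pair2 2 (Primrec.list_headI.comp Primrec.fst) Primrec.snd))) (Primrec.const none)
  have hrev : Primrec fun x : List ℕ × ℕ => x.1.reverse := Primrec.list_reverse.comp Primrec.fst
  have hIR : Primrec codeIntroR :=
    Primrec.ite hlen2 (Primrec.option_some.comp (Primrec.pair
      (Primrec.list_reverse.comp (Primrec.list_tail.comp hrev))
      (pair2 3 Primrec.snd (Primrec.list_headI.comp hrev)))) (Primrec.const none)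
  have hx : Primrec fun p : (List ℕ × ℕ) × (List ℕ × ℕ) => p.1.2 := Primrec.snd.comp Primrec.fst
  have hy : Primrec fun p : (List ℕ × ℕ) × (List ℕ × ℕ) => p.2.2 := Primrec.snd.comp Primrec.snd
  have happ : Primrec fun p : (List ℕ × ℕ) × (List ℕ × ℕ) => p.1.1 ++ p.2.1 :=
    Primrec.list_append.comp (Primrec.fst.comp Primrec.fst) (Primrec.fst.comp Primrec.snd)
  have hEL : Primrec₂ codeElimL := by
    have hu := Primrec.unpair.comp hy
    have hv := Primrec.unpair.comp (Primrec.snd.comp hu)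
    exact Primrec.ite ((Primrec.eq.comp (Primrec.fst.comp hu) (Primrec.const 2)).and
      (Primrec.eq.comp (Primrec.fst.comp hv) hx))
      (Primrec.option_some.comp (Primrec.pair happ (Primrec.snd.comp hv))) (Primrec.const none)
  have hER : Primrec₂ codeElimR := by
    have hu := Primrec.unpair.comp hx
    have hv := Primrec.unpair.comp (Primrec.snd.comp hu)
    exact Primrec.ite ((Primrec.eq.comp (Primrec.fst.comp hu) (Primrec.const 3)).and
      (Primrec.eq.comp (Primrec.snd.comp hv) hy))
      (Primrec.option_some.comp (Primrec.pair happ (Primrec.fst.comp hv))) (Primrec.const none)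
  have hn : Primrec fun p : ℕ × List (List (List ℕ × ℕ)) => p.2.length :=
    Primrec.list_length.comp Primrec.snd
  have hu := Primrec.unpair.comp hn
  have hv := Primrec.unpair.comp (Primrec.snd.comp hu)
  have ht : ∀ k, PrimrecPred fun p : ℕ × List (List (List ℕ × ℕ)) => p.2.length.unpair.1 = k :=
    fun k => Primrec.eq.comp (Primrec.fst.comp hu) (Primrec.const k)
  have hget : ∀ {f : ℕ × List (List (List ℕ × ℕ)) → ℕ}, Primrec f →
      Primrec fun p : ℕ × List (List (List ℕ × ℕ)) => p.2.getD (f p) [] :=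
    fun hf => (Primrec.list_getD []).comp Primrec.snd hf
  have hbin : ∀ {g : List ℕ × ℕ → List ℕ × ℕ → Option (List ℕ × ℕ)}, Primrec₂ g →
      Primrec fun p : ℕ × List (List (List ℕ × ℕ)) =>
        (p.2.getD p.2.length.unpair.2.unpair.1 []).flatMap fun x =>
          (p.2.getD p.2.length.unpair.2.unpair.2 []).filterMap fun y => g x y := by
    intro g hg
    refine Primrec.list_flatMap (hget (Primrec.fst.comp hv)) ?_
    refine Primrec.listFilterMap ((hget (Primrec.snd.comp hv)).comp Primrec.fst) ?_
    exact hg.comp (Primrec.snd.comp Primrec.fst) Primrec.snd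
  have hbase : Primrec fun p : ℕ × List (List (List ℕ × ℕ)) =>
      (List.range p.1).filterMap fun a => (baseList a).map fun _ => ([a], a) := by
    refine Primrec.listFilterMap (Primrec.list_range.comp Primrec.fst) ?_
    refine Primrec.option_map (primrec_baseList.comp Primrec.snd) ?_
    exact Primrec.pair (Primrec.list_cons.comp (Primrec.snd.comp Primrec.fst) (Primrec.const []))
      (Primrec.snd.comp Primrec.fst)
  have hstep : Primrec₂ typingsStep := by
    refine Primrec.ite (Primrec.eq.comp hn (Primrec.const 0)) hbase ?_
    refine Primrec.ite (ht 1) ?_ (Primrec.ite (ht 2) ?_ (Primrec.ite (ht 3) (hbin hEL) (hbin hER)))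
    · exact Primrec.listFilterMap (hget (Primrec.snd.comp hu)) (hIL.comp Primrec.snd)
    · exact Primrec.listFilterMap (hget (Primrec.snd.comp hu)) (hIR.comp Primrec.snd)
  exact primrec_listRec hstep

end Lambek


namespace Lambek

universe u v

/-! ### Subformula property -/

/-- Only subcategories of the sequent occur in a normal deduction, and a code bounds those of its
subcategories. Without a final introduction the conclusion is itself a part of the hypothesis that
ends the principal branch, so no bound on it is needed. -/
theorem Derives.catCode_le {N : ℕ} {d : NDTree (Cat ℕ)} {Γ : List (Cat ℕ)} {C : Cat ℕ}
    (h : Derives d Γ C) (hn : d.Normal) (hΓ : ∀ A ∈ Γ, catCode A ≤ N) :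
    (¬ d.IsIntro → catCode C ≤ N ∧ ∀ A ∈ d.labels, catCode A ≤ N) ∧
      (catCode C ≤ N → ∀ A ∈ d.labels, catCode A ≤ N) := by
  have parts : ∀ t a b : ℕ, Nat.pair t (Nat.pair a b) ≤ N → a ≤ N ∧ b ≤ N := fun t a b hN =>
    ⟨((Nat.left_le_pair a b).trans (Nat.right_le_pair t _)).trans hN,
      ((Nat.right_le_pair a b).trans (Nat.right_le_pair t _)).trans hN⟩
  induction h with
  | hyp A =>
    have hA := hΓ A (by simp)
    exact ⟨fun _ => ⟨hA, by simpa [NDTree.labels] using hA⟩,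
      fun _ => by simpa [NDTree.labels] using hA⟩
  | @introL d A B Γ hne h ih =>
    refine ⟨fun h => absurd trivial h, fun hC => ?_⟩
    obtain ⟨hA, hB⟩ := parts _ _ _ hC
    refine (ih hn ?_).2 hB
    simp only [List.mem_cons]
    rintro D (rfl | hD)
    · exact hA
    · exact hΓ D hD
  | @introR d A B Γ hne h ih =>
    refine ⟨fun h => absurd trivial h, fun hC => ?_⟩
    obtain ⟨hB, hA⟩ := parts _ _ _ hC
    refine (ih hn ?_).2 hB
    simp only [List.mem_append, List.mem_singleton]
    rintro D (hD | rfl)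
    · exact hΓ D hD
    · exact hA
  | @elimL arg fn A B Δ Γ h1 h2 ih1 ih2 =>
    obtain ⟨hf, hl⟩ := (ih2 hn.2.1 fun D hD => hΓ D (by simp [hD])).1 hn.2.2
    obtain ⟨hA, hB⟩ := parts _ _ _ hf
    have hall : ∀ D ∈ (NDTree.elimL arg fn).labels, catCode D ≤ N := by
      simp only [NDTree.labels, List.mem_append]
      rintro D (hD | hD)
      · exact (ih1 hn.1 fun D hD => hΓ D (by simp [hD])).2 hA D hD
      · exact hl D hD
    exact ⟨fun _ => ⟨hB, hall⟩, fun _ => hall⟩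
  | @elimR fn arg A B Γ Δ h2 h1 ih2 ih1 =>
    obtain ⟨hf, hl⟩ := (ih2 hn.1 fun D hD => hΓ D (by simp [hD])).1 hn.2.2
    obtain ⟨hB, hA⟩ := parts _ _ _ hf
    have hall : ∀ D ∈ (NDTree.elimR fn arg).labels, catCode D ≤ N := by
      simp only [NDTree.labels, List.mem_append]
      rintro D (hD | hD)
      · exact hl D hD
      · exact (ih1 hn.2.1 fun D hD => hΓ D (by simp [hD])).2 hA D hD
    exact ⟨fun _ => ⟨hB, hall⟩, fun _ => hall⟩

/-! ### Codes of lexicons -/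

namespace Lexicon

variable {W : Type v} {V : Type u} {m : ℕ}

/-- The rigid grammar given by a lexicon. -/
def toGrammar (K : Lexicon W V) : Grammar W V := fun w => (K w).toFinset

theorem rigid_toGrammar (K : Lexicon W V) : K.toGrammar.Rigid := by
  intro w
  unfold toGrammar
  cases K w <;> simp

theorem exists_toGrammar_eq {G : Grammar W V} (hG : G.Rigid) : ∃ K : Lexicon W V, K.toGrammar = G := by
  have h : ∀ w, ∃ o : Option (Cat V), o.toFinset = G w := by
    intro w
    rcases Nat.le_one_iff_eq_zero_or_eq_one.1 (hG w) with h | h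
    · exact ⟨none, by simp [Finset.card_eq_zero.1 h]⟩
    · obtain ⟨c, hc⟩ := Finset.card_eq_one.1 h
      exact ⟨some c, by simp [hc]⟩
  choose K hK using h
  exact ⟨K, funext hK⟩

theorem assigns_toGrammar {K : Lexicon W V} {ws : List W} {cs : List (Cat V)} :
    K.toGrammar.Assigns ws cs ↔ ws.map K = cs.map some := by
  unfold Grammar.Assigns toGrammar
  induction ws generalizing cs with
  | nil => cases cs <;> simp
  | cons w ws ih =>
    cases cs with
    | nil => simp
    | cons c cs =>
      rw [List.forall₂_cons, ih, List.map_cons, List.map_cons, List.cons.injEq, Option.mem_toFinset,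
        Option.mem_def]

theorem ndLanguage_toGrammar (K : Lexicon W V) : K.toGrammar.ndLanguage = K.language := by
  ext ⟨ws, f⟩
  constructor
  · rintro ⟨cs, hcs, d, hd⟩
    exact ⟨cs, assigns_toGrammar.1 hcs, d.1, d.2.1, d.2.2, hd⟩
  · rintro ⟨cs, hcs, d, h1, h2, hd⟩
    exact ⟨cs, assigns_toGrammar.2 hcs, ⟨d, h1, h2⟩, hd⟩

/-- The code of an entry. -/
def entryCode : Option (Cat ℕ) → ℕ
  | none => 0
  | some A => catCode A + 1

theorem entryCode_injective : Function.Injective entryCode := by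
  intro o o' h
  cases o <;> cases o' <;> simp only [entryCode, Nat.add_right_cancel_iff] at h
  · rfl
  · omega
  · omega
  · rw [catCode_injective h]

/-- The code of a lexicon. -/
def toCode (K : Lexicon (Fin m) ℕ) : List ℕ := List.ofFn fun w => entryCode (K w)

theorem getD_toCode (K : Lexicon (Fin m) ℕ) (w : Fin m) :
    K.toCode.getD w 0 = entryCode (K w) := by
  simp [toCode]

theorem toCode_injective : Function.Injective (toCode (m := m)) := by
  intro K K' h
  funext w
  apply entryCode_injective
  rw [← getD_toCode, h, getD_toCode]

/-- All entries are codes. -/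
def IsCode (m : ℕ) (l : List ℕ) : Prop :=
  l.length = m ∧ ∀ c ∈ l, c = 0 ∨ (baseList (c - 1)).isSome = true

theorem isCode_toCode (K : Lexicon (Fin m) ℕ) : IsCode m K.toCode := by
  refine ⟨by simp [toCode], fun c hc => ?_⟩
  obtain ⟨w, rfl⟩ := (List.mem_ofFn' _ _).1 hc
  simp only
  cases K w with
  | none => exact .inl rfl
  | some A => exact .inr (by simp [entryCode, baseList_catCode])

theorem IsCode.exists_toCode {l : List ℕ} (h : IsCode m l) :
    ∃ K : Lexicon (Fin m) ℕ, K.toCode = l := by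
  obtain ⟨rfl, h⟩ := h
  have h' : ∀ w : Fin l.length, ∃ o, entryCode o = l[w] := by
    intro w
    rcases h _ (List.getElem_mem w.2) with h0 | h0
    · exact ⟨none, h0.symm⟩
    · obtain ⟨A, hA⟩ := exists_catCode_eq h0
      by_cases h1 : l[w] = 0
      · exact ⟨none, h1.symm⟩
      · refine ⟨some A, ?_⟩
        have h2 : l[(w : ℕ)] ≠ 0 := h1
        change catCode A + 1 = l[(w : ℕ)]
        omega
  choose K hK using h'
  refine ⟨K, ?_⟩
  simp only [toCode, hK]
  exact List.ofFn_getElem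

/-- The codes of the base categories of all entries. -/
def codeBases (l : List ℕ) : List ℕ :=
  l.flatMap fun c => if c = 0 then [] else (baseList (c - 1)).getD []

theorem codeBases_toCode (K : Lexicon (Fin m) ℕ) :
    codeBases K.toCode = (List.finRange m).flatMap fun w => (K.entry w).map baseCode := by
  rw [codeBases, toCode, List.ofFn_eq_map, List.flatMap_map]
  congr 1
  funext w
  unfold entry
  cases K w with
  | none => rfl
  | some A => simp [entryCode, baseList_catCode]

theorem length_codeBases (K : Lexicon (Fin m) ℕ) : (codeBases K.toCode).length = K.weight := by
  rw [codeBases_toCode, List.length_flatMap, weight, Fin.sum_univ_def]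
  simp

theorem mem_codeBases {K : Lexicon (Fin m) ℕ} {v : ℕ} :
    v + 1 ∈ codeBases K.toCode ↔ v ∈ K.support := by
  rw [codeBases_toCode, mem_support]
  simp only [List.mem_flatMap, List.mem_finRange, true_and, List.mem_map]
  refine exists_congr fun w => ?_
  constructor
  · rintro ⟨b, hb, h⟩
    cases b with
    | s => simp [baseCode] at h
    | var n => obtain rfl : n = v := by simpa [baseCode] using h
               exact hb
  · exact fun h => ⟨_, h, rfl⟩

theorem small_iff {K : Lexicon (Fin m) ℕ} :
    K.Small ↔ ∀ x ∈ codeBases K.toCode, x ≤ (codeBases K.toCode).length := by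
  rw [length_codeBases]
  constructor
  · intro h x hx
    cases x with
    | zero => exact Nat.zero_le _
    | succ x => exact h x (mem_codeBases.1 hx)
  · exact fun h x hx => h _ (mem_codeBases.2 hx)

/-- The key of the lexicon with a given code. -/
def codeKey (l : List ℕ) : ℕ :=
  (codeBases l).length * ((codeBases l).length + 1) +
    ((List.range (codeBases l).length).filter fun v => decide (∀ x ∈ codeBases l, x ≠ v + 1)).length

/-- In a small lexicon all variables are below the weight, so counting the unused numbers below the
weight gives the second summand of the key. -/
theorem codeKey_toCode {K : Lexicon (Fin m) ℕ} (h : K.Small) : codeKey K.toCode = K.key := by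
  classical
  have h1 : ((List.range K.weight).filter fun v =>
      decide (∀ x ∈ codeBases K.toCode, x ≠ v + 1)).length = (Finset.range K.weight \ K.support).card := by
    rw [← List.toFinset_card_of_nodup (List.nodup_range.filter _)]
    congr 1
    ext v
    simp only [List.mem_toFinset, List.mem_filter, List.mem_range, decide_eq_true_eq,
      Finset.mem_sdiff, Finset.mem_range, ← mem_codeBases (K := K)]
    refine and_congr_right fun _ => ⟨fun h hv => h _ hv rfl, fun h x hx hv => h (hv ▸ hx)⟩
  rw [codeKey, length_codeBases, h1, key, Finset.card_sdiff_of_subset, Finset.card_range]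
  exact fun x hx => Finset.mem_range.2 (h x hx)

/-- The lexicon with a given code generates the structured sentence. -/
def CodeGenerates (l : List ℕ) (e : List (Fin m) × ℕ) : Prop :=
  (∀ w ∈ e.1, l.getD w 0 ≠ 0) ∧
    ∃ z ∈ typings (l.foldr (· + ·) 0 + 1) e.2, z = (e.1.map fun w : Fin m => l.getD (w : ℕ) 0 - 1, 0)

theorem map_eq_map_some_iff {K : Lexicon (Fin m) ℕ} {ws : List (Fin m)} {Γ : List (Cat ℕ)} :
    ws.map K = Γ.map some ↔ (∀ w ∈ ws, K.toCode.getD w 0 ≠ 0) ∧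
      (ws.map fun w : Fin m => K.toCode.getD (w : ℕ) 0 - 1) = Γ.map catCode := by
  simp only [getD_toCode]
  induction ws generalizing Γ with
  | nil => cases Γ <;> simp
  | cons w ws ih =>
    cases Γ with
    | nil => simp
    | cons A Γ =>
      simp only [List.map_cons, List.cons.injEq, ih, List.forall_mem_cons]
      have : K w = some A ↔ entryCode (K w) ≠ 0 ∧ entryCode (K w) - 1 = catCode A := by
        cases K w with
        | none => simp [entryCode]
        | some B => simp [entryCode, catCode_injective.eq_iff]
      rw [this]
      tauto

/-- The bound on the labels loses nothing, by the subformula property: each code of an entry is at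
most the sum of the list, and the conclusion `s` has code 0. Normality is a property of the frame,
so it need not be tested label by label. -/
theorem codeGenerates_iff {K : Lexicon (Fin m) ℕ} {ws : List (Fin m)} {f : NDTree Unit}
    (hf : f.Normal) : CodeGenerates K.toCode (ws, frameCode f) ↔ (ws, f) ∈ K.language := by
  unfold CodeGenerates
  simp only [mem_typings]
  constructor
  · rintro ⟨h1, _, ⟨d, Γ, C, hd, he, -, rfl⟩, h2⟩
    simp only [sequentCode, Prod.mk.injEq] at h2
    obtain rfl : C = Cat.s := catCode_injective h2.2
    exact ⟨Γ, map_eq_map_some_iff.2 ⟨h1, h2.1.symm⟩, d, hd,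
      d.normal_erase.1 (by rw [he]; exact hf), he⟩
  · rintro ⟨Γ, hΓ, d, hd, hn, he⟩
    simp only at hΓ he
    obtain ⟨h1, h2⟩ := map_eq_map_some_iff.1 hΓ
    refine ⟨h1, _, ⟨d, Γ, _, hd, he, fun A hA => Nat.lt_succ_of_le ?_, rfl⟩, ?_⟩
    · refine (hd.catCode_le hn fun B hB => ?_).2 (Nat.zero_le _) A hA
      have hB' : some B ∈ ws.map K := by rw [hΓ]; exact List.mem_map_of_mem hB
      obtain ⟨w, -, hw⟩ := List.mem_map.1 hB'
      have hmem : catCode B + 1 ∈ K.toCode := (List.mem_ofFn' _ _).2 ⟨w, by simp [hw, entryCode]⟩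
      have := List.le_sum_of_mem hmem
      rw [List.sum_eq_foldr] at this
      omega
    · rw [sequentCode, ← h2]
      rfl

/-- The code of the grammar, from the code of the lexicon. -/
def codeGrammar (l : List ℕ) : List (List ℕ) := l.map fun c => if c = 0 then [] else [c - 1]

theorem grammarCode_toGrammar (K : Lexicon (Fin m) ℕ) :
    grammarCode K.toGrammar = codeGrammar K.toCode := by
  rw [grammarCode, codeGrammar, toCode, List.map_ofFn]
  congr 1
  funext w
  simp only [toGrammar, Function.comp]
  cases K w <;> simp [entryCode]

/-! ### Finitely many lexicons of bounded weight -/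

theorem finite_cats (b k : ℕ) :
    {A : Cat ℕ | A.bases.length ≤ k ∧ ∀ x ∈ A.bases, baseCode x ≤ b}.Finite := by
  have hbase : {x : Base ℕ | baseCode x ≤ b}.Finite := by
    refine Set.Finite.preimage (Function.Injective.injOn ?_) (Set.finite_Iic b)
    intro x y h
    cases x <;> cases y <;> simp_all [baseCode]
  induction k with
  | zero =>
    refine Set.finite_empty.subset fun A hA => ?_
    have := A.length_bases_pos
    have := hA.1
    omega
  | succ k ih =>
    refine ((hbase.image Cat.base).union ((ih.image2 Cat.under ih).union (ih.image2 Cat.over ih))).subset ?_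
    rintro (x | ⟨A, B⟩ | ⟨B, A⟩) ⟨h1, h2⟩
    · exact .inl ⟨x, h2 x (by simp [Cat.bases]), rfl⟩
    · have := A.length_bases_pos
      have := B.length_bases_pos
      simp only [Cat.bases, List.length_append, List.mem_append] at h1 h2
      exact .inr (.inl ⟨A, ⟨by omega, fun x hx => h2 x (.inl hx)⟩, B,
        ⟨by omega, fun x hx => h2 x (.inr hx)⟩, rfl⟩)
    · have := A.length_bases_pos
      have := B.length_bases_pos
      simp only [Cat.bases, List.length_append, List.mem_append] at h1 h2
      exact .inr (.inr ⟨B, ⟨by omega, fun x hx => h2 x (.inl hx)⟩, A,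
        ⟨by omega, fun x hx => h2 x (.inr hx)⟩, rfl⟩)

/-- The key bounds the weight, the weight bounds the length of each category and, by smallness, its
variables. -/
theorem finite_small (m k : ℕ) : {K : Lexicon (Fin m) ℕ | K.Small ∧ K.key ≤ k}.Finite := by
  have h := Set.Finite.pi' (fun _ : Fin m => ((finite_cats k k).image some).insert none)
  refine h.subset fun (K : Lexicon (Fin m) ℕ) ⟨hK, hk⟩ w => ?_
  have hw : K.weight ≤ k := by
    have : K.weight ≤ K.key := by unfold key; nlinarith
    omega
  cases h : K w with
  | none => exact .inl rfl
  | some A =>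
    refine .inr ⟨A, ⟨?_, fun x hx => ?_⟩, rfl⟩
    · rw [← entry_of_some h]
      exact (Finset.single_le_sum (f := fun w => (K.entry w).length) (fun _ _ => Nat.zero_le _)
        (Finset.mem_univ w)).trans hw
    · cases x with
      | s => exact Nat.zero_le _
      | var v =>
        have := hK v (mem_support.2 ⟨w, by rwa [entry_of_some h]⟩)
        change v + 1 ≤ k
        omega

end Lexicon

end Lambek


namespace Lambek

/-! ### The learning function -/

namespace Lexicon

variable {m : ℕ}

/-- The code of a lexicon with a given number. -/
def numbered (n : ℕ) : List ℕ := (Encodable.decode (α := List ℕ) n).getD []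

theorem numbered_encode (l : List ℕ) : numbered (Encodable.encode l) = l := by
  simp [numbered]

/-- The coded sentences `p.1` are generated by the lexicon which is tried at stage `p.2`: its number
is the remainder, its key the quotient of the division by the number of sentences. -/
def Accepts (p : List (List (Fin m) × ℕ) × ℕ) : Prop :=
  IsCode m (numbered (p.2 % p.1.length)) ∧
  (∀ x ∈ codeBases (numbered (p.2 % p.1.length)),
    x ≤ (codeBases (numbered (p.2 % p.1.length))).length) ∧
  codeKey (numbered (p.2 % p.1.length)) = p.2 / p.1.length ∧
  ∀ e ∈ p.1, CodeGenerates (numbered (p.2 % p.1.length)) e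

theorem accepts_iff {D : List (List (Fin m) × NDTree Unit)} (hD : ∀ e ∈ D, e.2.Normal) {t : ℕ} :
    Accepts (D.map fun e => (e.1, frameCode e.2), t) ↔
      ∃ K : Lexicon (Fin m) ℕ, numbered (t % D.length) = K.toCode ∧ K.Small ∧
        K.key = t / D.length ∧ ∀ e ∈ D, e ∈ K.language := by
  simp only [Accepts, List.length_map, List.forall_mem_map]
  constructor
  · rintro ⟨h1, h2, h3, h4⟩
    obtain ⟨K, hK⟩ := h1.exists_toCode
    rw [← hK] at h2 h3 h4
    have hs := small_iff.2 h2
    exact ⟨K, hK.symm, hs, by rw [← h3, codeKey_toCode hs],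
      fun e he => (codeGenerates_iff (hD e he)).1 (h4 e he)⟩
  · rintro ⟨K, hK, hs, h3, h4⟩
    rw [hK]
    exact ⟨isCode_toCode K, small_iff.1 hs, by rw [codeKey_toCode hs, h3],
      fun e he => (codeGenerates_iff (hD e he)).2 (h4 e he)⟩

-- Primitive recursiveness of the acceptance test

theorem primrec_codeBases : Primrec codeBases := by
  refine Primrec.list_flatMap Primrec.id ?_
  refine Primrec.ite (Primrec.eq.comp Primrec.snd (Primrec.const 0)) (Primrec.const []) ?_
  exact Primrec.option_getD.comp (primrec_baseList.comp (Primrec.pred.comp Primrec.snd))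
    (Primrec.const [])

theorem primrec_codeKey : Primrec codeKey := by
  have hlen : Primrec fun l => (codeBases l).length := Primrec.list_length.comp primrec_codeBases
  have hrel : PrimrecRel fun (v : ℕ) (l : List ℕ) => ∀ x ∈ l, x ≠ v + 1 := by
    have h : PrimrecRel fun (x v : ℕ) => x ≠ v + 1 :=
      PrimrecPred.not (Primrec.eq.comp Primrec.fst (Primrec.succ.comp Primrec.snd))
    exact h.forall_mem_list.comp Primrec.snd Primrec.fst
  exact Primrec.nat_add.comp (Primrec.nat_mul.comp hlen (Primrec.succ.comp hlen))
    (Primrec.list_length.comp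
      (hrel.listFilter.comp (Primrec.list_range.comp hlen) primrec_codeBases))

theorem primrecRel_codeGenerates : PrimrecRel (CodeGenerates (m := m)) := by
  have hget : Primrec fun p : Fin m × List ℕ => p.2.getD (p.1 : ℕ) 0 :=
    (Primrec.list_getD 0).comp Primrec.snd (Primrec.fin_val.comp Primrec.fst)
  have h1 : PrimrecRel fun (w : Fin m) (l : List ℕ) => l.getD (w : ℕ) 0 ≠ 0 :=
    PrimrecPred.not (Primrec.eq.comp hget (Primrec.const 0))
  have h2 : PrimrecPred fun p : List ℕ × (List (Fin m) × ℕ) =>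
      ∀ w ∈ p.2.1, p.1.getD (w : ℕ) 0 ≠ 0 :=
    h1.forall_mem_list.comp (Primrec.fst.comp Primrec.snd) Primrec.fst
  have hadd : Primrec₂ fun (_ : List ℕ × (List (Fin m) × ℕ)) (q : ℕ × ℕ) => q.1 + q.2 :=
    Primrec.nat_add.comp (Primrec.fst.comp Primrec.snd) (Primrec.snd.comp Primrec.snd)
  have hsum : Primrec fun p : List ℕ × (List (Fin m) × ℕ) => p.1.foldr (· + ·) 0 + 1 :=
    Primrec.succ.comp (Primrec.list_foldr Primrec.fst (Primrec.const 0) hadd)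
  have hty := primrec_typings.comp hsum (Primrec.snd.comp Primrec.snd)
  have hmap : Primrec fun p : List ℕ × (List (Fin m) × ℕ) =>
      (p.2.1.map fun w : Fin m => p.1.getD (w : ℕ) 0 - 1, 0) := by
    refine Primrec.pair (Primrec.list_map (Primrec.fst.comp Primrec.snd) ?_) (Primrec.const 0)
    exact Primrec.pred.comp (hget.comp (Primrec.pair Primrec.snd (Primrec.fst.comp Primrec.fst)))
  have heq : PrimrecRel fun (z y : List ℕ × ℕ) => z = y := Primrec.eq
  exact PrimrecPred.and h2 (heq.exists_mem_list.comp hty hmap)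

theorem primrec_numbered : Primrec numbered :=
  Primrec.option_getD.comp Primrec.decode (Primrec.const [])

theorem primrecPred_isCode : PrimrecPred (IsCode m) := by
  have h : PrimrecPred fun c : ℕ => c = 0 ∨ (baseList (c - 1)).isSome = true :=
    PrimrecPred.or (Primrec.eq.comp Primrec.id (Primrec.const 0))
      (Primrec.eq.comp (Primrec.option_isSome.comp (primrec_baseList.comp Primrec.pred))
        (Primrec.const true))
  exact PrimrecPred.and (Primrec.eq.comp Primrec.list_length (Primrec.const m)) h.forall_mem_list

theorem primrecPred_accepts : PrimrecPred (Accepts (m := m)) := by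
  have hlen : Primrec fun p : List (List (Fin m) × ℕ) × ℕ => p.1.length :=
    Primrec.list_length.comp Primrec.fst
  have hn : Primrec fun p : List (List (Fin m) × ℕ) × ℕ => numbered (p.2 % p.1.length) :=
    primrec_numbered.comp (Primrec.nat_mod.comp Primrec.snd hlen)
  have hb := primrec_codeBases.comp hn
  have hle : PrimrecRel fun x y : ℕ => x ≤ y := Primrec.nat_le
  have hgen : PrimrecRel fun (e : List (Fin m) × ℕ) (l : List ℕ) => CodeGenerates l e :=
    primrecRel_codeGenerates.comp Primrec.snd Primrec.fst
  exact PrimrecPred.and (primrecPred_isCode.comp hn) (PrimrecPred.and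
    (hle.forall_mem_list.comp hb (Primrec.list_length.comp hb)) (PrimrecPred.and
      (Primrec.eq.comp (primrec_codeKey.comp hn) (Primrec.nat_div.comp Primrec.snd hlen))
      (hgen.forall_mem_list.comp Primrec.fst hn)))

open Classical in
/-- The first stage at which a lexicon is accepted. -/
noncomputable def firstStage (D : List (List (Fin m) × ℕ)) : Part ℕ :=
  Nat.rfind fun t => Part.some (decide (Accepts (D, t)))

theorem mem_firstStage {D : List (List (Fin m) × ℕ)} {t : ℕ} :
    t ∈ firstStage D ↔ Accepts (D, t) ∧ ∀ t' < t, ¬ Accepts (D, t') := by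
  classical
  have h : ∀ {b : Bool} {p : Prop} [Decidable p], b ∈ Part.some (decide p) ↔ b = decide p :=
    Part.mem_some_iff
  refine Nat.mem_rfind.trans (and_congr (h.trans ?_) (forall₂_congr fun _ _ => h.trans ?_)) <;>
    simp

theorem partrec_firstStage : Partrec (firstStage (m := m)) := by
  classical
  refine Partrec.rfind ?_
  have h := primrecPred_accepts (m := m).decide
  exact h.to_comp.partrec

open Classical in
/-- The lexicon with a given code. -/
noncomputable def ofCode (m : ℕ) (l : List ℕ) : Lexicon (Fin m) ℕ :=
  if h : ∃ K : Lexicon (Fin m) ℕ, K.toCode = l then h.choose else fun _ => none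

theorem ofCode_toCode (K : Lexicon (Fin m) ℕ) : ofCode m K.toCode = K := by
  have h : ∃ K' : Lexicon (Fin m) ℕ, K'.toCode = K.toCode := ⟨K, rfl⟩
  rw [ofCode, dif_pos h]
  exact toCode_injective h.choose_spec

/-- The learning function. -/
noncomputable def learner (D : List (List (Fin m) × NDTree Unit)) : Part (Grammar (Fin m) ℕ) :=
  (firstStage (D.map fun e => (e.1, frameCode e.2))).map fun t =>
    (ofCode m (numbered (t % D.length))).toGrammar

theorem effective_learner : Effective (learner (m := m)) := by
  refine ⟨fun D => (firstStage D).map fun t => codeGrammar (numbered (t % D.length)),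
    Partrec.map partrec_firstStage ?_, fun D => ?_⟩
  · refine Primrec.to_comp ?_
    refine Primrec.list_map (primrec_numbered.comp (Primrec.nat_mod.comp Primrec.snd
      (Primrec.list_length.comp Primrec.fst))) ?_
    exact Primrec.ite (Primrec.eq.comp Primrec.snd (Primrec.const 0)) (Primrec.const [])
      (Primrec.list_cons.comp (Primrec.pred.comp Primrec.snd) (Primrec.const []))
  · ext x
    simp only [learner, Part.mem_map_iff, exists_exists_and_eq_and]
    refine exists_congr fun t => and_congr_right fun ht => ?_
    -- An accepted number is the number of a code, so the default value of `ofCode` is not used.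
    obtain ⟨K, hK⟩ := (mem_firstStage.1 ht).1.1.exists_toCode
    simp only [List.length_map] at hK ⊢
    rw [← hK, ofCode_toCode, grammarCode_toGrammar]

-- Convergence of the learner

theorem isLearningFunction_learner :
    IsLearningFunction {G : Grammar (Fin m) ℕ | G.Rigid} Grammar.ndLanguage (learner (m := m)) := by
  classical
  refine ⟨fun D H hH => ?_, fun G hG e he => ?_⟩
  · obtain ⟨t, -, rfl⟩ := (Part.mem_map_iff _).1 hH
    exact rigid_toGrammar _
  obtain ⟨K₀, rfl⟩ := exists_toGrammar_eq hG
  rw [ndLanguage_toGrammar] at he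
  have hnormal : ∀ i, (e i).2.Normal := by
    intro i
    have : e i ∈ K₀.language := he ▸ Set.mem_range_self i
    obtain ⟨Γ, -, d, -, hd, hd'⟩ := this
    rw [← hd']
    exact d.normal_erase.2 hd
  -- the best candidate
  let Cand : ℕ → ℕ → Prop := fun k n => ∃ K : Lexicon (Fin m) ℕ, numbered n = K.toCode ∧ K.Small ∧
    K₀.language ⊆ K.language ∧ K.key = k
  have hCand : ∀ K : Lexicon (Fin m) ℕ, K.Small → K₀.language ⊆ K.language →
      Cand K.key (Encodable.encode K.toCode) := fun K h1 h2 => ⟨K, numbered_encode _, h1, h2, rfl⟩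
  have hex : ∃ k n, Cand k n := by
    obtain ⟨K, h1, h2, -⟩ := K₀.exists_small
    exact ⟨_, _, hCand K h1 h2⟩
  -- The limit is the candidate with the least key `k` and, among those, the least number `n`; its
  -- key being minimal, it generates exactly the language.
  obtain ⟨k, hk, hkmin⟩ : ∃ k, (∃ n, Cand k n) ∧ ∀ k', (∃ n, Cand k' n) → k ≤ k' :=
    ⟨Nat.find hex, Nat.find_spec hex, fun k' => Nat.find_min' hex⟩
  obtain ⟨n, hn, hnmin⟩ : ∃ n, Cand k n ∧ ∀ n', Cand k n' → n ≤ n' :=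
    ⟨Nat.find hk, Nat.find_spec hk, fun n' => Nat.find_min' hk⟩
  obtain ⟨H, hH1, hH2, hH3, hH4⟩ := hn
  have hlang : H.language = K₀.language := by
    refine Set.Subset.antisymm (language_subset_of_key_le hH3 fun H' h1 h2 => ?_) hH3
    rw [hH4]
    exact hkmin _ ⟨_, hCand H' h1 h2⟩
  -- the stage from which the smaller candidates are refuted
  have hrefute : ∀ K : Lexicon (Fin m) ℕ, ∃ i, ¬ K₀.language ⊆ K.language → e i ∉ K.language := by
    intro K
    by_cases h : K₀.language ⊆ K.language
    · exact ⟨0, fun h' => absurd h h'⟩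
    · obtain ⟨x, hx, hxK⟩ := Set.not_subset.1 h
      obtain ⟨i, rfl⟩ := he.symm ▸ hx
      exact ⟨i, fun _ => hxK⟩
  choose r hr using hrefute
  -- Each small lexicon with key at most `k` that misses some sentence of the language misses one of
  -- `e 0, …, e M`.
  obtain ⟨M, hM⟩ := ((finite_small m k).image r).bddAbove
  -- With more than `M` sentences all these refutations have been seen; with more than `n`, the
  -- number `n` is a possible remainder.
  refine ⟨max M n + 1, H.toGrammar, by rw [ndLanguage_toGrammar, ndLanguage_toGrammar, hlang],
    fun P hP => ?_⟩
  have hnP : n < P := by omega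
  have hmod : (P * k + n) % P = n := by rw [Nat.mul_add_mod, Nat.mod_eq_of_lt hnP]
  have hdiv : (P * k + n) / P = k := by
    rw [Nat.mul_add_div (by omega), Nat.div_eq_of_lt hnP, Nat.add_zero]
  have hD : ∀ x ∈ (List.range P).map e, x.2.Normal := by
    intro x hx
    obtain ⟨i, -, rfl⟩ := List.mem_map.1 hx
    exact hnormal i
  have hlen : ((List.range P).map e).length = P := by simp
  -- Stages compare the key (quotient) before the number (remainder). An earlier accepted stage has
  -- key at most `k` and is not refuted, hence is a candidate; so its key is `k` and its number at
  -- least `n`, which makes it no earlier.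
  have hstage : P * k + n ∈ firstStage (((List.range P).map e).map fun e => (e.1, frameCode e.2)) := by
    refine mem_firstStage.2 ⟨(accepts_iff hD).2 ⟨H, ?_, hH2, ?_, fun x hx => ?_⟩, fun t ht hacc => ?_⟩
    · rw [hlen, hmod, hH1]
    · rw [hlen, hdiv, hH4]
    · obtain ⟨i, -, rfl⟩ := List.mem_map.1 hx
      exact hH3 (he ▸ Set.mem_range_self i)
    · obtain ⟨K, h1, h2, h3, h4⟩ := (accepts_iff hD).1 hacc
      rw [hlen] at h1 h3
      have hle : t / P ≤ k := by
        rw [← hdiv]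
        exact Nat.div_le_div_right ht.le
      have hsub : K₀.language ⊆ K.language := by
        by_contra hsub
        have hrM : r K ≤ M := hM ⟨K, ⟨h2, by omega⟩, rfl⟩
        exact hr K hsub (h4 _ (List.mem_map_of_mem (List.mem_range.2 (by omega))))
      have hkt : t / P = k := le_antisymm hle (hkmin _ ⟨_, K, h1, h2, hsub, h3⟩)
      have hnt : n ≤ t % P := hnmin _ ⟨K, h1, h2, hsub, h3.trans hkt⟩
      have := Nat.div_add_mod t P
      rw [hkt] at this
      omega
  refine Part.eq_some_iff.2 ((Part.mem_map_iff _).2 ⟨_, hstage, ?_⟩)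
  rw [hlen, hmod, hH1, ofCode_toCode]

end Lexicon

end Lambek

-- The three statements together

theorem mainTheorem2 (V : Type*) (W : Type*) (m : ℕ) :
    -- cut-free proof nets and normal natural deductions
    (∀ (Γ : List (Lambek.Cat V)) (C : Lambek.Cat V),
      ∃ e : Lambek.NormalDeduction Γ C ≃ Lambek.ProofNet Γ C,
        (∀ (d : Lambek.NormalDeduction Γ C) (π : Lambek.Struct V),
          Lambek.Translates d.1 π ↔ ∃ h : π.IsNetOf Γ C, e d = Lambek.ProofNet.mk π h) ∧
        (∀ (π : Lambek.Struct V) (h : π.IsNetOf Γ C),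
          (∃! t : Lambek.LTerm (Lambek.PTree V) V, Lambek.Reads π t) ∧
          ∀ t : Lambek.LTerm (Lambek.PTree V) V, Lambek.Reads π t →
            t.HasType (π.dropLast.reverse.zip Γ) C ∧ t.vars.Nodup ∧
            t.toND = (e.symm (Lambek.ProofNet.mk π h)).1)) ∧
    -- s proof frames and name-free natural deductions
    (∃ F : Lambek.NDFrame V ≃ Lambek.ProofFrame,
      (∀ (Γ : List (Lambek.Cat V)) (d : Lambek.NormalDeduction Γ Lambek.Cat.s)
          (π : Lambek.Struct V), Lambek.Translates d.1 π →
        ∃ h : Lambek.IsProofFrame π.frame, F d.frame = Lambek.ProofFrame.mk π.frame h) ∧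
      (∀ (G : Lambek.Grammar W V) (ws : List W) (f : Lambek.NDFrame V),
        (ws, f.1) ∈ G.ndLanguage ↔ (ws, F f) ∈ G.spfLanguage)) ∧
    -- learnability of rigid grammars from natural deduction frames
    (∃ φ : List (List (Fin m) × Lambek.NDTree Unit) →. Lambek.Grammar (Fin m) ℕ,
      Lambek.Effective φ ∧
      Lambek.IsLearningFunction {G : Lambek.Grammar (Fin m) ℕ | G.Rigid}
        Lambek.Grammar.ndLanguage φ) := by
  exact ⟨fun Γ C => Lambek.exists_equiv Γ C, Lambek.exists_frameEquiv V W,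
    Lambek.Lexicon.learner, Lambek.Lexicon.effective_learner,
    Lambek.Lexicon.isLearningFunction_learner⟩
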